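/- **Theorem (Comparison principle and contraction).** Let $(M,d)$ be a proper metric space, $\mu$ a locally finite (hence $\sigma$-finite) Borel measure on $M$, and $q\in(1,\infty)$. For $u:M\to\mathbb R$ let $|Du|(x)=\limsup_{y\to x}\frac{|u(y)-u(x)|}{d(y,x)}$ ($=0$ at isolated points). A function $g\in L^q(M,\mu)$ is a *$q$-relaxed slope* of $f\in L^2(M,\mu)$ if there are Lipschitz functions $u_n\in L^2(M,\mu)$ with $|Du_n|\in L^q(M,\mu)$ such that $u_n\to f$ strongly in $L^2$ and $|Du_n|$ converges weakly in $L^q$ to some $\tilde g$ with $\tilde g\le g$ a.e.; $|\nabla f|_*$ denotes the $q$-relaxed slope of $f$ of minimal $L^q$-norm. The *$q$-Cheeger energy* is $\operatorname{Ch}_q(f)=\frac1q\int|\nabla f|_*^q\,d\mu$ if $f$ has a $q$-relaxed slope, and $\operatorname{Ch}_q(f)=\infty$ otherwise. For $\operatorname{Ch}_q(f)<\infty$, $\partial^-\operatorname{Ch}_q(f)$ is the set of $\ell\in L^2(M,\mu)$ with $\int\ell(g-f)\,d\mu\le\operatorname{Ch}_q(g)-\operatorname{Ch}_q(f)$ for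 all $g\in L^2(M,\mu)$; it is empty if $\operatorname{Ch}_q(f)=\infty$. A *$q$-heat flow* (gradient flow of $\operatorname{Ch}_q$) starting from $f_0\in L^2(M,\mu)$ is a curve $(f_t)_{t\ge0}$ in $L^2(M,\mu)$ that is locally Lipschitz on $(0,\infty)$, satisfies $f_t\to f_0$ in $L^2$ as $t\downarrow0$, and $\frac{d}{dt}f_t\in-\partial^-\operatorname{Ch}_q(f_t)$ for a.e. $t>0$. Let $f_t$ and $g_t$ be $q$-heat flows starting from $f_0,g_0\in L^2(M,\mu)$. All pointwise inequalities are understood $\mu$-a.e. 1. (Comparison principle) Let $C,c\in\mathbb R$. If $f_0\le C$ (resp. $f_0\ge c$), then $f_t\le C$ (resp. $f_t\ge c$) for every $t\ge0$. If $f_0\le g_0+C$, then $f_t\le g_t+C$ for every $t\ge0$. 2. (Contraction) Let $e:\mathbb R\to[-l,\infty]$ ($l\in\mathbb R$) be convex and lower semicontinuous, and suppose that $E(h)=\int e(h)\,d\mu$ is well defined with values in $(-\infty,\infty]$ on $L^2(M,\mu)$, i.e. the negative part of $e(h)$ is integrable for every $h\in L^2(M,\mu)$ (automatic if $\mu(M)<\infty$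 or $e\ge0$). Then, for every $t\ge0$, $$E(f_t)\le E(f_0)\qquad\text{and}\qquad E(f_t-g_t)\le E(f_0-g_0).$$ In particular, if $r\in[1,\infty]$ and $f_0,g_0\in L^2(M,\mu)\cap L^r(M,\mu)$, then $f_t,g_t\in L^r(M,\mu)$ and $\|f_t-g_t\|_r\le\|f_0-g_0\|_r$ for every $t\ge0$. 3. (Energy identity) Let $e:\mathbb R\to[0,\infty)$ be convex and differentiable with locally absolutely continuous derivative $e'$ (for instance, $e'$ locally Lipschitz), and let $e''$ be its a.e. defined second derivative, with the value $0$ assigned where $e'$ is not differentiable. If $E(f_0)=\int e(f_0)\,d\mu<\infty$, then $$E(f_t)+\int_0^t\int e''(f_s)\,|\nabla f_s|_*^q\,d\mu\,ds=E(f_0)\qquad\text{for every }t\ge0.$$ 4. (Mass preservation) If $\mu(M)<\infty$, then $\int f_t\,d\mu=\int f_0\,d\mu$ for every $t\ge0$. -/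

import Mathlib

open MeasureTheory Filter Topology
open scoped ENNReal NNReal

noncomputable section

namespace QHeat

/-- The local Lipschitz constant `|Df|(x) = limsup_{y → x} |f y - f x| / d(y, x)`
(equal to `0` at an isolated point). -/
def lipConst {M : Type*} [MetricSpace M] (f : M → ℝ) (x : M) : ℝ≥0∞ :=
  limsup (fun y => edist (f y) (f x) / edist y x) (𝓝[≠] x)

/-- `g ∈ L^q` is a `q`-relaxed slope of `f ∈ L²`: there are Lipschitz functions `u n` in `L²`
with `|D(u n)| ∈ L^q` such that `u n → f` strongly in `L²` and `|D(u n)|` converges weakly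
in `L^q` to some `g'` with `g' ≤ g` almost everywhere. -/
def IsRelaxedSlope {M : Type*} [MetricSpace M] [MeasurableSpace M] (q : ℝ≥0∞) [Fact (1 ≤ q)]
    (μ : Measure M) (f : Lp ℝ 2 μ) (g : Lp ℝ q μ) : Prop :=
  ∃ (u : ℕ → M → ℝ) (hu : ∀ n, MemLp (u n) 2 μ)
    (hD : ∀ n, MemLp (fun x => (lipConst (u n) x).toReal) q μ) (g' : Lp ℝ q μ),
    (∀ n, ∃ K : ℝ≥0, LipschitzWith K (u n)) ∧
    Tendsto (fun n => (hu n).toLp (u n)) atTop (𝓝 f) ∧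
    (∀ L : Lp ℝ q μ →L[ℝ] ℝ, Tendsto (fun n => L ((hD n).toLp _)) atTop (𝓝 (L g'))) ∧
    g' ≤ g

/-- `g` is a `q`-relaxed slope of `f` of minimal `L^q`-norm. -/
def IsMinRelaxedSlope {M : Type*} [MetricSpace M] [MeasurableSpace M] (q : ℝ≥0∞)
    [Fact (1 ≤ q)] (μ : Measure M) (f : Lp ℝ 2 μ) (g : Lp ℝ q μ) : Prop :=
  IsRelaxedSlope q μ f g ∧ ∀ g₁ : Lp ℝ q μ, IsRelaxedSlope q μ f g₁ → ‖g‖ ≤ ‖g₁‖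

open Classical in
/-- The function `|∇f|_*`: the `q`-relaxed slope of `f` of minimal `L^q`-norm. For `1 < q < ∞`
it exists and is unique as soon as `f` has a `q`-relaxed slope; otherwise the value is `0`. -/
def relaxedSlope {M : Type*} [MetricSpace M] [MeasurableSpace M] (q : ℝ≥0∞) [Fact (1 ≤ q)]
    (μ : Measure M) (f : Lp ℝ 2 μ) : Lp ℝ q μ :=
  if h : ∃ g, IsMinRelaxedSlope q μ f g then h.choose else 0

open Classical in
/-- The `q`-Cheeger energy `Ch_q(f) = (1/q) ∫ |∇f|_*^q dμ`, equal to `∞` when `f` has no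
`q`-relaxed slope. -/
def cheeger {M : Type*} [MetricSpace M] [MeasurableSpace M] (q : ℝ≥0∞) [Fact (1 ≤ q)]
    (μ : Measure M) (f : Lp ℝ 2 μ) : ℝ≥0∞ :=
  if ∃ g, IsRelaxedSlope q μ f g then
    q⁻¹ * ∫⁻ x, ‖relaxedSlope q μ f x‖ₑ ^ q.toReal ∂μ
  else ⊤

/-- `l ∈ ∂⁻Ch_q(f)`: `f ∈ D(Ch_q)` and `∫ l (g - f) dμ ≤ Ch_q(g) - Ch_q(f)` for all `g ∈ L²`. -/
def IsSubgradient {M : Type*} [MetricSpace M] [MeasurableSpace M] (q : ℝ≥0∞) [Fact (1 ≤ q)]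
    (μ : Measure M) (f l : Lp ℝ 2 μ) : Prop :=
  cheeger q μ f ≠ ⊤ ∧
    ∀ g : Lp ℝ 2 μ,
      (cheeger q μ f : EReal) + ((∫ x, l x * (g x - f x) ∂μ : ℝ) : EReal) ≤ cheeger q μ g

/-- `t ↦ f t` is the gradient flow of `Ch_q` in `L²(M, μ)` starting from `f₀` (only `t ≥ 0`
matters): it is locally Lipschitz in `(0, ∞)`, converges to `f 0 = f₀` as `t → 0+`, and
`d/dt f t ∈ -∂⁻Ch_q(f t)` for almost every `t > 0`. -/
structure IsHeatFlow {M : Type*} [MetricSpace M] [MeasurableSpace M] (q : ℝ≥0∞) [Fact (1 ≤ q)]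
    (μ : Measure M) (f₀ : Lp ℝ 2 μ) (f : ℝ → Lp ℝ 2 μ) : Prop where
  init : f 0 = f₀
  tendsto : Tendsto f (𝓝[>] 0) (𝓝 f₀)
  locLip : LocallyLipschitzOn (Set.Ioi 0) f
  deriv_mem : ∀ᵐ t ∂(volume.restrict (Set.Ioi (0 : ℝ))),
    ∃ l : Lp ℝ 2 μ, IsSubgradient q μ (f t) l ∧ HasDerivAt f (-l) t

/-- Convexity of an extended-real-valued function on the line that never takes the
value `-∞`. -/
def IsConvex (e : ℝ → EReal) : Prop :=
  ∀ x y a b : ℝ, 0 < a → 0 < b → a + b = 1 →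
    e (a * x + b * y) ≤ (a : EReal) * e x + (b : EReal) * e y

/-- The integral of the negative part of `e ∘ f`. -/
def negPart {M : Type*} [MeasurableSpace M] (μ : Measure M) (e : ℝ → EReal)
    (f : Lp ℝ 2 μ) : ℝ≥0∞ :=
  ∫⁻ x, (-e (f x)).toENNReal ∂μ

/-- `E(f) = ∫ e(f) dμ`, the integral of the positive part minus that of the negative part. -/
def energy {M : Type*} [MeasurableSpace M] (μ : Measure M) (e : ℝ → EReal)
    (f : Lp ℝ 2 μ) : EReal :=
  ((∫⁻ x, (e (f x)).toENNReal ∂μ : ℝ≥0∞) : EReal) - (negPart μ e f : EReal)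

end QHeat

end

/-! The subdifferential of the Cheeger energy satisfies two properties that carry the theorem.

*`T`-monotonicity* (`inner_superpose_nonneg`): if `l ∈ ∂⁻Ch_q(f)`, `l' ∈ ∂⁻Ch_q(g)` and `ψ` is
nondecreasing and Lipschitz, then `∫ ψ(f - g) (l - l') ≥ 0`. With `η = ε ψ` and `ε` small, the
chain rule bounds the slopes of `f - η(f - g)` and `g + η(f - g)` by complementary convex combinations of
`|∇f|_*` and `|∇g|_*`, so that, by convexity of `r ↦ r ^ q`, the sum of the two energies does not
exceed `Ch_q(f) + Ch_q(g)`; the claim is the sum of the two subgradient inequalities. Hence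
`∫ m(f t - g t)` is nonincreasing along two heat flows for every convex `m` of class `C^{1,1}`. A
nonnegative convex lower semicontinuous `e` is the increasing limit of such functions, its
Moreau–Yosida regularizations, which gives `IsHeatFlow.lintegral_sub_le`. The comparison principle
is the case of the indicator function (`0` on a closed interval, `∞` outside), the contraction in
`L^r` that of the powers, and `g = 0` is a heat flow. An integrand with negative values is reduced
to a nonnegative one by adding a constant if `μ` is finite; if `μ` is infinite, the negative part of
`e` can be integrable along all of `L²` only if `e 0 > 0`, when the right-hand side is infinite, or
`e ≥ 0`.

*The Euler equation* (`inner_superpose_primitive`): if `l ∈ ∂⁻Ch_q(f)`, then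
`∫ l φ(f) = ∫ φ'(f) |∇f|_*^q`. For `φ` of class `C¹` it follows from the variations `f ± ε φ(f)`,
whose slopes the chain rule bounds by `(1 ± ε φ'(f)) |∇f|_*`. Both sides are integrals of `φ'`
against finite signed measures on the line, so the equation persists for bounded measurable `φ'`.
Integrated along the flow, it is the energy identity for bounded `e''`; the general case is the
monotone limit of the truncations of `e''`. The constant `φ = 1` gives mass preservation.

The chain rule has to be available for the minimal relaxed slope, which is defined through weak
limits in `L^q`. Closed convex sets being weakly closed, all relaxed slopes belong to the fibres of
a strongly closed convex set, `slopeGraph`, to which the chain rule for Lipschitz functions passes by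
strong limits (`sub_superpose_mem_slopeGraph`). Conversely, by uniform convexity of `L^q` on
nonnegative functions, the element of minimal norm of a fibre is a relaxed slope, hence the minimal
one (`exists_isRelaxedSlope_minimal`). -/

noncomputable section

namespace QHeat

/-! ### Calculus of the local Lipschitz constant -/

section

lemma limsup_add_le_ennreal {ι : Type*} {f : Filter ι} (F G : ι → ℝ≥0∞) :
    limsup (fun i => F i + G i) f ≤ limsup F f + limsup G f := by
  refine ENNReal.le_of_forall_pos_le_add fun ε hε hlt => ?_
  have hε2 : ((ε / 2 : ℝ≥0) : ℝ≥0∞) ≠ 0 := by simpa using hε.ne'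
  have hF := ENNReal.lt_add_right (ne_top_of_lt (lt_of_le_of_lt le_self_add hlt)) hε2
  have hG := ENNReal.lt_add_right (ne_top_of_lt (lt_of_le_of_lt le_add_self hlt)) hε2
  refine limsup_le_of_le (h := ?_)
  filter_upwards [eventually_lt_of_limsup_lt hF, eventually_lt_of_limsup_lt hG] with i h1 h2
  refine (add_le_add h1.le h2.le).trans (le_of_eq ?_)
  rw [add_add_add_comm, ← ENNReal.coe_add, add_halves]

/-- The common source of the sum rule and the chain rule: the coefficients in the bound for the
increments of `w` need only converge at `x`. -/
lemma lipConst_le_of_eventually_le {M : Type*} [MetricSpace M] {u v w : M → ℝ} {x : M}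
    {A B : M → ℝ≥0∞} {α β : ℝ≥0∞} (hA : Tendsto A (𝓝[≠] x) (𝓝 α))
    (hB : Tendsto B (𝓝[≠] x) (𝓝 β)) (hα : α ≠ ⊤) (hβ : β ≠ ⊤)
    (hu : lipConst u x ≠ ⊤) (hv : lipConst v x ≠ ⊤)
    (h : ∀ᶠ y in 𝓝[≠] x, edist (w y) (w x) ≤ A y * edist (u y) (u x) + B y * edist (v y) (v x)) :
    lipConst w x ≤ α * lipConst u x + β * lipConst v x := by
  rcases (𝓝[≠] x).eq_or_neBot with hbot | hne
  · simp [lipConst, hbot]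
  have key : ∀ (A : M → ℝ≥0∞) (α : ℝ≥0∞) (u : M → ℝ), Tendsto A (𝓝[≠] x) (𝓝 α) → α ≠ ⊤ →
      lipConst u x ≠ ⊤ →
      limsup (fun y => A y * (edist (u y) (u x) / edist y x)) (𝓝[≠] x) ≤ α * lipConst u x := by
    intro A α u hA hα hu
    have := ENNReal.limsup_mul_le' (f := 𝓝[≠] x) (u := A)
      (v := fun y => edist (u y) (u x) / edist y x) (.inr hu) (.inl (by rwa [hA.limsup_eq]))
    rw [hA.limsup_eq] at this
    exact this
  set F : M → ℝ≥0∞ := fun y => A y * (edist (u y) (u x) / edist y x)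
  set G : M → ℝ≥0∞ := fun y => B y * (edist (v y) (v x) / edist y x)
  have h1 : lipConst w x ≤ limsup (F + G) (𝓝[≠] x) := by
    refine limsup_le_limsup ?_
    filter_upwards [h] with y hy
    calc edist (w y) (w x) / edist y x
        ≤ (A y * edist (u y) (u x) + B y * edist (v y) (v x)) / edist y x :=
          ENNReal.div_le_div_right hy _
      _ = (F + G) y := by rw [ENNReal.add_div, mul_div_assoc, mul_div_assoc]; rfl
  have h2 : limsup (F + G) (𝓝[≠] x) ≤ limsup F (𝓝[≠] x) + limsup G (𝓝[≠] x) :=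
    limsup_add_le_ennreal F G
  exact h1.trans (h2.trans (add_le_add (key A α u hA hα hu) (key B β v hB hβ hv)))

lemma lipConst_le_of_lipschitzWith {M : Type*} [MetricSpace M] {u : M → ℝ} {K : ℝ≥0}
    (hu : LipschitzWith K u) (x : M) : lipConst u x ≤ K := by
  refine limsup_le_of_le (h := ?_)
  filter_upwards with y
  exact ENNReal.div_le_of_le_mul (hu y x)

lemma lipConst_ne_top {M : Type*} [MetricSpace M] {u : M → ℝ} {K : ℝ≥0}
    (hu : LipschitzWith K u) (x : M) : lipConst u x ≠ ⊤ :=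
  ne_top_of_le_ne_top ENNReal.coe_ne_top (lipConst_le_of_lipschitzWith hu x)

/-- The upper limit is an infimum over radii of suprema of difference quotients, and each of these
suprema is lower semicontinuous in the base point. -/
lemma measurable_lipConst {M : Type*} [MetricSpace M] [MeasurableSpace M] [BorelSpace M]
    {u : M → ℝ} (hu : Continuous u) : Measurable (lipConst u) := by
  set S : ℕ → M → ℝ≥0∞ := fun n x =>
    ⨆ y ∈ {y : M | y ≠ x ∧ dist y x < 1 / ((n : ℝ) + 1)}, edist (u y) (u x) / edist y x with hS
  have h1 : lipConst u = fun x => ⨅ n, S n x := by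
    ext x
    have hb : (𝓝[≠] x).HasBasis (fun _ : ℕ => True)
        (fun n => {y : M | y ≠ x ∧ dist y x < 1 / ((n : ℝ) + 1)}) := by
      have := nhdsWithin_hasBasis (Metric.nhds_basis_ball_inv_nat_succ (x := x)) {x}ᶜ
      refine this.to_hasBasis ?_ ?_
      · intro n _
        exact ⟨n, trivial, fun y hy => ⟨hy.2, hy.1⟩⟩
      · intro n _
        exact ⟨n, trivial, fun y hy => ⟨hy.2, hy.1⟩⟩
    rw [lipConst, hb.limsup_eq_iInf_iSup]
    simp [hS]
  rw [h1]
  refine Measurable.iInf fun n => ?_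
  refine LowerSemicontinuous.measurable ?_
  intro x c hc
  simp only [hS, lt_iSup_iff] at hc
  obtain ⟨y, ⟨hy1, hy2⟩, hy3⟩ := hc
  have hcont : ContinuousAt (fun x => edist (u y) (u x) / edist y x) x := by
    refine ENNReal.Tendsto.div ?_ (.inr ?_) ?_ (.inl ?_)
    · exact (continuous_const.edist hu).continuousAt
    · simpa using hy1
    · exact (continuous_const.edist continuous_id).continuousAt
    · exact edist_ne_top _ _
  have e1 : ∀ᶠ z in 𝓝 x, c < edist (u y) (u z) / edist y z := hcont.eventually_const_lt hy3
  have e2 : ∀ᶠ z in 𝓝 x, dist y z < 1 / ((n : ℝ) + 1) :=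
    ((continuous_const.dist continuous_id).continuousAt (x := x)).eventually_lt_const hy2
  have e3 : ∀ᶠ z in 𝓝 x, z ≠ y := eventually_ne_nhds hy1.symm
  filter_upwards [e1, e2, e3] with z h1 h2 h3
  exact h1.trans_le (le_iSup₂_of_le y ⟨h3.symm, h2⟩ le_rfl)

/-- The chain rule for the local Lipschitz constant. For `0 ≤ η' ≤ 1` it says that the gradient of
`u - η (u - v)` is a convex combination of those of `u` and `v`. -/
lemma lipConst_sub_comp_sub_le {M : Type*} [MetricSpace M] {u v : M → ℝ} {K K' : ℝ≥0}
    (hu : LipschitzWith K u) (hv : LipschitzWith K' v) {η η' : ℝ → ℝ}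
    (hη : ∀ r, HasDerivAt η (η' r) r) (x : M) :
    lipConst (fun y => u y - η (u y - v y)) x ≤
      ‖1 - η' (u x - v x)‖ₑ * lipConst u x + ‖η' (u x - v x)‖ₑ * lipConst v x := by
  set r₀ := u x - v x
  -- the difference quotient of `η` at `r₀`, extended by the derivative
  set θ : M → ℝ := fun y => dslope η r₀ (u y - v y) with hθ
  have hcont : Tendsto θ (𝓝 x) (𝓝 (η' r₀)) := by
    have h1 : ContinuousAt (dslope η r₀) r₀ := continuousAt_dslope_same.2 (hη r₀).differentiableAt
    have h2 : Tendsto (fun y => u y - v y) (𝓝 x) (𝓝 r₀) :=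
      (hu.continuous.sub hv.continuous).continuousAt
    have := h1.tendsto.comp h2
    rwa [dslope_same, (hη r₀).deriv] at this
  have hc : Tendsto θ (𝓝[≠] x) (𝓝 (η' r₀)) := hcont.mono_left nhdsWithin_le_nhds
  refine lipConst_le_of_eventually_le (A := fun y => ‖1 - θ y‖ₑ) (B := fun y => ‖θ y‖ₑ)
    (tendsto_const_nhds.sub hc).enorm hc.enorm enorm_ne_top enorm_ne_top
    (lipConst_ne_top hu x) (lipConst_ne_top hv x) (Eventually.of_forall fun y => ?_)
  have h1 : η (u y - v y) - η r₀ = (u y - v y - r₀) * θ y := by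
    simpa [smul_eq_mul] using (sub_smul_dslope η r₀ (u y - v y)).symm
  simp only [edist_eq_enorm_sub]
  rw [← enorm_mul, ← enorm_mul]
  refine le_trans (le_of_eq ?_) (enorm_add_le _ _)
  congr 1
  linear_combination -h1

lemma lipConst_smul_add_smul_le {M : Type*} [MetricSpace M] {u v : M → ℝ} {K K' : ℝ≥0}
    (hu : LipschitzWith K u) (hv : LipschitzWith K' v) (a b : ℝ) (x : M) :
    lipConst (fun y => a * u y + b * v y) x ≤ ‖a‖ₑ * lipConst u x + ‖b‖ₑ * lipConst v x := by
  refine lipConst_le_of_eventually_le tendsto_const_nhds tendsto_const_nhds enorm_ne_top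
    enorm_ne_top (lipConst_ne_top hu x) (lipConst_ne_top hv x) (Eventually.of_forall fun y => ?_)
  simp only [edist_eq_enorm_sub]
  rw [← enorm_mul, ← enorm_mul]
  refine le_trans (le_of_eq ?_) (enorm_add_le _ _)
  congr 1
  ring

end

/-! ### Uniform convexity of `L^q` on the cone of nonnegative functions -/

section

lemma rpow_half_add_le {p : ℝ} (hp : 1 ≤ p) {a b : ℝ} (ha : 0 ≤ a) (hb : 0 ≤ b) :
    ((a + b) / 2) ^ p ≤ (a ^ p + b ^ p) / 2 := by
  have := (convexOn_rpow hp).2 (Set.mem_Ici.2 ha) (Set.mem_Ici.2 hb)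
    (by norm_num : (0 : ℝ) ≤ 1 / 2) (by norm_num : (0 : ℝ) ≤ 1 / 2) (by norm_num)
  simp only [smul_eq_mul] at this
  rw [show 1 / 2 * a + 1 / 2 * b = (a + b) / 2 by ring] at this
  linarith

/-- A quantitative form of the strict convexity of `r ↦ r ^ p` on `[0, ∞)`. By homogeneity it
reduces to `a = 1`, `b ∈ [0, 1]`, where it follows from compactness. -/
lemma exists_abs_sub_rpow_le {p : ℝ} (hp : 1 < p) {ε : ℝ} (hε : 0 < ε) :
    ∃ C, 0 ≤ C ∧ ∀ a b : ℝ, 0 ≤ a → 0 ≤ b →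
      |a - b| ^ p ≤ C * ((a ^ p + b ^ p) / 2 - ((a + b) / 2) ^ p) + ε * (a ^ p + b ^ p) := by
  have hp0 : 0 < p := by linarith
  set gap : ℝ → ℝ := fun t => (1 + t ^ p) / 2 - ((1 + t) / 2) ^ p with hgap
  have hgc : Continuous gap := by
    have h1 : Continuous fun t : ℝ => t ^ p := Real.continuous_rpow_const hp0.le
    exact ((continuous_const.add h1).div_const 2).sub
      (h1.comp ((continuous_const.add continuous_id).div_const 2))
  have hg0 : ∀ t, 0 ≤ t → 0 ≤ gap t := fun t ht => by
    have := rpow_half_add_le hp.le zero_le_one ht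
    rw [Real.one_rpow] at this
    simp only [hgap]; linarith
  have hgpos : ∀ t, 0 ≤ t → t < 1 → 0 < gap t := fun t ht ht1 => by
    have := (strictConvexOn_rpow hp).2 (Set.mem_Ici.2 zero_le_one) (Set.mem_Ici.2 ht) ht1.ne'
      (by norm_num : (0 : ℝ) < 1 / 2) (by norm_num : (0 : ℝ) < 1 / 2) (by norm_num)
    simp only [smul_eq_mul, Real.one_rpow] at this
    have e : (1 / 2 * 1 + 1 / 2 * t : ℝ) = (1 + t) / 2 := by ring
    rw [e] at this
    simp only [hgap]; linarith
  have hc : Continuous fun t : ℝ => |1 - t| ^ p :=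
    (Real.continuous_rpow_const hp0.le).comp (continuous_const.sub continuous_id).abs
  obtain ⟨C, hC0, hC⟩ : ∃ C, 0 ≤ C ∧ ∀ t, 0 ≤ t → t ≤ 1 → |1 - t| ^ p ≤ C * gap t + ε := by
    set S : Set ℝ := Set.Icc 0 1 ∩ {t | ε ≤ |1 - t| ^ p}
    have hS : IsCompact S := isCompact_Icc.inter_right (isClosed_le continuous_const hc)
    rcases S.eq_empty_or_nonempty with hSe | hSn
    · refine ⟨0, le_rfl, fun t h0 h1 => ?_⟩
      by_contra! hcon
      have : t ∈ S := ⟨⟨h0, h1⟩, by simp only [Set.mem_ofPred_eq]; linarith⟩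
      rw [hSe] at this; exact this
    · obtain ⟨t₀, ht₀, hmin⟩ := hS.exists_isMinOn hSn hgc.continuousOn
      have hlt : t₀ < 1 := by
        refine lt_of_le_of_ne ht₀.1.2 fun h => ?_
        have := ht₀.2
        simp only [Set.mem_ofPred_eq, h, sub_self, abs_zero, Real.zero_rpow hp0.ne'] at this
        linarith
      have hpos := hgpos t₀ ht₀.1.1 hlt
      refine ⟨1 / gap t₀, by positivity, fun t h0 h1 => ?_⟩
      by_cases ht : ε ≤ |1 - t| ^ p
      · have h2 : gap t₀ ≤ gap t := hmin (⟨⟨h0, h1⟩, ht⟩ : t ∈ S)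
        have h3 : |1 - t| ^ p ≤ 1 := by
          refine Real.rpow_le_one (abs_nonneg _) ?_ hp0.le
          rw [abs_of_nonneg (by linarith)]; linarith
        have h4 : 1 ≤ 1 / gap t₀ * gap t := by
          rw [one_div, inv_mul_eq_div, le_div_iff₀ hpos]; linarith
        linarith
      · have := mul_nonneg (by positivity : 0 ≤ 1 / gap t₀) (hg0 t h0)
        linarith
  have main : ∀ a b : ℝ, 0 ≤ b → b ≤ a →
      |a - b| ^ p ≤ C * ((a ^ p + b ^ p) / 2 - ((a + b) / 2) ^ p) + ε * (a ^ p + b ^ p) := by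
    intro a b hb hba
    rcases (hb.trans hba).eq_or_lt with h | ha
    · have hb0 : b = 0 := le_antisymm (by rw [h]; exact hba) hb
      subst hb0; rw [← h]; simp [Real.zero_rpow hp0.ne']
    · set t := b / a with ht
      have ht0 : 0 ≤ t := by positivity
      have ht1 : t ≤ 1 := (div_le_one ha).2 hba
      have hbt : b = a * t := by rw [ht]; field_simp
      have e1 : |a - b| ^ p = a ^ p * |1 - t| ^ p := by
        rw [← Real.mul_rpow ha.le (abs_nonneg _), hbt]
        congr 1
        rw [show a - a * t = a * (1 - t) by ring, abs_mul, abs_of_pos ha]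
      have e2 : (a ^ p + b ^ p) / 2 - ((a + b) / 2) ^ p = a ^ p * gap t := by
        have : (a + b) / 2 = a * ((1 + t) / 2) := by rw [hbt]; ring
        rw [this, Real.mul_rpow ha.le (by positivity), hbt, Real.mul_rpow ha.le ht0]
        simp only [hgap]; ring
      rw [e1, e2]
      have hap : 0 ≤ a ^ p := by positivity
      have hbp : 0 ≤ b ^ p := by positivity
      calc a ^ p * |1 - t| ^ p ≤ a ^ p * (C * gap t + ε) :=
            mul_le_mul_of_nonneg_left (hC t ht0 ht1) hap
        _ ≤ _ := by nlinarith [mul_nonneg hε.le hbp]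
  refine ⟨C, hC0, fun a b ha hb => ?_⟩
  rcases le_total b a with h | h
  · exact main a b hb h
  · have := main b a ha h
    rw [abs_sub_comm, add_comm b a, add_comm (b ^ p)] at this
    exact this

section Lp
variable {M : Type*} [MeasurableSpace M] {μ : Measure M} {q : ℝ≥0∞}

lemma integrable_abs_rpow (hq0 : q ≠ 0) (hq' : q ≠ ⊤) (d : Lp ℝ q μ) :
    Integrable (fun x => |d x| ^ q.toReal) μ := by
  simpa using (Lp.memLp d).integrable_norm_rpow hq0 hq'

lemma norm_rpow_eq_integral (hq0 : q ≠ 0) (hq' : q ≠ ⊤) (d : Lp ℝ q μ) :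
    ‖d‖ ^ q.toReal = ∫ x, |d x| ^ q.toReal ∂μ := by
  have hp : 0 < q.toReal := ENNReal.toReal_pos hq0 hq'
  have h0 : 0 ≤ ∫ x, ‖d x‖ ^ q.toReal ∂μ := integral_nonneg fun x => by positivity
  rw [Lp.norm_def, (Lp.memLp d).eLpNorm_eq_integral_rpow_norm hq0 hq',
    ENNReal.toReal_ofReal (by positivity), ← Real.rpow_mul h0, inv_mul_cancel₀ hp.ne',
    Real.rpow_one]
  simp only [Real.norm_eq_abs]

/-- Integrated form of `exists_abs_sub_rpow_le`: nonnegative functions of nearly equal norm whose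
midpoint has nearly the same norm are close in `L^q`. -/
lemma norm_sub_rpow_le [Fact (1 ≤ q)] (hq : 1 < q) (hq' : q ≠ ⊤) {ε C : ℝ}
    (hC : ∀ a b : ℝ, 0 ≤ a → 0 ≤ b → |a - b| ^ q.toReal ≤
      C * ((a ^ q.toReal + b ^ q.toReal) / 2 - ((a + b) / 2) ^ q.toReal) +
        ε * (a ^ q.toReal + b ^ q.toReal)) {d d' : Lp ℝ q μ} (hd : 0 ≤ d) (hd' : 0 ≤ d') :
    ‖d - d'‖ ^ q.toReal ≤ C * ((‖d‖ ^ q.toReal + ‖d'‖ ^ q.toReal) / 2 -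
      ‖(1 / 2 : ℝ) • d + (1 / 2 : ℝ) • d'‖ ^ q.toReal) +
        ε * (‖d‖ ^ q.toReal + ‖d'‖ ^ q.toReal) := by
  have hq0 : q ≠ 0 := (zero_lt_one.trans hq).ne'
  have i1 := integrable_abs_rpow hq0 hq' d
  have i2 := integrable_abs_rpow hq0 hq' d'
  have i3 := integrable_abs_rpow hq0 hq' ((1 / 2 : ℝ) • d + (1 / 2 : ℝ) • d')
  have i4 : Integrable (fun x => |d x| ^ q.toReal + |d' x| ^ q.toReal) μ := i1.add i2
  have i5 : Integrable (fun x => (|d x| ^ q.toReal + |d' x| ^ q.toReal) / 2 -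
      |((1 / 2 : ℝ) • d + (1 / 2 : ℝ) • d' : Lp ℝ q μ) x| ^ q.toReal) μ := (i4.div_const 2).sub i3
  simp only [norm_rpow_eq_integral hq0 hq']
  rw [← integral_add i1 i2, ← integral_div, ← integral_sub (i4.div_const 2) i3,
    ← integral_const_mul, ← integral_const_mul,
    ← integral_add (i5.const_mul C) (i4.const_mul ε)]
  refine integral_mono_ae (integrable_abs_rpow hq0 hq' (d - d'))
    ((i5.const_mul C).add (i4.const_mul ε)) ?_
  filter_upwards [Lp.coeFn_sub d d', Lp.coeFn_add ((1 / 2 : ℝ) • d) ((1 / 2 : ℝ) • d'),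
    Lp.coeFn_smul (1 / 2 : ℝ) d, Lp.coeFn_smul (1 / 2 : ℝ) d', (Lp.coeFn_nonneg d).2 hd,
    (Lp.coeFn_nonneg d').2 hd'] with x h1 h2 h3 h4 h5 h6
  simp only [Pi.zero_apply] at h5 h6
  have := hC (d x) (d' x) h5 h6
  simp only [Pi.add_apply, Pi.sub_apply, h1, h2, h3, h4, Pi.smul_apply, smul_eq_mul]
  rw [abs_of_nonneg h5, abs_of_nonneg h6,
    show 1 / 2 * d x + 1 / 2 * d' x = (d x + d' x) / 2 by ring,
    abs_of_nonneg (show 0 ≤ (d x + d' x) / 2 by linarith)]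
  exact this
end Lp

end

/-! ### The graph of upper slopes and the minimal relaxed slope -/

section

/-- The pairs `(u, d) ∈ L² × L^q` such that `u` has a Lipschitz representative whose local
Lipschitz constant is at most `d` almost everywhere. -/
def slopePairs {M : Type*} [MetricSpace M] [MeasurableSpace M] (q : ℝ≥0∞)
    (μ : Measure M) : Set (Lp ℝ 2 μ × Lp ℝ q μ) :=
  {z | ∃ v : M → ℝ, (∃ K : ℝ≥0, LipschitzWith K v) ∧ z.1 =ᵐ[μ] v ∧
    ∀ᵐ x ∂μ, (lipConst v x).toReal ≤ z.2 x}

/-- The strong closure of `slopePairs` in `L² × L^q`. Its fibre over `f` is a closed convex set,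
whose element of minimal norm is the minimal relaxed slope of `f`. -/
def slopeGraph {M : Type*} [MetricSpace M] [MeasurableSpace M] (q : ℝ≥0∞) [Fact (1 ≤ q)]
    (μ : Measure M) : Set (Lp ℝ 2 μ × Lp ℝ q μ) :=
  closure (slopePairs q μ)

variable {M : Type*} [MetricSpace M] [MeasurableSpace M] {μ : Measure M} {q : ℝ≥0∞}

lemma snd_nonneg_of_mem_slopePairs {z : Lp ℝ 2 μ × Lp ℝ q μ} (hz : z ∈ slopePairs q μ) :
    0 ≤ z.2 := by
  obtain ⟨v, -, -, h⟩ := hz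
  rw [← Lp.coeFn_nonneg]
  filter_upwards [h] with x hx
  exact ENNReal.toReal_nonneg.trans hx

lemma mem_slopePairs_of_le {u : Lp ℝ 2 μ} {d d' : Lp ℝ q μ} (hz : (u, d) ∈ slopePairs q μ)
    (h : d ≤ d') : (u, d') ∈ slopePairs q μ := by
  obtain ⟨v, hv, hu, hd⟩ := hz
  refine ⟨v, hv, hu, ?_⟩
  filter_upwards [hd, (Lp.coeFn_le d d').2 h] with x h1 h2
  exact h1.trans h2

lemma convex_slopePairs [Fact (1 ≤ q)] : Convex ℝ (slopePairs q μ) := by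
  rintro z ⟨v, ⟨K, hv⟩, hzv, hzd⟩ w ⟨v', ⟨K', hv'⟩, hwv, hwd⟩ a b ha hb -
  refine ⟨fun y => a * v y + b * v' y, ⟨‖a‖₊ * K + ‖b‖₊ * K', ?_⟩, ?_, ?_⟩
  · exact ((lipschitzWith_smul a).comp hv).add ((lipschitzWith_smul b).comp hv')
  · filter_upwards [hzv, hwv, Lp.coeFn_add (a • z.1) (b • w.1), Lp.coeFn_smul a z.1,
      Lp.coeFn_smul b w.1] with x h1 h2 h3 h4 h5
    simp only [Prod.fst_add, Prod.smul_fst, h3, Pi.add_apply, h4, h5, Pi.smul_apply, smul_eq_mul,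
      h1, h2]
  · filter_upwards [hzd, hwd, Lp.coeFn_add (a • z.2) (b • w.2), Lp.coeFn_smul a z.2,
      Lp.coeFn_smul b w.2] with x h1 h2 h3 h4 h5
    simp only [Prod.snd_add, Prod.smul_snd, h3, Pi.add_apply, h4, h5, Pi.smul_apply, smul_eq_mul]
    have f1 := ENNReal.mul_ne_top (enorm_ne_top (x := a)) (lipConst_ne_top hv x)
    have f2 := ENNReal.mul_ne_top (enorm_ne_top (x := b)) (lipConst_ne_top hv' x)
    have h6 := ENNReal.toReal_mono (ENNReal.add_ne_top.2 ⟨f1, f2⟩)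
      (lipConst_smul_add_smul_le hv hv' a b x)
    rw [ENNReal.toReal_add f1 f2, ENNReal.toReal_mul, ENNReal.toReal_mul, toReal_enorm,
      toReal_enorm, Real.norm_of_nonneg ha, Real.norm_of_nonneg hb] at h6
    refine h6.trans ?_
    gcongr

/-- The second component of an element of `slopePairs` can be lowered to the local Lipschitz
constant of a Lipschitz representative of the first. -/
lemma exists_lipConst_of_mem_slopePairs [BorelSpace M] {z : Lp ℝ 2 μ × Lp ℝ q μ}
    (hz : z ∈ slopePairs q μ) :
    ∃ (v : M → ℝ) (hv : MemLp v 2 μ) (hD : MemLp (fun x => (lipConst v x).toReal) q μ),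
      (∃ K : ℝ≥0, LipschitzWith K v) ∧ hv.toLp v = z.1 ∧
      (z.1, hD.toLp _) ∈ slopePairs q μ ∧ hD.toLp _ ≤ z.2 := by
  obtain ⟨v, ⟨K, hvK⟩, hzv, hzd⟩ := hz
  have hv : MemLp v 2 μ := (memLp_congr_ae hzv).1 (Lp.memLp z.1)
  have hD : MemLp (fun x => (lipConst v x).toReal) q μ := by
    refine (Lp.memLp z.2).mono
      (measurable_lipConst hvK.continuous).ennreal_toReal.aestronglyMeasurable ?_
    filter_upwards [hzd] with x hx
    rw [Real.norm_of_nonneg ENNReal.toReal_nonneg]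
    exact hx.trans (le_abs_self _)
  refine ⟨v, hv, hD, ⟨K, hvK⟩, ?_, ⟨v, ⟨K, hvK⟩, hzv, ?_⟩, ?_⟩
  · exact Lp.ext (hv.coeFn_toLp.trans hzv.symm)
  · filter_upwards [hD.coeFn_toLp] with x hx
    exact hx.ge
  · rw [← Lp.coeFn_le]
    filter_upwards [hD.coeFn_toLp, hzd] with x hx hx'
    rw [hx]; exact hx'

section slopeGraph
variable [Fact (1 ≤ q)]

lemma exists_seq_of_mem_slopeGraph {f : Lp ℝ 2 μ} {c : Lp ℝ q μ} (h : (f, c) ∈ slopeGraph q μ) :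
    ∃ (u : ℕ → Lp ℝ 2 μ) (d : ℕ → Lp ℝ q μ), (∀ n, (u n, d n) ∈ slopePairs q μ) ∧
      Tendsto u atTop (𝓝 f) ∧ Tendsto d atTop (𝓝 c) := by
  obtain ⟨z, hz, hlim⟩ := mem_closure_iff_seq_limit.1 h
  exact ⟨fun n => (z n).1, fun n => (z n).2, hz, (Prod.tendsto_iff _ _).1 hlim⟩

lemma mem_slopeGraph_of_tendsto {f : Lp ℝ 2 μ} {c : Lp ℝ q μ} {u : ℕ → Lp ℝ 2 μ}
    {d : ℕ → Lp ℝ q μ} (h : ∀ n, (u n, d n) ∈ slopePairs q μ) (hu : Tendsto u atTop (𝓝 f))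
    (hd : Tendsto d atTop (𝓝 c)) : (f, c) ∈ slopeGraph q μ :=
  mem_closure_of_tendsto (hu.prodMk_nhds hd) (Eventually.of_forall h)

lemma snd_nonneg_of_mem_slopeGraph {f : Lp ℝ 2 μ} {c : Lp ℝ q μ} (h : (f, c) ∈ slopeGraph q μ) :
    0 ≤ c := by
  obtain ⟨u, d, hud, -, hd⟩ := exists_seq_of_mem_slopeGraph h
  exact ge_of_tendsto' hd fun n => snd_nonneg_of_mem_slopePairs (hud n)

lemma mem_slopeGraph_of_le {f : Lp ℝ 2 μ} {c c' : Lp ℝ q μ} (h : (f, c) ∈ slopeGraph q μ)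
    (hc : c ≤ c') : (f, c') ∈ slopeGraph q μ := by
  obtain ⟨u, d, hud, hu, hd⟩ := exists_seq_of_mem_slopeGraph h
  refine mem_slopeGraph_of_tendsto (d := fun n => d n + (c' - c)) (fun n => ?_) hu ?_
  · exact mem_slopePairs_of_le (hud n) (le_add_of_nonneg_right (sub_nonneg.2 hc))
  · simpa using hd.add_const (c' - c)

lemma zero_mem_slopeGraph : ((0 : Lp ℝ 2 μ), (0 : Lp ℝ q μ)) ∈ slopeGraph q μ := by
  refine subset_closure ⟨0, ⟨0, LipschitzWith.const 0⟩, Lp.coeFn_zero _ _ _, ?_⟩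
  filter_upwards [Lp.coeFn_zero ℝ q μ] with x hx
  have h : lipConst (0 : M → ℝ) x ≤ ((0 : ℝ≥0) : ℝ≥0∞) :=
    lipConst_le_of_lipschitzWith (LipschitzWith.const 0) x
  rw [ENNReal.coe_zero, nonpos_iff_eq_zero] at h
  rw [h, ENNReal.toReal_zero]
  exact hx.ge

/-- A relaxed slope lies in the strong closure: a closed convex set is weakly closed. -/
lemma IsRelaxedSlope.mem_slopeGraph [BorelSpace M] {f : Lp ℝ 2 μ} {g : Lp ℝ q μ}
    (h : IsRelaxedSlope q μ f g) : (f, g) ∈ slopeGraph q μ := by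
  obtain ⟨u, hu, hD, g', hL, hlim, hweak, hle⟩ := h
  refine mem_slopeGraph_of_le ?_ hle
  by_contra hcon
  obtain ⟨F, s, h1, h2⟩ := geometric_hahn_banach_closed_point
    (convex_slopePairs (q := q) (μ := μ)).closure isClosed_closure hcon
  have hmem : ∀ n, ((hu n).toLp (u n), (hD n).toLp _) ∈ slopePairs q μ := fun n =>
    ⟨u n, hL n, (hu n).coeFn_toLp, by filter_upwards [(hD n).coeFn_toLp] with x hx using hx.ge⟩
  have e1 : Tendsto (fun n => F ((hu n).toLp (u n), 0)) atTop (𝓝 (F (f, 0))) :=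
    ((F.comp (ContinuousLinearMap.inl ℝ (Lp ℝ 2 μ) (Lp ℝ q μ))).continuous.tendsto f).comp hlim
  have e2 := hweak (F.comp (ContinuousLinearMap.inr ℝ (Lp ℝ 2 μ) (Lp ℝ q μ)))
  have e3 := e1.add e2
  simp only [ContinuousLinearMap.comp_apply, ContinuousLinearMap.inr_apply, ← map_add,
    Prod.mk_add_mk, add_zero, zero_add] at e3
  exact absurd (le_of_tendsto' e3 fun n => (h1 _ (subset_closure (hmem n))).le) (not_le.2 h2)

/-- Elements of `slopePairs` whose first components are close to `f` and whose second components
have nearly minimal norm have close second components. -/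
lemma exists_dist_snd_le (hq : 1 < q) (hq' : q ≠ ⊤) {f : Lp ℝ 2 μ} {m : ℝ} (hm : 0 ≤ m)
    (hlow : ∀ δ > 0, ∃ ε > 0, ∀ z ∈ slopePairs q μ, ‖z.1 - f‖ < ε → m - δ < ‖z.2‖)
    {δ : ℝ} (hδ : 0 < δ) :
    ∃ ε > 0, ∀ z ∈ slopePairs q μ, ∀ w ∈ slopePairs q μ, ‖z.1 - f‖ < ε → ‖w.1 - f‖ < ε →
      ‖z.2‖ ≤ m + ε → ‖w.2‖ ≤ m + ε → ‖z.2 - w.2‖ ≤ δ := by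
  set p := q.toReal with hp
  have hp1 : 1 < p := by simpa using (ENNReal.toReal_lt_toReal ENNReal.one_ne_top hq').2 hq
  have hp0 : 0 < p := by linarith
  have hδp : 0 < δ ^ p := by positivity
  have hm1 : 0 < (m + 1) ^ p := by positivity
  obtain ⟨C, hC0, hC⟩ := exists_abs_sub_rpow_le hp1
    (show 0 < δ ^ p / (4 * (m + 1) ^ p) by positivity)
  have hη : 0 < δ ^ p / (4 * (C + 1)) := by positivity
  obtain ⟨ρ, hρ, hcont⟩ := Metric.continuousAt_iff.1
    ((Real.continuous_rpow_const hp0.le).continuousAt (x := m)) _ hη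
  simp only [Real.dist_eq] at hcont
  obtain ⟨ε, hε, hεlow⟩ := hlow ρ hρ
  refine ⟨min (min ε 1) (ρ / 2), by positivity, fun z hz w hw hzf hwf hzn hwn => ?_⟩
  have hup : ∀ r, 0 ≤ r → r ≤ m + min (min ε 1) (ρ / 2) →
      r ^ p ≤ m ^ p + δ ^ p / (4 * (C + 1)) ∧ r ^ p ≤ (m + 1) ^ p := by
    intro r hr hr'
    refine ⟨?_, Real.rpow_le_rpow hr (hr'.trans ?_) hp0.le⟩
    · rcases le_total r m with h | h
      · exact (Real.rpow_le_rpow hr h hp0.le).trans (by linarith)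
      · have : |r - m| < ρ := by
          rw [abs_of_nonneg (by linarith)]
          have := min_le_right (min ε 1) (ρ / 2)
          linarith
        have := (abs_lt.1 (hcont this)).2
        linarith
    · have := (min_le_left (min ε 1) (ρ / 2)).trans (min_le_right _ _)
      linarith
  have hz' := hup _ (norm_nonneg _) hzn
  have hw' := hup _ (norm_nonneg _) hwn
  have hmid := convex_slopePairs hz hw (by norm_num : (0 : ℝ) ≤ 1 / 2)
    (by norm_num : (0 : ℝ) ≤ 1 / 2) (by norm_num)
  have hmidf : ‖((1 / 2 : ℝ) • z + (1 / 2 : ℝ) • w).1 - f‖ < ε := by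
    have e : ((1 / 2 : ℝ) • z + (1 / 2 : ℝ) • w).1 - f =
        (1 / 2 : ℝ) • (z.1 - f) + (1 / 2 : ℝ) • (w.1 - f) := by
      simp only [Prod.fst_add, Prod.smul_fst]; module
    rw [e]
    refine (norm_add_le _ _).trans_lt ?_
    rw [norm_smul, norm_smul, Real.norm_of_nonneg (by norm_num : (0 : ℝ) ≤ 1 / 2)]
    have := (min_le_left (min ε 1) (ρ / 2)).trans (min_le_left _ _)
    linarith
  have hmidn := hεlow _ hmid hmidf
  simp only [Prod.snd_add, Prod.smul_snd] at hmidn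
  have hmidp : m ^ p - δ ^ p / (4 * (C + 1)) ≤
      ‖(1 / 2 : ℝ) • z.2 + (1 / 2 : ℝ) • w.2‖ ^ p := by
    rcases le_total m ‖(1 / 2 : ℝ) • z.2 + (1 / 2 : ℝ) • w.2‖ with h | h
    · have := Real.rpow_le_rpow hm h hp0.le
      linarith
    · have : |‖(1 / 2 : ℝ) • z.2 + (1 / 2 : ℝ) • w.2‖ - m| < ρ := by
        rw [abs_of_nonpos (by linarith)]; linarith
      have := (abs_lt.1 (hcont this)).1
      linarith
  have key := norm_sub_rpow_le hq hq' hC (snd_nonneg_of_mem_slopePairs hz)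
    (snd_nonneg_of_mem_slopePairs hw)
  have hfin : ‖z.2 - w.2‖ ^ p ≤ δ ^ p := by
    refine key.trans ?_
    have b1 : C * ((‖z.2‖ ^ p + ‖w.2‖ ^ p) / 2 - ‖(1 / 2 : ℝ) • z.2 + (1 / 2 : ℝ) • w.2‖ ^ p) ≤
        C * (2 * (δ ^ p / (4 * (C + 1)))) :=
      mul_le_mul_of_nonneg_left (by linarith [hz'.1, hw'.1]) hC0
    have b2 : C * (2 * (δ ^ p / (4 * (C + 1)))) ≤ δ ^ p / 2 := by
      rw [show C * (2 * (δ ^ p / (4 * (C + 1)))) = (δ ^ p / 2) * (C / (C + 1)) by field_simp; ring]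
      exact mul_le_of_le_one_right (by positivity) ((div_le_one (by linarith)).2 (by linarith))
    have b3 : δ ^ p / (4 * (m + 1) ^ p) * (‖z.2‖ ^ p + ‖w.2‖ ^ p) ≤
        δ ^ p / (4 * (m + 1) ^ p) * (2 * (m + 1) ^ p) :=
      mul_le_mul_of_nonneg_left (by linarith [hz'.2, hw'.2]) (by positivity)
    have b4 : δ ^ p / (4 * (m + 1) ^ p) * (2 * (m + 1) ^ p) = δ ^ p / 2 := by
      field_simp; ring
    linarith
  exact (Real.rpow_le_rpow_iff (norm_nonneg _) hδ.le hp0).1 hfin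

/-- The fibre of `slopeGraph` over `f` has a unique element `a` of minimal norm. A minimizing
sequence of local Lipschitz constants is Cauchy by uniform convexity, so `a` is a strong limit of
such functions, and therefore a relaxed slope itself. -/
lemma exists_isRelaxedSlope_minimal [BorelSpace M] (hq : 1 < q) (hq' : q ≠ ⊤) {f : Lp ℝ 2 μ}
    (hf : ∃ c, (f, c) ∈ slopeGraph q μ) :
    ∃ a, IsRelaxedSlope q μ f a ∧ ∀ c, (f, c) ∈ slopeGraph q μ →
      ‖a‖ ≤ ‖c‖ ∧ (‖c‖ ≤ ‖a‖ → c = a) := by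
  obtain ⟨c₀, hc₀⟩ := hf
  set R : Set ℝ := {r | 0 ≤ r ∧ ∀ ε > 0, ∃ z ∈ slopePairs q μ, ‖z.1 - f‖ < ε ∧ ‖z.2‖ ≤ r} with hR
  have hmemR : ∀ c, (f, c) ∈ slopeGraph q μ → ∀ r, ‖c‖ < r → r ∈ R := by
    intro c hc r hr
    refine ⟨(norm_nonneg _).trans hr.le, fun ε hε => ?_⟩
    obtain ⟨u, d, hud, hu, hd⟩ := exists_seq_of_mem_slopeGraph hc
    have e1 : ∀ᶠ n in atTop, ‖u n - f‖ < ε := by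
      have := (tendsto_iff_norm_sub_tendsto_zero.1 hu)
      exact this.eventually_lt_const hε
    have e2 : ∀ᶠ n in atTop, ‖d n‖ < r := hd.norm.eventually_lt_const hr
    obtain ⟨n, h1, h2⟩ := (e1.and e2).exists
    exact ⟨_, hud n, h1, h2.le⟩
  have hbdd : BddBelow R := ⟨0, fun r hr => hr.1⟩
  have hne : R.Nonempty := ⟨‖c₀‖ + 1, hmemR c₀ hc₀ _ (by linarith)⟩
  -- the relaxation, along sequences converging to `f` in `L²`, of the minimal norm
  set m := sInf R with hmdef
  have hm : 0 ≤ m := le_csInf hne fun r hr => hr.1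
  have hlow : ∀ δ > 0, ∃ ε > 0, ∀ z ∈ slopePairs q μ, ‖z.1 - f‖ < ε → m - δ < ‖z.2‖ := by
    intro δ hδ
    by_contra! hcon
    rcases lt_or_ge (m - δ) 0 with h | h
    · obtain ⟨z, -, -, hz⟩ := hcon 1 one_pos
      linarith [norm_nonneg z.2]
    · have : m - δ ∈ R := ⟨h, hcon⟩
      linarith [csInf_le hbdd this]
  have happ : ∀ n : ℕ, ∃ z ∈ slopePairs q μ, ‖z.1 - f‖ < 1 / ((n : ℝ) + 1) ∧
      ‖z.2‖ ≤ m + 1 / ((n : ℝ) + 1) := by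
    intro n
    have hn : 0 < 1 / ((n : ℝ) + 1) := by positivity
    obtain ⟨r, hr, hrlt⟩ := exists_lt_of_csInf_lt hne (lt_add_of_pos_right m hn)
    obtain ⟨z, hz, h1, h2⟩ := hr.2 _ hn
    exact ⟨z, hz, h1, h2.trans hrlt.le⟩
  choose z hz hzf hzn using happ
  choose v hv hD hvL hvz hvG hvle using fun n => exists_lipConst_of_mem_slopePairs (hz n)
  have hDn : ∀ n, ‖(hD n).toLp _‖ ≤ m + 1 / ((n : ℝ) + 1) := fun n => by
    refine le_trans (norm_le_norm_of_abs_le_abs ?_) (hzn n)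
    rw [abs_of_nonneg (snd_nonneg_of_mem_slopePairs (hvG n)),
      abs_of_nonneg (snd_nonneg_of_mem_slopePairs (hz n))]
    exact hvle n
  have htend := tendsto_one_div_add_atTop_nhds_zero_nat (𝕜 := ℝ)
  have hevent : ∀ ε > 0, ∀ᶠ n : ℕ in atTop, 1 / ((n : ℝ) + 1) < ε := fun ε hε =>
    htend.eventually_lt_const hε
  have hcauchy : CauchySeq fun n => (hD n).toLp _ := by
    refine Metric.cauchySeq_iff'.2 fun δ hδ => ?_
    obtain ⟨ε, hε, hclose⟩ := exists_dist_snd_le hq hq' hm hlow (half_pos hδ)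
    obtain ⟨N, hN⟩ := eventually_atTop.1 (hevent ε hε)
    refine ⟨N, fun n hn => ?_⟩
    rw [dist_eq_norm]
    have := hclose _ (hvG n) _ (hvG N) ((hzf n).trans (hN n hn)) ((hzf N).trans (hN N le_rfl))
      ((hDn n).trans (by linarith [hN n hn])) ((hDn N).trans (by linarith [hN N le_rfl]))
    exact this.trans_lt (half_lt_self hδ)
  obtain ⟨a, ha⟩ := cauchySeq_tendsto_of_complete hcauchy
  have hzlim : Tendsto (fun n => (z n).1) atTop (𝓝 f) :=
    tendsto_iff_norm_sub_tendsto_zero.2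
      (squeeze_zero (fun n => norm_nonneg _) (fun n => (hzf n).le) htend)
  have ham : ‖a‖ ≤ m := le_of_tendsto_of_tendsto' ha.norm
    (by simpa using htend.const_add m) hDn
  have hmin : ∀ c, (f, c) ∈ slopeGraph q μ → m ≤ ‖c‖ := fun c hc =>
    le_of_forall_gt fun r hr => lt_of_le_of_lt
      (csInf_le hbdd (hmemR c hc ((‖c‖ + r) / 2) (by linarith))) (by linarith)
  have hag : (f, a) ∈ slopeGraph q μ := mem_slopeGraph_of_tendsto hvG hzlim ha
  refine ⟨a, ⟨v, hv, hD, a, hvL, ?_, fun L => (L.continuous.tendsto a).comp ha, le_rfl⟩,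
    fun c hc => ⟨ham.trans (hmin c hc), fun hca => ?_⟩⟩
  · simpa only [hvz] using hzlim
  · obtain ⟨u, d, hud, hu, hd⟩ := exists_seq_of_mem_slopeGraph hc
    refine eq_of_sub_eq_zero (norm_eq_zero.1 (le_antisymm ?_ (norm_nonneg _)))
    refine le_of_forall_pos_le_add fun δ hδ => ?_
    obtain ⟨ε, hε, hclose⟩ := exists_dist_snd_le hq hq' hm hlow hδ
    rw [zero_add]
    have hlim : Tendsto (fun n => ‖d n - (hD n).toLp _‖) atTop (𝓝 ‖c - a‖) := (hd.sub ha).norm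
    refine le_of_tendsto hlim ?_
    have e1 : ∀ᶠ n in atTop, ‖u n - f‖ < ε :=
      (tendsto_iff_norm_sub_tendsto_zero.1 hu).eventually_lt_const hε
    have e2 : ∀ᶠ n in atTop, ‖d n‖ < m + ε :=
      hd.norm.eventually_lt_const (by linarith)
    filter_upwards [e1, e2, hevent ε hε] with n h1 h2 h3
    have := hclose _ (hud n) _ (hvG n) h1 ((hzf n).trans h3) h2.le ((hDn n).trans (by linarith))
    exact this

/-- The chosen function `relaxedSlope` minimizes the norm not only among relaxed slopes but in the
whole fibre of `slopeGraph`, which is closed under strong limits. -/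
lemma relaxedSlope_spec [BorelSpace M] (hq : 1 < q) (hq' : q ≠ ⊤) {f : Lp ℝ 2 μ}
    (hf : ∃ c, (f, c) ∈ slopeGraph q μ) :
    IsRelaxedSlope q μ f (relaxedSlope q μ f) ∧ (f, relaxedSlope q μ f) ∈ slopeGraph q μ ∧
      ∀ c, (f, c) ∈ slopeGraph q μ → ‖relaxedSlope q μ f‖ ≤ ‖c‖ := by
  obtain ⟨a, ha, hmin⟩ := exists_isRelaxedSlope_minimal hq hq' hf
  have h : ∃ g, IsMinRelaxedSlope q μ f g := ⟨a, ha, fun g hg => (hmin g hg.mem_slopeGraph).1⟩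
  have hs : relaxedSlope q μ f = h.choose := by rw [relaxedSlope, dif_pos h]
  have hspec := h.choose_spec
  rw [← hs] at hspec
  have heq := (hmin _ hspec.1.mem_slopeGraph).2 (hspec.2 a ha)
  exact ⟨hspec.1, hspec.1.mem_slopeGraph, fun c hc => by rw [heq]; exact (hmin c hc).1⟩

lemma exists_isRelaxedSlope_iff [BorelSpace M] (hq : 1 < q) (hq' : q ≠ ⊤) {f : Lp ℝ 2 μ} :
    (∃ g, IsRelaxedSlope q μ f g) ↔ ∃ c, (f, c) ∈ slopeGraph q μ :=
  ⟨fun ⟨g, hg⟩ => ⟨g, hg.mem_slopeGraph⟩, fun h => ⟨_, (relaxedSlope_spec hq hq' h).1⟩⟩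

lemma cheeger_eq_ofReal [BorelSpace M] (hq : 1 < q) (hq' : q ≠ ⊤) {f : Lp ℝ 2 μ}
    (hf : ∃ c, (f, c) ∈ slopeGraph q μ) :
    cheeger q μ f = ENNReal.ofReal (‖relaxedSlope q μ f‖ ^ q.toReal / q.toReal) := by
  have hq0 : q ≠ 0 := (zero_lt_one.trans hq).ne'
  have hp0 : 0 < q.toReal := ENNReal.toReal_pos hq0 hq'
  rw [cheeger, if_pos ((exists_isRelaxedSlope_iff hq hq').2 hf),
    norm_rpow_eq_integral hq0 hq', div_eq_inv_mul, ENNReal.ofReal_mul (by positivity),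
    ENNReal.ofReal_inv_of_pos hp0, ENNReal.ofReal_toReal hq',
    ofReal_integral_eq_lintegral_ofReal (integrable_abs_rpow hq0 hq' _)
      (Eventually.of_forall fun x => by positivity)]
  congr 2
  ext x
  rw [← ENNReal.ofReal_rpow_of_nonneg (abs_nonneg _) hp0.le, Real.enorm_eq_ofReal_abs]

/-- The real form of the subgradient inequality: on the right-hand side every element of the
fibre of `slopeGraph` may be used. -/
lemma IsSubgradient.le [BorelSpace M] (hq : 1 < q) (hq' : q ≠ ⊤) {f l : Lp ℝ 2 μ}
    (h : IsSubgradient q μ f l) :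
    (f, relaxedSlope q μ f) ∈ slopeGraph q μ ∧ ∀ g c, (g, c) ∈ slopeGraph q μ →
      ‖relaxedSlope q μ f‖ ^ q.toReal + q.toReal * inner ℝ l (g - f) ≤ ‖c‖ ^ q.toReal := by
  have hp0 : 0 < q.toReal := ENNReal.toReal_pos (zero_lt_one.trans hq).ne' hq'
  have hf : ∃ c, (f, c) ∈ slopeGraph q μ := by
    rw [← exists_isRelaxedSlope_iff hq hq']
    by_contra hcon
    exact h.1 (by rw [cheeger, if_neg hcon])
  refine ⟨(relaxedSlope_spec hq hq' hf).2.1, fun g c hgc => ?_⟩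
  have h2 := h.2 g
  rw [cheeger_eq_ofReal hq hq' hf, cheeger_eq_ofReal hq hq' ⟨c, hgc⟩,
    EReal.coe_ennreal_ofReal, EReal.coe_ennreal_ofReal, max_eq_left (by positivity),
    max_eq_left (by positivity), ← EReal.coe_add, EReal.coe_le_coe_iff] at h2
  have h3 : inner ℝ l (g - f) = ∫ x, l x * (g x - f x) ∂μ := by
    rw [L2.inner_def]
    refine integral_congr_ae ?_
    filter_upwards [Lp.coeFn_sub g f] with x hx
    rw [hx, Pi.sub_apply]
    exact mul_comm _ _
  rw [← h3] at h2
  have h4 := Real.rpow_le_rpow (norm_nonneg _) ((relaxedSlope_spec hq hq' ⟨c, hgc⟩).2.2 c hgc)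
    hp0.le
  have h5 := mul_le_mul_of_nonneg_left h2 hp0.le
  rw [mul_add, mul_div_cancel₀ _ hp0.ne', mul_div_cancel₀ _ hp0.ne'] at h5
  linarith

end slopeGraph

end

/-! ### Superposition operators and the chain rule for upper slopes -/

section

section superpose
variable {M : Type*} [MeasurableSpace M] {μ : Measure M} {q : ℝ≥0∞}

open Classical in
/-- The superposition operator `u ↦ η ∘ u` on `L²`; its value is `0` if `η ∘ u ∉ L²`. -/
def superpose (η : ℝ → ℝ) (u : Lp ℝ 2 μ) : Lp ℝ 2 μ :=
  if h : MemLp (fun x => η (u x)) 2 μ then h.toLp _ else 0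

open Classical in
/-- The product `ρ(h) d` for `h ∈ L²`, `d ∈ L^q`; its value is `0` if this is not in `L^q`. -/
def weightMul (ρ : ℝ → ℝ) (h : Lp ℝ 2 μ) (d : Lp ℝ q μ) : Lp ℝ q μ :=
  if h : MemLp (fun x => ρ (h x) * d x) q μ then h.toLp _ else 0

variable {η : ℝ → ℝ} {K : ℝ≥0}

lemma memLp_superpose (hη : LipschitzWith K η) (h0 : η 0 = 0 ∨ μ Set.univ < ⊤) (u : Lp ℝ 2 μ) :
    MemLp (fun x => η (u x)) 2 μ := by
  have h1 : LipschitzWith K fun r => η r - η 0 :=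
    LipschitzWith.of_dist_le_mul fun r s => by simpa using hη.dist_le_mul r s
  have h2 : MemLp (fun x => η (u x) - η 0) 2 μ := h1.comp_memLp (by simp) (Lp.memLp u)
  rcases h0 with h0 | h0
  · simpa [h0] using h2
  · have : IsFiniteMeasure μ := ⟨h0⟩
    refine (h2.add (memLp_const (η 0))).ae_eq (Eventually.of_forall fun x => ?_)
    simp

lemma coeFn_superpose (hη : LipschitzWith K η) (h0 : η 0 = 0 ∨ μ Set.univ < ⊤) (u : Lp ℝ 2 μ) :
    superpose η u =ᵐ[μ] fun x => η (u x) := by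
  rw [superpose, dif_pos (memLp_superpose hη h0 u)]
  exact (memLp_superpose hη h0 u).coeFn_toLp

lemma norm_superpose_sub_le (hη : LipschitzWith K η) (h0 : η 0 = 0 ∨ μ Set.univ < ⊤)
    (u v : Lp ℝ 2 μ) : ‖superpose η u - superpose η v‖ ≤ K * ‖u - v‖ := by
  refine Lp.norm_le_mul_norm_of_ae_le_mul ?_
  filter_upwards [coeFn_superpose hη h0 u, coeFn_superpose hη h0 v,
    Lp.coeFn_sub (superpose η u) (superpose η v), Lp.coeFn_sub u v] with x h1 h2 h3 h4
  rw [h3, h4, Pi.sub_apply, Pi.sub_apply, h1, h2]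
  exact hη.norm_sub_le _ _

lemma memLp_weightMul {ρ : ℝ → ℝ} {B : ℝ} (hρ : Measurable ρ) (hB : ∀ r, |ρ r| ≤ B)
    (h : Lp ℝ 2 μ) (d : Lp ℝ q μ) : MemLp (fun x => ρ (h x) * d x) q μ := by
  refine (Lp.memLp d).of_le_mul (c := B) ?_ (Eventually.of_forall fun x => ?_)
  · exact ((hρ.comp (Lp.stronglyMeasurable h).measurable).aestronglyMeasurable).mul
      (Lp.aestronglyMeasurable d)
  · rw [norm_mul]
    exact mul_le_mul_of_nonneg_right (hB _) (norm_nonneg _)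

lemma coeFn_weightMul {ρ : ℝ → ℝ} {B : ℝ} (hρ : Measurable ρ) (hB : ∀ r, |ρ r| ≤ B)
    (h : Lp ℝ 2 μ) (d : Lp ℝ q μ) : weightMul ρ h d =ᵐ[μ] fun x => ρ (h x) * d x := by
  rw [weightMul, dif_pos (memLp_weightMul hρ hB h d)]
  exact (memLp_weightMul hρ hB h d).coeFn_toLp

/-- The bounded weights converge only almost everywhere, so that dominated convergence is needed
besides the convergence of `dn`. -/
lemma tendsto_weightMul [Fact (1 ≤ q)] (hq' : q ≠ ⊤) {ρ : ℝ → ℝ} {B : ℝ} (hρ : Continuous ρ)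
    (hB : ∀ r, |ρ r| ≤ B) {h : Lp ℝ 2 μ} {hn : ℕ → Lp ℝ 2 μ} {d : Lp ℝ q μ} {dn : ℕ → Lp ℝ q μ}
    (hh : ∀ᵐ x ∂μ, Tendsto (fun n => hn n x) atTop (𝓝 (h x))) (hd : Tendsto dn atTop (𝓝 d)) :
    Tendsto (fun n => weightMul ρ (hn n) (dn n)) atTop (𝓝 (weightMul ρ h d)) := by
  have hq0 : q ≠ 0 := (zero_lt_one.trans_le (Fact.out : 1 ≤ q)).ne'
  have hp0 : 0 < q.toReal := ENNReal.toReal_pos hq0 hq'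
  have hB0 : 0 ≤ B := (abs_nonneg _).trans (hB 0)
  have e1 : Tendsto (fun n => weightMul ρ (hn n) (dn n) - weightMul ρ (hn n) d) atTop (𝓝 0) := by
    refine squeeze_zero_norm (a := fun n => B * ‖dn n - d‖) (fun n => ?_) ?_
    · refine Lp.norm_le_mul_norm_of_ae_le_mul ?_
      filter_upwards [coeFn_weightMul hρ.measurable hB (hn n) (dn n),
        coeFn_weightMul hρ.measurable hB (hn n) d,
        Lp.coeFn_sub (weightMul ρ (hn n) (dn n)) (weightMul ρ (hn n) d),
        Lp.coeFn_sub (dn n) d] with x h1 h2 h3 h4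
      rw [h3, h4, Pi.sub_apply, Pi.sub_apply, h1, h2, ← mul_sub, norm_mul]
      exact mul_le_mul_of_nonneg_right (hB _) (norm_nonneg _)
    · simpa using (tendsto_iff_norm_sub_tendsto_zero.1 hd).const_mul B
  have e2 : Tendsto (fun n => ‖weightMul ρ (hn n) d - weightMul ρ h d‖ ^ q.toReal) atTop
      (𝓝 0) := by
    have hae : ∀ n, ∀ᵐ x ∂μ, (weightMul ρ (hn n) d - weightMul ρ h d : Lp ℝ q μ) x =
        (ρ (hn n x) - ρ (h x)) * d x := fun n => by
      filter_upwards [coeFn_weightMul hρ.measurable hB (hn n) d,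
        coeFn_weightMul hρ.measurable hB h d,
        Lp.coeFn_sub (weightMul ρ (hn n) d) (weightMul ρ h d)] with x h1 h2 h3
      rw [h3, Pi.sub_apply, h1, h2, sub_mul]
    have hz : (0 : ℝ) = ∫ _x, (0 : ℝ) ∂μ := by simp
    simp only [norm_rpow_eq_integral hq0 hq']
    rw [hz]
    refine tendsto_integral_of_dominated_convergence
      (fun x => (2 * B) ^ q.toReal * |d x| ^ q.toReal)
      (fun n => (integrable_abs_rpow hq0 hq' _).aestronglyMeasurable)
      ((integrable_abs_rpow hq0 hq' d).const_mul _) (fun n => ?_) ?_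
    · filter_upwards [hae n] with x hx
      rw [hx, Real.norm_of_nonneg (by positivity), abs_mul,
        Real.mul_rpow (abs_nonneg _) (abs_nonneg _)]
      refine mul_le_mul_of_nonneg_right (Real.rpow_le_rpow (abs_nonneg _) ?_ hp0.le)
        (by positivity)
      linarith [abs_sub (ρ (hn n x)) (ρ (h x)), hB (hn n x), hB (h x)]
    · filter_upwards [ae_all_iff.2 hae, hh] with x hx hx'
      simp only [hx]
      have t1 : Tendsto (fun n => |(ρ (hn n x) - ρ (h x)) * d x|) atTop (𝓝 0) := by
        have := ((((hρ.tendsto (h x)).comp hx').sub_const (ρ (h x))).mul_const (d x)).abs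
        simpa using this
      have := (Real.continuous_rpow_const hp0.le).tendsto 0 |>.comp t1
      simpa [Real.zero_rpow hp0.ne', Function.comp_def] using this
  have e3 : Tendsto (fun n => ‖weightMul ρ (hn n) d - weightMul ρ h d‖) atTop (𝓝 0) := by
    have := (Real.continuous_rpow_const (inv_nonneg.2 hp0.le)).tendsto 0 |>.comp e2
    simp only [Function.comp_def, Real.rpow_rpow_inv (norm_nonneg _) hp0.ne'] at this
    simpa [Real.zero_rpow (inv_ne_zero hp0.ne')] using this
  refine tendsto_iff_norm_sub_tendsto_zero.2 ?_
  have e4 := (tendsto_zero_iff_norm_tendsto_zero.1 e1).add e3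
  rw [add_zero] at e4
  refine squeeze_zero (fun n => norm_nonneg _) (fun n => ?_) e4
  have := norm_add_le (weightMul ρ (hn n) (dn n) - weightMul ρ (hn n) d)
    (weightMul ρ (hn n) d - weightMul ρ h d)
  simpa using this

end superpose

section chain
variable {M : Type*} [MetricSpace M] [MeasurableSpace M] {μ : Measure M} {q : ℝ≥0∞}

lemma abs_deriv_le_of_lipschitzWith {η η' : ℝ → ℝ} {K : ℝ≥0} (hη : LipschitzWith K η)
    (hη' : ∀ r, HasDerivAt η (η' r) r) (r : ℝ) : |η' r| ≤ K := by
  have := norm_deriv_le_of_lipschitz hη (x₀ := r)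
  rwa [(hη' r).deriv] at this

/-- The chain rule: if `a`, `b` are upper slopes of `f`, `g`, then
`|1 - η'(f - g)| a + |η'(f - g)| b` is an upper slope of `f - η (f - g)`. -/
lemma sub_superpose_mem_slopeGraph [Fact (1 ≤ q)] (hq' : q ≠ ⊤) {f g : Lp ℝ 2 μ} {a b : Lp ℝ q μ}
    (hf : (f, a) ∈ slopeGraph q μ) (hg : (g, b) ∈ slopeGraph q μ) {η η' : ℝ → ℝ} {K : ℝ≥0}
    (hη : LipschitzWith K η) (hη' : ∀ r, HasDerivAt η (η' r) r) (hc : Continuous η')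
    (h0 : η 0 = 0 ∨ μ Set.univ < ⊤) :
    (f - superpose η (f - g), weightMul (fun r => |1 - η' r|) (f - g) a +
      weightMul (fun r => |η' r|) (f - g) b) ∈ slopeGraph q μ := by
  obtain ⟨u, d, hud, hu, hd⟩ := exists_seq_of_mem_slopeGraph hf
  obtain ⟨v, e, hve, hv, he⟩ := exists_seq_of_mem_slopeGraph hg
  -- along a subsequence, `η'` of the differences converges almost everywhere
  obtain ⟨ns, hns, hae⟩ :=
    (tendstoInMeasure_of_tendsto_Lp (hu.sub hv)).exists_seq_tendsto_ae
  have hbd := abs_deriv_le_of_lipschitzWith hη hη'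
  have hc1 : Continuous fun r => |1 - η' r| := (continuous_const.sub hc).abs
  have hB1 : ∀ r, |(|1 - η' r|)| ≤ 1 + K := fun r => by
    rw [abs_abs]
    exact (abs_sub _ _).trans (by rw [abs_one]; linarith [hbd r])
  have hB2 : ∀ r, |(|η' r|)| ≤ (K : ℝ) := fun r => by rw [abs_abs]; exact hbd r
  refine mem_slopeGraph_of_tendsto (u := fun n => u (ns n) - superpose η (u (ns n) - v (ns n)))
    (d := fun n => weightMul (fun r => |1 - η' r|) (u (ns n) - v (ns n)) (d (ns n)) +
      weightMul (fun r => |η' r|) (u (ns n) - v (ns n)) (e (ns n))) (fun n => ?_) ?_ ?_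
  · obtain ⟨w, ⟨L, hw⟩, hwu, hwd⟩ := hud (ns n)
    obtain ⟨w', ⟨L', hw'⟩, hwv, hwe⟩ := hve (ns n)
    refine ⟨fun y => w y - η (w y - w' y), ⟨_, hw.sub (hη.comp (hw.sub hw'))⟩, ?_, ?_⟩
    · filter_upwards [hwu, hwv, Lp.coeFn_sub (u (ns n)) (superpose η (u (ns n) - v (ns n))),
        Lp.coeFn_sub (u (ns n)) (v (ns n)),
        coeFn_superpose hη h0 (u (ns n) - v (ns n))] with x h1 h2 h3 h4 h5
      rw [h3, Pi.sub_apply, h5, h4, Pi.sub_apply, h1, h2]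
    · filter_upwards [hwu, hwv, Lp.coeFn_sub (u (ns n)) (v (ns n)), hwd, hwe,
        Lp.coeFn_add (weightMul (fun r => |1 - η' r|) (u (ns n) - v (ns n)) (d (ns n)))
          (weightMul (fun r => |η' r|) (u (ns n) - v (ns n)) (e (ns n))),
        coeFn_weightMul hc1.measurable hB1 (u (ns n) - v (ns n)) (d (ns n)),
        coeFn_weightMul hc.abs.measurable hB2 (u (ns n) - v (ns n)) (e (ns n))]
        with x h1 h2 h3 h4 h5 h6 h7 h8
      rw [h6, Pi.add_apply, h7, h8, h3, Pi.sub_apply, h1, h2]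
      have f1 := ENNReal.mul_ne_top (enorm_ne_top (x := 1 - η' (w x - w' x)))
        (lipConst_ne_top hw x)
      have f2 := ENNReal.mul_ne_top (enorm_ne_top (x := η' (w x - w' x))) (lipConst_ne_top hw' x)
      have h9 := ENNReal.toReal_mono (ENNReal.add_ne_top.2 ⟨f1, f2⟩)
        (lipConst_sub_comp_sub_le hw hw' hη' x)
      rw [ENNReal.toReal_add f1 f2, ENNReal.toReal_mul, ENNReal.toReal_mul, toReal_enorm,
        toReal_enorm, Real.norm_eq_abs, Real.norm_eq_abs] at h9
      refine h9.trans ?_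
      gcongr
  · refine (hu.comp hns.tendsto_atTop).sub ?_
    refine tendsto_iff_norm_sub_tendsto_zero.2 (squeeze_zero (fun n => norm_nonneg _)
      (fun n => norm_superpose_sub_le hη h0 _ _) ?_)
    have := (tendsto_iff_norm_sub_tendsto_zero.1
      ((hu.sub hv).comp hns.tendsto_atTop)).const_mul (K : ℝ)
    simpa using this
  · exact (tendsto_weightMul hq' hc1 hB1 hae (hd.comp hns.tendsto_atTop)).add
      (tendsto_weightMul hq' hc.abs hB2 hae (he.comp hns.tendsto_atTop))

end chain

end

/-! ### Monotonicity of the subdifferential and the Euler equation -/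

section

section
variable {M : Type*} [MeasurableSpace M] {μ : Measure M}

lemma inner_superpose_eq_integral {η : ℝ → ℝ} {K : ℝ≥0} (hη : LipschitzWith K η)
    (h0 : η 0 = 0 ∨ μ Set.univ < ⊤) (l u : Lp ℝ 2 μ) :
    inner ℝ l (superpose η u) = ∫ x, l x * η (u x) ∂μ := by
  rw [L2.inner_def]
  refine integral_congr_ae ?_
  filter_upwards [coeFn_superpose hη h0 u] with x hx
  rw [hx]
  exact mul_comm _ _

lemma superpose_const_mul {η : ℝ → ℝ} {K : ℝ≥0} (hη : LipschitzWith K η)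
    (h0 : η 0 = 0 ∨ μ Set.univ < ⊤) (c : ℝ) (u : Lp ℝ 2 μ) :
    superpose (fun r => c * η r) u = c • superpose η u := by
  refine Lp.ext ?_
  filter_upwards [coeFn_superpose ((lipschitzWith_smul c).comp hη)
    (h0.imp_left fun h => by simp [h]) u, coeFn_superpose hη h0 u,
    Lp.coeFn_smul c (superpose η u)] with x h1 h2 h3
  rw [h3, Pi.smul_apply, h2]
  exact h1

/-- The forward average `(n + 1) ∫_r^{r + 1/(n + 1)} ψ`, shifted by a constant so as to agree with
`ψ` at `0`. It is a `C¹` approximation of `ψ` that is again nondecreasing if `ψ` is, and has the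
same Lipschitz constant. -/
def forwardAverage (ψ : ℝ → ℝ) (n : ℕ) (r : ℝ) : ℝ :=
  (n + 1) * (∫ s in (0 : ℝ)..(r + 1 / (n + 1)), ψ s) - (n + 1) * (∫ s in (0 : ℝ)..r, ψ s) +
    (ψ 0 - (n + 1) * ∫ s in (0 : ℝ)..(1 / ((n : ℝ) + 1)), ψ s)

lemma hasDerivAt_forwardAverage {ψ : ℝ → ℝ} (hψ : Continuous ψ) (n : ℕ) (r : ℝ) :
    HasDerivAt (forwardAverage ψ n) ((n + 1) * ψ (r + 1 / (n + 1)) - (n + 1) * ψ r) r := by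
  have h1 : ∀ r, HasDerivAt (fun r => ∫ s in (0 : ℝ)..r, ψ s) (ψ r) r := fun r =>
    intervalIntegral.integral_hasDerivAt_right (hψ.intervalIntegrable _ _)
      (hψ.stronglyMeasurableAtFilter _ _) hψ.continuousAt
  have h2 := (h1 (r + 1 / (n + 1))).comp_add_const r (1 / ((n : ℝ) + 1))
  exact ((h2.const_mul ((n : ℝ) + 1)).sub ((h1 r).const_mul ((n : ℝ) + 1))).add_const _

lemma forwardAverage_zero (ψ : ℝ → ℝ) (n : ℕ) : forwardAverage ψ n 0 = ψ 0 := by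
  simp [forwardAverage]

lemma tendsto_forwardAverage {ψ : ℝ → ℝ} (hψ : Continuous ψ) (r : ℝ) :
    Tendsto (fun n => forwardAverage ψ n r) atTop (𝓝 (ψ r)) := by
  have h1 : ∀ r, HasDerivAt (fun r => ∫ s in (0 : ℝ)..r, ψ s) (ψ r) r := fun r =>
    intervalIntegral.integral_hasDerivAt_right (hψ.intervalIntegrable _ _)
      (hψ.stronglyMeasurableAtFilter _ _) hψ.continuousAt
  have htend : Tendsto (fun n : ℕ => 1 / ((n : ℝ) + 1)) atTop (𝓝[≠] 0) :=
    tendsto_nhdsWithin_iff.2 ⟨tendsto_one_div_add_atTop_nhds_zero_nat,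
      Eventually.of_forall fun n => by
        simp only [Set.mem_compl_iff, Set.mem_singleton_iff]; positivity⟩
  have h2 : ∀ r, Tendsto (fun n : ℕ => ((n : ℝ) + 1) * (∫ s in (0 : ℝ)..(r + 1 / (n + 1)), ψ s) -
      (n + 1) * (∫ s in (0 : ℝ)..r, ψ s)) atTop (𝓝 (ψ r)) := fun r => by
    have := (hasDerivAt_iff_tendsto_slope_zero.1 (h1 r)).comp htend
    refine this.congr fun n => ?_
    simp [smul_eq_mul, mul_sub]
  have h3 := (h2 r).add ((h2 0).const_sub (ψ 0))
  simp only [zero_add, intervalIntegral.integral_same, mul_zero, sub_zero, sub_self,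
    add_zero] at h3
  exact h3

end

variable {M : Type*} [MetricSpace M] [MeasurableSpace M] [BorelSpace M] {μ : Measure M} {q : ℝ≥0∞}
  [Fact (1 ≤ q)]

/-- For smooth `ψ`: with `η = ε ψ` and small `ε`, the slopes of `f - η (f - g)` and
`g + η (f - g)` are complementary convex combinations of those of `f` and `g`, so that the
sum of the two energies does not increase; now add the two subgradient inequalities. -/
lemma inner_superpose_nonneg_of_contDiff (hq : 1 < q) (hq' : q ≠ ⊤) {f g l l' : Lp ℝ 2 μ}
    (hf : IsSubgradient q μ f l) (hg : IsSubgradient q μ g l') {ψ ψ' : ℝ → ℝ} {K : ℝ≥0}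
    (hψ : LipschitzWith K ψ) (hψ' : ∀ r, HasDerivAt ψ (ψ' r) r) (hc : Continuous ψ')
    (hpos : ∀ r, 0 ≤ ψ' r) (h0 : ψ 0 = 0 ∨ μ Set.univ < ⊤) :
    0 ≤ inner ℝ (l - l') (superpose ψ (f - g)) := by
  have hq0 : q ≠ 0 := (zero_lt_one.trans hq).ne'
  have hp0 : 0 < q.toReal := ENNReal.toReal_pos hq0 hq'
  have hp1 : 1 ≤ q.toReal := by
    simpa using (ENNReal.toReal_le_toReal ENNReal.one_ne_top hq').2 hq.le
  set p := q.toReal with hpq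
  obtain ⟨hfa, hfle⟩ := hf.le hq hq'
  obtain ⟨hgb, hgle⟩ := hg.le hq hq'
  set a := relaxedSlope q μ f
  set b := relaxedSlope q μ g
  set h := f - g with hh
  set ε : ℝ := 1 / (K + 1) with hε
  have hεpos : 0 < ε := by positivity
  set η : ℝ → ℝ := fun r => ε * ψ r with hηdef
  have hη : LipschitzWith _ η := (lipschitzWith_smul ε).comp hψ
  have hη' : ∀ r, HasDerivAt η (ε * ψ' r) r := fun r => (hψ' r).const_mul ε
  have hηc : Continuous fun r => ε * ψ' r := continuous_const.mul hc
  have h0η : η 0 = 0 ∨ μ Set.univ < ⊤ := h0.imp_left fun h => by simp [hηdef, h]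
  have hη0 : ∀ r, 0 ≤ ε * ψ' r := fun r => mul_nonneg hεpos.le (hpos r)
  have hη1 : ∀ r, ε * ψ' r ≤ 1 := fun r => by
    have := (le_abs_self _).trans (abs_deriv_le_of_lipschitzWith hψ hψ' r)
    rw [hε, one_div, inv_mul_eq_div, div_le_one (by positivity)]
    linarith
  -- the same function, seen from `g - f`
  set ξ : ℝ → ℝ := fun r => -η (-r) with hξdef
  have hξ : LipschitzWith _ ξ := (hη.comp LipschitzWith.id.neg).neg
  have hξ' : ∀ r, HasDerivAt ξ (ε * ψ' (-r)) r := fun r => by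
    have := ((hη' (-r)).scomp r (hasDerivAt_neg r)).neg
    exact this.congr_deriv (by simp)
  have hξc : Continuous fun r => ε * ψ' (-r) := hηc.comp continuous_neg
  have h0ξ : ξ 0 = 0 ∨ μ Set.univ < ⊤ := h0η.imp_left fun h => by simp [hξdef, h]
  have hξs : superpose ξ (g - f) = -superpose η h := by
    refine Lp.ext ?_
    filter_upwards [coeFn_superpose hξ h0ξ (g - f), coeFn_superpose hη h0η h,
      Lp.coeFn_neg (superpose η h), Lp.coeFn_sub f g, Lp.coeFn_sub g f] with x h1 h2 h3 h4 h5
    rw [h1, h3, Pi.neg_apply, h2, h5, hh, h4, hξdef]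
    simp
  have m1 := sub_superpose_mem_slopeGraph hq' hfa hgb hη hη' hηc h0η
  have m2 := sub_superpose_mem_slopeGraph hq' hgb hfa hξ hξ' hξc h0ξ
  have i1 := hfle _ _ m1
  have i2 := hgle _ _ m2
  rw [hξs] at i2
  have hsm := superpose_const_mul hψ h0 ε h
  simp only [sub_sub_cancel_left, inner_neg_right, neg_neg] at i1 i2
  rw [← hh] at i1
  have hnorm : ‖weightMul (fun r => |1 - ε * ψ' r|) (f - g) a +
        weightMul (fun r => |ε * ψ' r|) (f - g) b‖ ^ p +
      ‖weightMul (fun r => |1 - ε * ψ' (-r)|) (g - f) b +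
        weightMul (fun r => |ε * ψ' (-r)|) (g - f) a‖ ^ p ≤ ‖a‖ ^ p + ‖b‖ ^ p := by
    simp only [p, norm_rpow_eq_integral hq0 hq']
    rw [← integral_add (integrable_abs_rpow hq0 hq' _) (integrable_abs_rpow hq0 hq' _),
      ← integral_add (integrable_abs_rpow hq0 hq' _) (integrable_abs_rpow hq0 hq' _)]
    refine integral_mono_ae
      ((integrable_abs_rpow hq0 hq' _).add (integrable_abs_rpow hq0 hq' _))
      ((integrable_abs_rpow hq0 hq' _).add (integrable_abs_rpow hq0 hq' _)) ?_
    have b1 : ∀ r, |(|1 - ε * ψ' r|)| ≤ 1 := fun r => by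
      rw [abs_abs, abs_of_nonneg (by linarith [hη1 r])]; linarith [hη0 r]
    have b2 : ∀ r, |(|ε * ψ' r|)| ≤ 1 := fun r => by
      rw [abs_abs, abs_of_nonneg (hη0 r)]; exact hη1 r
    have c1 : Measurable fun r => |1 - ε * ψ' r| := (continuous_const.sub hηc).abs.measurable
    have c2 : Measurable fun r => |ε * ψ' r| := hηc.abs.measurable
    have c3 : Measurable fun r => |1 - ε * ψ' (-r)| := (continuous_const.sub hξc).abs.measurable
    have c4 : Measurable fun r => |ε * ψ' (-r)| := hξc.abs.measurable
    filter_upwards [Lp.coeFn_add (weightMul (fun r => |1 - ε * ψ' r|) (f - g) a)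
        (weightMul (fun r => |ε * ψ' r|) (f - g) b),
      Lp.coeFn_add (weightMul (fun r => |1 - ε * ψ' (-r)|) (g - f) b)
        (weightMul (fun r => |ε * ψ' (-r)|) (g - f) a),
      coeFn_weightMul c1 b1 (f - g) a, coeFn_weightMul c2 b2 (f - g) b,
      coeFn_weightMul c3 (fun r => b1 (-r)) (g - f) b,
      coeFn_weightMul c4 (fun r => b2 (-r)) (g - f) a, Lp.coeFn_sub f g, Lp.coeFn_sub g f,
      (Lp.coeFn_nonneg a).2 (snd_nonneg_of_mem_slopeGraph hfa),
      (Lp.coeFn_nonneg b).2 (snd_nonneg_of_mem_slopeGraph hgb)]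
      with x h1 h2 h3 h4 h5 h6 h7 h8 h9 h10
    simp only [Pi.zero_apply] at h9 h10
    rw [h1, h2, Pi.add_apply, Pi.add_apply, h3, h4, h5, h6, h7, h8, Pi.sub_apply, Pi.sub_apply,
      neg_sub]
    set t := ε * ψ' (f x - g x) with ht
    have t0 : 0 ≤ t := hη0 _
    have t1 : 0 ≤ 1 - t := by linarith [hη1 (f x - g x)]
    rw [abs_of_nonneg t0, abs_of_nonneg t1, abs_of_nonneg h9, abs_of_nonneg h10,
      abs_of_nonneg (by positivity), abs_of_nonneg (by positivity)]
    -- pointwise, the two sums of slopes are complementary convex combinations of `a x` and `b x`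
    have cv := convexOn_rpow hp1
    have k1 := cv.2 (Set.mem_Ici.2 h9) (Set.mem_Ici.2 h10) t1 t0 (by ring)
    have k2 := cv.2 (Set.mem_Ici.2 h10) (Set.mem_Ici.2 h9) t1 t0 (by ring)
    simp only [smul_eq_mul] at k1 k2
    linarith
  rw [← hpq] at i1 i2
  have hfin : p * inner ℝ l' (superpose η h) ≤ p * inner ℝ l (superpose η h) := by linarith
  have hfin' := le_of_mul_le_mul_left hfin hp0
  rw [hsm, inner_smul_right, inner_smul_right] at hfin'
  have := le_of_mul_le_mul_left hfin' hεpos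
  rw [inner_sub_left]
  linarith

/-- The subdifferential is `T`-monotone: `∫ ψ(f - g) (l - l') ≥ 0` for nondecreasing Lipschitz `ψ`,
by approximation with the forward averages of `ψ`. -/
lemma inner_superpose_nonneg (hq : 1 < q) (hq' : q ≠ ⊤) {f g l l' : Lp ℝ 2 μ}
    (hf : IsSubgradient q μ f l) (hg : IsSubgradient q μ g l') {ψ : ℝ → ℝ} {K : ℝ≥0}
    (hψ : LipschitzWith K ψ) (hmono : Monotone ψ) (h0 : ψ 0 = 0 ∨ μ Set.univ < ⊤) :
    0 ≤ inner ℝ (l - l') (superpose ψ (f - g)) := by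
  set h := f - g
  have hd := hasDerivAt_forwardAverage hψ.continuous
  have hpos : ∀ (n : ℕ) (r : ℝ), 0 ≤ ((n : ℝ) + 1) * ψ (r + 1 / (n + 1)) - (n + 1) * ψ r := by
    intro n r
    have h1 : r ≤ r + 1 / ((n : ℝ) + 1) := by
      have : 0 ≤ 1 / ((n : ℝ) + 1) := by positivity
      linarith
    have := mul_le_mul_of_nonneg_left (hmono h1) (by positivity : (0 : ℝ) ≤ n + 1)
    linarith
  have hL : ∀ n, LipschitzWith K (forwardAverage ψ n) := fun n => by
    refine lipschitzWith_of_nnnorm_deriv_le (fun r => (hd n r).differentiableAt) fun r => ?_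
    rw [← NNReal.coe_le_coe, coe_nnnorm, (hd n r).deriv, Real.norm_of_nonneg (hpos n r), ← mul_sub]
    have h2 := (le_abs_self _).trans (hψ.dist_le_mul (r + 1 / ((n : ℝ) + 1)) r)
    rw [Real.dist_eq, add_sub_cancel_left, abs_of_nonneg (by positivity : 0 ≤ 1 / ((n : ℝ) + 1))]
      at h2
    have h3 := mul_le_mul_of_nonneg_left h2
      (by positivity : (0 : ℝ) ≤ n + 1)
    refine h3.trans (le_of_eq ?_)
    field_simp
  have h0n : ∀ n, forwardAverage ψ n 0 = 0 ∨ μ Set.univ < ⊤ := fun n =>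
    h0.imp_left fun h => by rw [forwardAverage_zero, h]
  have hn : ∀ n, 0 ≤ inner ℝ (l - l') (superpose (forwardAverage ψ n) h) := fun n =>
    inner_superpose_nonneg_of_contDiff hq hq' hf hg (hL n) (hd n)
      ((continuous_const.mul (hψ.continuous.comp (continuous_id.add continuous_const))).sub
        (continuous_const.mul hψ.continuous)) (hpos n) (h0n n)
  refine ge_of_tendsto' (x := atTop) ?_ hn
  simp only [inner_superpose_eq_integral (hL _) (h0n _), inner_superpose_eq_integral hψ h0]
  have hint : Integrable (fun x => |(l - l' : Lp ℝ 2 μ) x| * (|ψ (h x)| + 2 * K * |h x|)) μ := by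
    have hm : MemLp (fun x => |ψ (h x)| + 2 * K * |h x|) 2 μ :=
      (memLp_superpose hψ h0 h).abs.add ((Lp.memLp h).abs.const_mul (2 * K))
    exact (Lp.memLp (l - l')).abs.integrable_mul hm
  refine tendsto_integral_of_dominated_convergence _ (fun n => ?_) hint
    (fun n => Eventually.of_forall fun x => ?_) (Eventually.of_forall fun x => ?_)
  · exact (Lp.aestronglyMeasurable _).mul (memLp_superpose (hL n) (h0n n) h).aestronglyMeasurable
  · rw [norm_mul]
    refine mul_le_mul_of_nonneg_left ?_ (norm_nonneg _)
    have h1 := (hL n).dist_le_mul (h x) 0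
    have h2 := hψ.dist_le_mul (h x) 0
    rw [forwardAverage_zero] at h1
    simp only [Real.dist_eq, sub_zero] at h1 h2
    rw [Real.norm_eq_abs]
    have h3 := abs_sub_abs_le_abs_sub (forwardAverage ψ n (h x)) (ψ 0)
    have h4 := abs_sub_abs_le_abs_sub (ψ 0) (ψ (h x))
    rw [abs_sub_comm] at h4
    linarith
  · exact (tendsto_forwardAverage hψ.continuous _).const_mul _

/-- The graph of `r ↦ r ^ p` lies above its tangent at `1 + s`, here evaluated at `1`. -/
lemma one_add_rpow_sub_one_le {p s : ℝ} (hp : 1 ≤ p) (hs : -1 < s) :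
    (1 + s) ^ p - 1 ≤ p * s * (1 + s) ^ (p - 1) := by
  have h1 : 0 < 1 + s := by linarith
  have h2 := one_add_mul_self_le_rpow_one_add (s := (1 + s)⁻¹ - 1)
    (by linarith [inv_pos.2 h1]) hp
  rw [add_sub_cancel, Real.inv_rpow h1.le] at h2
  have h3 : 0 < (1 + s) ^ p := by positivity
  have h4 := mul_le_mul_of_nonneg_left h2 h3.le
  rw [mul_inv_cancel₀ h3.ne'] at h4
  have h5 : (1 + s) ^ p = (1 + s) ^ (p - 1) * (1 + s) := by
    rw [← Real.rpow_add_one h1.ne', sub_add_cancel]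
  have h6 : (1 + s) ^ p * (1 + p * ((1 + s)⁻¹ - 1)) = (1 + s) ^ p - p * s * (1 + s) ^ (p - 1) := by
    rw [h5]; field_simp; ring
  linarith

/-- One half of the Euler equation, from the variation `f + ε φ(f)`, `ε ↓ 0`. -/
lemma inner_superpose_le_integral (hq : 1 < q) (hq' : q ≠ ⊤) {f l : Lp ℝ 2 μ}
    (hf : IsSubgradient q μ f l) {φ φ' : ℝ → ℝ} {K : ℝ≥0} (hφ : LipschitzWith K φ)
    (hφ' : ∀ r, HasDerivAt φ (φ' r) r) (hc : Continuous φ') (h0 : φ 0 = 0 ∨ μ Set.univ < ⊤) :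
    inner ℝ l (superpose φ f) ≤ ∫ x, φ' (f x) * |relaxedSlope q μ f x| ^ q.toReal ∂μ := by
  have hq0 : q ≠ 0 := (zero_lt_one.trans hq).ne'
  have hp0 : 0 < q.toReal := ENNReal.toReal_pos hq0 hq'
  have hp1 : 1 ≤ q.toReal := by
    simpa using (ENNReal.toReal_le_toReal ENNReal.one_ne_top hq').2 hq.le
  set p := q.toReal with hpq
  obtain ⟨hfa, hfle⟩ := hf.le hq hq'
  set a := relaxedSlope q μ f
  have hbd := abs_deriv_le_of_lipschitzWith hφ hφ'
  -- steps so small that `1 + ε φ'` stays positive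
  set ε : ℕ → ℝ := fun n => 1 / ((n : ℝ) + 1) * (1 / (K + 1)) with hε
  have hεpos : ∀ n, 0 < ε n := fun n => by positivity
  have hεK : ∀ n, ε n * K < 1 := fun n => by
    have h1 : 1 / ((n : ℝ) + 1) ≤ 1 := by
      rw [div_le_one (by positivity)]
      have : (0 : ℝ) ≤ n := Nat.cast_nonneg n
      linarith
    have h2 : 1 / ((K : ℝ) + 1) * K < 1 := by
      rw [one_div, inv_mul_eq_div, div_lt_one (by positivity)]; linarith
    calc ε n * K = 1 / ((n : ℝ) + 1) * (1 / ((K : ℝ) + 1) * K) := by rw [hε]; ring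
      _ ≤ 1 * (1 / ((K : ℝ) + 1) * K) := mul_le_mul_of_nonneg_right h1 (by positivity)
      _ < 1 := by rwa [one_mul]
  have hsmall : ∀ n r, |ε n * φ' r| < 1 := fun n r => by
    rw [abs_mul, abs_of_pos (hεpos n)]
    exact (mul_le_mul_of_nonneg_left (hbd r) (hεpos n).le).trans_lt (hεK n)
  have hmeas : ∀ n, Measurable fun r => φ' r * (1 + ε n * φ' r) ^ (p - 1) := fun n =>
    hc.measurable.mul ((measurable_const.add (measurable_const.mul hc.measurable)).pow_const _)
  have hbound : ∀ n r, |φ' r * (1 + ε n * φ' r) ^ (p - 1)| ≤ K * 2 ^ (p - 1) := fun n r => by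
    have h1 := abs_lt.1 (hsmall n r)
    rw [abs_mul, abs_of_nonneg (Real.rpow_nonneg (by linarith : 0 ≤ 1 + ε n * φ' r) _)]
    exact mul_le_mul (hbd r) (Real.rpow_le_rpow (by linarith) (by linarith) (by linarith))
      (Real.rpow_nonneg (by linarith) _) K.2
  have hfm : Measurable f := (Lp.stronglyMeasurable f).measurable
  have hia := integrable_abs_rpow hq0 hq' a
  have hint : ∀ n, Integrable
      (fun x => φ' (f x) * (1 + ε n * φ' (f x)) ^ (p - 1) * |a x| ^ p) μ := fun n =>
    hia.bdd_mul ((hmeas n).comp hfm).aestronglyMeasurable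
      (Eventually.of_forall fun x => hbound n (f x))
  have key : ∀ n, inner ℝ l (superpose φ f) ≤
      ∫ x, φ' (f x) * (1 + ε n * φ' (f x)) ^ (p - 1) * |a x| ^ p ∂μ := by
    intro n
    set η : ℝ → ℝ := fun r => (-ε n) * φ r with hηdef
    have hη : LipschitzWith _ η := (lipschitzWith_smul (-ε n)).comp hφ
    have hη' : ∀ r, HasDerivAt η ((-ε n) * φ' r) r := fun r => (hφ' r).const_mul _
    have h0η : η 0 = 0 ∨ μ Set.univ < ⊤ := h0.imp_left fun h => by simp [hηdef, h]
    have m := sub_superpose_mem_slopeGraph hq' hfa zero_mem_slopeGraph hη hη'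
      (continuous_const.mul hc) h0η
    have i := hfle _ _ m
    rw [sub_zero, hηdef, superpose_const_mul hφ h0, sub_sub_cancel_left, ← neg_smul, neg_neg,
      inner_smul_right] at i
    set c := weightMul (fun r => |1 - -ε n * φ' r|) f a +
      weightMul (fun r => |-ε n * φ' r|) f (0 : Lp ℝ q μ)
    have hcx : ∀ᵐ x ∂μ, |c x| ^ p = (1 + ε n * φ' (f x)) ^ p * |a x| ^ p := by
      have b1 : ∀ r, |(|1 - -ε n * φ' r|)| ≤ 2 := fun r => by
        have := abs_lt.1 (hsmall n r)
        rw [abs_abs, abs_le]; constructor <;> linarith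
      have b2 : ∀ r, |(|-ε n * φ' r|)| ≤ 1 := fun r => by
        rw [abs_abs, neg_mul, abs_neg]; exact (hsmall n r).le
      have c1 : Measurable fun r => |1 - -ε n * φ' r| :=
        (continuous_const.sub (continuous_const.mul hc)).abs.measurable
      have c2 : Measurable fun r => |-ε n * φ' r| := (continuous_const.mul hc).abs.measurable
      filter_upwards [Lp.coeFn_add (weightMul (fun r => |1 - -ε n * φ' r|) f a)
          (weightMul (fun r => |-ε n * φ' r|) f (0 : Lp ℝ q μ)),
        coeFn_weightMul c1 b1 f a, coeFn_weightMul c2 b2 f (0 : Lp ℝ q μ),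
        Lp.coeFn_zero ℝ q μ] with x h1 h2 h3 h4
      have h5 := abs_lt.1 (hsmall n (f x))
      rw [h1, Pi.add_apply, h2, h3, h4, Pi.zero_apply, mul_zero, add_zero, abs_mul, abs_abs,
        Real.mul_rpow (abs_nonneg _) (abs_nonneg _), neg_mul, sub_neg_eq_add,
        abs_of_nonneg (by linarith : 0 ≤ 1 + ε n * φ' (f x))]
    simp only [norm_rpow_eq_integral hq0 hq'] at i
    rw [← hpq] at i
    have hdiff : (∫ x, |c x| ^ p ∂μ) - ∫ x, |a x| ^ p ∂μ ≤
        p * ε n * ∫ x, φ' (f x) * (1 + ε n * φ' (f x)) ^ (p - 1) * |a x| ^ p ∂μ := by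
      rw [← integral_sub (integrable_abs_rpow hq0 hq' c) hia, ← integral_const_mul]
      refine integral_mono_ae ((integrable_abs_rpow hq0 hq' c).sub hia)
        ((hint n).const_mul _) ?_
      filter_upwards [hcx] with x hx
      have h1 := one_add_rpow_sub_one_le hp1 (abs_lt.1 (hsmall n (f x))).1
      have h2 := mul_le_mul_of_nonneg_right h1 (by positivity : 0 ≤ |a x| ^ p)
      rw [hx]
      linarith
    have hfin : p * ε n * inner ℝ l (superpose φ f) ≤
        p * ε n * ∫ x, φ' (f x) * (1 + ε n * φ' (f x)) ^ (p - 1) * |a x| ^ p ∂μ := by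
      linarith
    exact le_of_mul_le_mul_left hfin (mul_pos hp0 (hεpos n))
  refine ge_of_tendsto' (x := atTop) ?_ key
  refine tendsto_integral_of_dominated_convergence (fun x => K * 2 ^ (p - 1) * |a x| ^ p)
    (fun n => (hint n).aestronglyMeasurable) (hia.const_mul _)
    (fun n => Eventually.of_forall fun x => ?_) (Eventually.of_forall fun x => ?_)
  · rw [norm_mul, Real.norm_of_nonneg (by positivity : 0 ≤ |a x| ^ p)]
    exact mul_le_mul_of_nonneg_right (hbound n (f x)) (by positivity)
  · have h1 : Tendsto ε atTop (𝓝 0) := by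
      have := (tendsto_one_div_add_atTop_nhds_zero_nat (𝕜 := ℝ)).mul_const (1 / ((K : ℝ) + 1))
      rwa [zero_mul] at this
    have h2 : Tendsto (fun n => 1 + ε n * φ' (f x)) atTop (𝓝 1) := by
      simpa using (h1.mul_const (φ' (f x))).const_add 1
    have h3 := (h2.rpow_const (p := p - 1) (.inl one_ne_zero))
    have h4 := (h3.const_mul (φ' (f x))).mul_const (|a x| ^ p)
    simpa using h4

/-- The Euler equation `∫ l φ(f) = ∫ φ'(f) |∇f|_*^q` for smooth `φ`. -/
lemma inner_superpose_eq_of_contDiff (hq : 1 < q) (hq' : q ≠ ⊤) {f l : Lp ℝ 2 μ}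
    (hf : IsSubgradient q μ f l) {φ φ' : ℝ → ℝ} {K : ℝ≥0} (hφ : LipschitzWith K φ)
    (hφ' : ∀ r, HasDerivAt φ (φ' r) r) (hc : Continuous φ') (h0 : φ 0 = 0 ∨ μ Set.univ < ⊤) :
    inner ℝ l (superpose φ f) = ∫ x, φ' (f x) * |relaxedSlope q μ f x| ^ q.toReal ∂μ := by
  refine le_antisymm (inner_superpose_le_integral hq hq' hf hφ hφ' hc h0) ?_
  have h1 := inner_superpose_le_integral hq hq' hf (φ := fun r => (-1) * φ r)
    (φ' := fun r => (-1) * φ' r) ((lipschitzWith_smul (-1 : ℝ)).comp hφ)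
    (fun r => (hφ' r).const_mul _) (continuous_const.mul hc) (h0.imp_left fun h => by simp [h])
  rw [superpose_const_mul hφ h0, inner_smul_right] at h1
  simp only [mul_assoc] at h1
  rw [integral_const_mul] at h1
  linarith

end

/-! ### The Euler equation for bounded measurable weights -/

section

/-- The primitive `r ↦ ∫₀^r ρ`. -/
def primitive (ρ : ℝ → ℝ) (r : ℝ) : ℝ := ∫ s in (0 : ℝ)..r, ρ s

lemma primitive_zero (ρ : ℝ → ℝ) : primitive ρ 0 = 0 := by simp [primitive]

lemma intervalIntegrable_of_bounded {ρ : ℝ → ℝ} {B : ℝ} (hρ : Measurable ρ)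
    (hB : ∀ r, |ρ r| ≤ B) (a b : ℝ) : IntervalIntegrable ρ volume a b :=
  (intervalIntegrable_const (c := B)).mono_fun hρ.aestronglyMeasurable
    (Eventually.of_forall fun r => (hB r).trans (le_abs_self B))

lemma lipschitzWith_primitive {ρ : ℝ → ℝ} {B : ℝ≥0} (hρ : Measurable ρ) (hB : ∀ r, |ρ r| ≤ B) :
    LipschitzWith B (primitive ρ) := by
  refine LipschitzWith.of_dist_le_mul fun r s => ?_
  have hi := intervalIntegrable_of_bounded hρ hB
  rw [Real.dist_eq, primitive, primitive,
    intervalIntegral.integral_interval_sub_left (hi _ _) (hi _ _)]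
  have := intervalIntegral.norm_integral_le_of_norm_le_const (f := ρ) (a := s) (b := r)
    (C := (B : ℝ)) fun t _ => hB t
  rwa [Real.norm_eq_abs] at this

lemma enorm_primitive_le (ρ : ℝ → ℝ) (r : ℝ) :
    ‖primitive ρ r‖ₑ ≤ ∫⁻ s in Set.uIoc 0 r, ‖ρ s‖ₑ := by
  rw [primitive, intervalIntegral.intervalIntegral_eq_integral_uIoc, enorm_smul]
  refine le_trans (le_of_eq ?_) (enorm_integral_le_lintegral_enorm _)
  split_ifs <;> simp

variable {M : Type*} [MetricSpace M] [MeasurableSpace M] [BorelSpace M] {μ : Measure M} {q : ℝ≥0∞}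
  [Fact (1 ≤ q)]

/-- The Euler equation `∫ l φ(f) = ∫ φ'(f) |∇f|_*^q` when `φ` is the primitive of a bounded
measurable function `ρ`. Both sides are integrals of `ρ` against finite (signed) measures on the
line; they agree for continuous `ρ`, hence always. In particular the image of
`|∇f|_*^q μ` under `f` is absolutely continuous. -/
lemma inner_superpose_primitive [SFinite μ] (hq : 1 < q) (hq' : q ≠ ⊤) {f l : Lp ℝ 2 μ}
    (hf : IsSubgradient q μ f l) {ρ : ℝ → ℝ} {B : ℝ≥0} (hρ : Measurable ρ)
    (hB : ∀ r, |ρ r| ≤ B) :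
    inner ℝ l (superpose (primitive ρ) f) =
      ∫ x, ρ (f x) * |relaxedSlope q μ f x| ^ q.toReal ∂μ := by
  have hq0 : q ≠ 0 := (zero_lt_one.trans hq).ne'
  set a := relaxedSlope q μ f
  have hfm : Measurable f := (Lp.stronglyMeasurable f).measurable
  have hlm : Measurable l := (Lp.stronglyMeasurable l).measurable
  have hia := integrable_abs_rpow hq0 hq' a
  have ham : Measurable fun x => |a x| ^ q.toReal :=
    ((Lp.stronglyMeasurable a).measurable.norm).pow_const _
  -- the measure representing the right-hand side
  set ν : Measure ℝ := (μ.withDensity fun x => ENNReal.ofReal (|a x| ^ q.toReal)).map f with hν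
  -- a measure dominating the left-hand side
  set T : Set (M × ℝ) := {z | z.2 ∈ Set.uIoc 0 (f z.1)} with hT
  have hTm : MeasurableSet T := by
    have h1 : T = {z | min 0 (f z.1) < z.2} ∩ {z | z.2 ≤ max 0 (f z.1)} := rfl
    rw [h1]
    exact (measurableSet_lt (measurable_const.min (hfm.comp measurable_fst)) measurable_snd).inter
      (measurableSet_le measurable_snd (measurable_const.max (hfm.comp measurable_fst)))
  set ν' : Measure ℝ :=
    (((μ.withDensity fun x => ‖l x‖ₑ).prod (volume : Measure ℝ)).restrict T).map Prod.snd with hν'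
  have hν'l : ∀ σ : ℝ → ℝ, Measurable σ →
      ∫⁻ s, ‖σ s‖ₑ ∂ν' = ∫⁻ x, ‖l x‖ₑ * (∫⁻ s in Set.uIoc 0 (f x), ‖σ s‖ₑ) ∂μ := by
    intro σ hσ
    have hm : Measurable (T.indicator fun z : M × ℝ => ‖σ z.2‖ₑ) :=
      (hσ.comp measurable_snd).enorm.indicator hTm
    rw [hν', lintegral_map hσ.enorm measurable_snd, ← lintegral_indicator hTm,
      lintegral_prod _ hm.aemeasurable,
      lintegral_withDensity_eq_lintegral_mul _ hlm.enorm hm.lintegral_prod_right']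
    refine lintegral_congr fun x => ?_
    rw [Pi.mul_apply, ← lintegral_indicator measurableSet_uIoc]
    rfl
  have hlf : Integrable (fun x => l x * f x) μ := (Lp.memLp l).integrable_mul (Lp.memLp f)
  have hν'fin : IsFiniteMeasure ν' := by
    refine ⟨?_⟩
    have h1 := hν'l (fun _ => 1) measurable_const
    simp only [enorm_one, lintegral_const, one_mul, Measure.restrict_apply_univ] at h1
    rw [h1]
    refine lt_of_le_of_lt (lintegral_mono fun x => ?_) hlf.2
    rw [enorm_mul]
    gcongr
    rw [Set.uIoc, Real.volume_Ioc, max_sub_min_eq_abs, sub_zero, Real.enorm_eq_ofReal_abs]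
  have hνfin : IsFiniteMeasure ν := by
    have : IsFiniteMeasure (μ.withDensity fun x => ENNReal.ofReal (|a x| ^ q.toReal)) :=
      isFiniteMeasure_withDensity_ofReal hia.2
    exact Measure.isFiniteMeasure_map _ _
  have hνint : ∀ σ : ℝ → ℝ, Measurable σ →
      ∫ s, σ s ∂ν = ∫ x, σ (f x) * |a x| ^ q.toReal ∂μ := by
    intro σ hσ
    rw [hν, integral_map hfm.aemeasurable hσ.aestronglyMeasurable,
      integral_withDensity_eq_integral_toReal_smul ham.ennreal_ofReal
        (Eventually.of_forall fun x => ENNReal.ofReal_lt_top)]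
    refine integral_congr_ae (Eventually.of_forall fun x => ?_)
    simp only [smul_eq_mul]
    rw [ENNReal.toReal_ofReal (by positivity), mul_comm]
  rw [inner_superpose_eq_integral (lipschitzWith_primitive hρ hB) (.inl (primitive_zero ρ)),
    ← hνint ρ hρ]
  have hlint : ∀ (σ : ℝ → ℝ) (C : ℝ≥0), Measurable σ → (∀ r, |σ r| ≤ C) →
      Integrable (fun x => l x * primitive σ (f x)) μ := fun σ C hσ hC =>
    (Lp.memLp l).integrable_mul
      (memLp_superpose (lipschitzWith_primitive hσ hC) (.inl (primitive_zero σ)) f)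
  have hbint : ∀ (σ : ℝ → ℝ) (C : ℝ≥0), Measurable σ → (∀ r, |σ r| ≤ C) →
      Integrable σ (ν + ν') := fun σ C hσ hC =>
    Integrable.of_bound hσ.aestronglyMeasurable C (Eventually.of_forall hC)
  -- approximate `ρ` by a continuous `σ` in `L¹` of both measures
  refine eq_of_abs_sub_le_all fun δ hδ => ?_
  obtain ⟨σ, hσ, hσint⟩ := (hbint ρ B hρ hB).exists_boundedContinuous_integral_sub_le
    (half_pos hδ)
  have hσm : Measurable σ := σ.continuous.measurable
  have hσB : ∀ r, |σ r| ≤ ‖σ‖₊ := fun r => σ.norm_coe_le_norm r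
  have hdm : Measurable fun r => ρ r - σ r := hρ.sub hσm
  have hdB : ∀ r, |ρ r - σ r| ≤ ((B + ‖σ‖₊ : ℝ≥0) : ℝ) := fun r => by
    push_cast
    exact (abs_sub _ _).trans (add_le_add (hB r) (hσB r))
  have hdint := hbint _ _ hdm hdB
  have e0 : ∫ x, l x * primitive σ (f x) ∂μ = ∫ s, σ s ∂ν := by
    rw [hνint σ hσm, ← inner_superpose_eq_integral (lipschitzWith_primitive hσm hσB)
      (.inl (primitive_zero σ))]
    refine inner_superpose_eq_of_contDiff hq hq' hf (lipschitzWith_primitive hσm hσB)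
      (fun r => ?_) σ.continuous (.inl (primitive_zero σ))
    exact intervalIntegral.integral_hasDerivAt_right (σ.continuous.intervalIntegrable _ _)
      (σ.continuous.stronglyMeasurableAtFilter _ _) σ.continuous.continuousAt
  have hsplit : ∫ s, ‖ρ s - σ s‖ ∂(ν + ν') = ∫ s, ‖ρ s - σ s‖ ∂ν + ∫ s, ‖ρ s - σ s‖ ∂ν' :=
    integral_add_measure hdint.norm.left_of_add_measure hdint.norm.right_of_add_measure
  have e1 : |∫ s, ρ s ∂ν - ∫ s, σ s ∂ν| ≤ ∫ s, ‖ρ s - σ s‖ ∂ν := by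
    rw [← integral_sub (hbint ρ B hρ hB).left_of_add_measure
      (hbint σ _ hσm hσB).left_of_add_measure]
    exact norm_integral_le_integral_norm fun s => ρ s - σ s
  have e2 : |∫ x, l x * primitive ρ (f x) ∂μ - ∫ x, l x * primitive σ (f x) ∂μ| ≤
      ∫ s, ‖ρ s - σ s‖ ∂ν' := by
    rw [← integral_sub (hlint ρ B hρ hB) (hlint σ _ hσm hσB)]
    have hp : ∀ r, primitive ρ r - primitive σ r = primitive (fun s => ρ s - σ s) r := fun r =>
      (intervalIntegral.integral_sub (intervalIntegrable_of_bounded hρ hB _ _)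
        (intervalIntegrable_of_bounded hσm hσB _ _)).symm
    simp only [← mul_sub, hp]
    rw [integral_norm_eq_lintegral_enorm hdm.aestronglyMeasurable, hν'l _ hdm]
    have hfin : ∫⁻ x, ‖l x‖ₑ * (∫⁻ s in Set.uIoc 0 (f x), ‖ρ s - σ s‖ₑ) ∂μ ≠ ⊤ := by
      rw [← hν'l _ hdm]
      exact hdint.right_of_add_measure.2.ne
    rw [← Real.norm_eq_abs, ← toReal_enorm]
    refine ENNReal.toReal_mono hfin ((enorm_integral_le_lintegral_enorm _).trans
      (lintegral_mono fun x => ?_))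
    rw [enorm_mul]
    gcongr
    exact enorm_primitive_le _ _
  have e3 : (∫ x, l x * primitive ρ (f x) ∂μ) - ∫ s, ρ s ∂ν =
      (∫ x, l x * primitive ρ (f x) ∂μ - ∫ x, l x * primitive σ (f x) ∂μ) -
        (∫ s, ρ s ∂ν - ∫ s, σ s ∂ν) := by rw [e0]; ring
  rw [e3]
  refine (abs_sub _ _).trans ?_
  have : ∫ s, ‖ρ s - σ s‖ ∂(ν + ν') ≤ δ / 2 := hσ
  linarith

/-- The mean of a subgradient vanishes, since `Ch_q` is invariant under adding constants. -/
lemma integral_subgradient_eq_zero (hq : 1 < q) (hq' : q ≠ ⊤) {f l : Lp ℝ 2 μ}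
    (hf : IsSubgradient q μ f l) (hμ : μ Set.univ < ⊤) : ∫ x, l x ∂μ = 0 := by
  have h := inner_superpose_eq_of_contDiff hq hq' hf (φ := fun _ => 1) (φ' := fun _ => 0)
    (LipschitzWith.const (1 : ℝ)) (fun r => hasDerivAt_const r 1) continuous_const (.inr hμ)
  rw [inner_superpose_eq_integral (LipschitzWith.const (1 : ℝ)) (.inr hμ)] at h
  simpa using h

end

/-! ### Integral functionals along curves in `L²` -/

section

/-- `e` is a `C^{1,1}` function with derivative `ψ`, such that `u ↦ ∫ e(u) dμ` is finite on `L²`.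
The derivative is encoded by the quadratic bound for the first-order Taylor remainder; the constant
`K` serves both in this bound and as a Lipschitz constant of `ψ`. -/
structure IsSmoothIntegrand {M : Type*} [MeasurableSpace M] (μ : Measure M) (e ψ : ℝ → ℝ)
    (K : ℝ≥0) : Prop where
  lipschitz : LipschitzWith K ψ
  remainder : ∀ r s, |e s - e r - ψ r * (s - r)| ≤ K * (s - r) ^ 2
  zero : (e 0 = 0 ∧ ψ 0 = 0) ∨ μ Set.univ < ⊤

lemma hasDerivAt_of_remainder {e ψ : ℝ → ℝ} {K : ℝ≥0}
    (h : ∀ r s, |e s - e r - ψ r * (s - r)| ≤ K * (s - r) ^ 2) (r : ℝ) :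
    HasDerivAt e (ψ r) r := by
  rw [hasDerivAt_iff_isLittleO]
  have h1 : (fun s => e s - e r - (s - r) • ψ r) =O[𝓝 r] fun s => ‖s - r‖ ^ 2 := by
    refine Asymptotics.IsBigO.of_bound K (Eventually.of_forall fun s => ?_)
    rw [smul_eq_mul, mul_comm (s - r)]
    simpa using h r s
  exact h1.trans_isLittleO (Asymptotics.isLittleO_pow_sub_sub r one_lt_two)

lemma primitive_remainder_le {ψ : ℝ → ℝ} {K : ℝ≥0} (hψ : LipschitzWith K ψ) (r s : ℝ) :
    |primitive ψ s - primitive ψ r - ψ r * (s - r)| ≤ K * (s - r) ^ 2 := by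
  have hi : ∀ a b, IntervalIntegrable ψ volume a b := fun a b =>
    hψ.continuous.intervalIntegrable a b
  have h1 : primitive ψ s - primitive ψ r - ψ r * (s - r) = ∫ t in r..s, (ψ t - ψ r) := by
    rw [intervalIntegral.integral_sub (hi _ _) intervalIntegrable_const,
      intervalIntegral.integral_const, primitive, primitive,
      intervalIntegral.integral_interval_sub_left (hi _ _) (hi _ _), smul_eq_mul, mul_comm (ψ r)]
  rw [h1, ← sq_abs, sq, ← mul_assoc, ← Real.norm_eq_abs]
  refine intervalIntegral.norm_integral_le_of_norm_le_const fun t ht => ?_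
  refine (hψ.norm_sub_le t r).trans (mul_le_mul_of_nonneg_left ?_ K.2)
  rw [Real.norm_eq_abs]
  rcases Set.mem_uIoc.1 ht with h | h
  · rw [abs_of_pos (by linarith), abs_of_pos (by linarith)]; linarith
  · rw [abs_of_nonpos (by linarith), abs_of_neg (by linarith)]; linarith

namespace IsSmoothIntegrand
variable {M : Type*} [MeasurableSpace M] {μ : Measure M} {e ψ : ℝ → ℝ} {K : ℝ≥0}

lemma zero_deriv (he : IsSmoothIntegrand μ e ψ K) : ψ 0 = 0 ∨ μ Set.univ < ⊤ :=
  he.zero.imp_left And.right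

lemma continuous (he : IsSmoothIntegrand μ e ψ K) : Continuous e :=
  continuous_iff_continuousAt.2 fun r => (hasDerivAt_of_remainder he.remainder r).continuousAt

lemma integrable_remainder (he : IsSmoothIntegrand μ e ψ K) (u v : Lp ℝ 2 μ) :
    Integrable (fun x => e (v x) - e (u x) - ψ (u x) * (v x - u x)) μ := by
  have hum := Lp.aestronglyMeasurable u
  have hvm := Lp.aestronglyMeasurable v
  have hsq : Integrable (fun x => K * (v x - u x) ^ 2) μ := by
    have := ((Lp.memLp v).sub (Lp.memLp u)).integrable_sq.const_mul (K : ℝ)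
    simpa using this
  refine hsq.mono' ?_ (Eventually.of_forall fun x => he.remainder _ _)
  exact ((he.continuous.comp_aestronglyMeasurable hvm).sub
    (he.continuous.comp_aestronglyMeasurable hum)).sub
      ((he.lipschitz.continuous.comp_aestronglyMeasurable hum).mul (hvm.sub hum))

lemma integrable_deriv_mul (he : IsSmoothIntegrand μ e ψ K) (u v w : Lp ℝ 2 μ) :
    Integrable (fun x => ψ (u x) * (v x - w x)) μ :=
  (memLp_superpose he.lipschitz he.zero_deriv u).integrable_mul ((Lp.memLp v).sub (Lp.memLp w))

lemma integrable (he : IsSmoothIntegrand μ e ψ K) (u : Lp ℝ 2 μ) :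
    Integrable (fun x => e (u x)) μ := by
  have h0 : Integrable (fun x => e ((0 : Lp ℝ 2 μ) x)) μ := by
    have hae : (fun x => e ((0 : Lp ℝ 2 μ) x)) =ᵐ[μ] fun _ => e 0 := by
      filter_upwards [Lp.coeFn_zero ℝ 2 μ] with x hx
      rw [hx]; rfl
    rw [integrable_congr hae]
    rcases he.zero with h | h
    · rw [h.1]; exact integrable_zero _ _ _
    · have : IsFiniteMeasure μ := ⟨h⟩
      exact integrable_const _
  have := ((he.integrable_remainder 0 u).add (he.integrable_deriv_mul 0 u 0)).add h0
  refine this.congr (Eventually.of_forall fun x => ?_)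
  simp only [Pi.add_apply]
  ring

/-- The functional `u ↦ ∫ e(u) dμ` is differentiable on `L²` with gradient `ψ(u)`. -/
lemma abs_integral_sub_le (he : IsSmoothIntegrand μ e ψ K) (u v : Lp ℝ 2 μ) :
    |∫ x, e (v x) ∂μ - ∫ x, e (u x) ∂μ - inner ℝ (superpose ψ u) (v - u)| ≤ K * ‖v - u‖ ^ 2 := by
  have h1 : inner ℝ (superpose ψ u) (v - u) = ∫ x, ψ (u x) * (v x - u x) ∂μ := by
    rw [real_inner_comm, inner_superpose_eq_integral he.lipschitz he.zero_deriv]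
    refine integral_congr_ae ?_
    filter_upwards [Lp.coeFn_sub v u] with x hx
    rw [hx, mul_comm]; rfl
  have h2 : K * ‖v - u‖ ^ 2 = ∫ x, K * (v x - u x) ^ 2 ∂μ := by
    rw [integral_const_mul, ← real_inner_self_eq_norm_sq, L2.inner_def]
    congr 1
    refine integral_congr_ae ?_
    filter_upwards [Lp.coeFn_sub v u] with x hx
    rw [hx, sq]; rfl
  have hsq : Integrable (fun x => K * (v x - u x) ^ 2) μ := by
    have := ((Lp.memLp v).sub (Lp.memLp u)).integrable_sq.const_mul (K : ℝ)
    simpa using this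
  have h3 : Integrable (fun x => e (v x) - e (u x)) μ := (he.integrable v).sub (he.integrable u)
  rw [h1, h2, ← integral_sub (he.integrable v) (he.integrable u),
    ← integral_sub h3 (he.integrable_deriv_mul u v u)]
  exact (norm_integral_le_integral_norm _).trans
    (integral_mono (he.integrable_remainder u v).norm hsq fun x => he.remainder _ _)

lemma hasFDerivAt (he : IsSmoothIntegrand μ e ψ K) (u : Lp ℝ 2 μ) :
    HasFDerivAt (fun u : Lp ℝ 2 μ => ∫ x, e (u x) ∂μ) (innerSL ℝ (superpose ψ u)) u := by
  rw [hasFDerivAt_iff_isLittleO]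
  have h1 : (fun v : Lp ℝ 2 μ => ∫ x, e (v x) ∂μ - ∫ x, e (u x) ∂μ -
      innerSL ℝ (superpose ψ u) (v - u)) =O[𝓝 u] fun v => ‖v - u‖ ^ 2 := by
    refine Asymptotics.IsBigO.of_bound K (Eventually.of_forall fun v => ?_)
    simpa using he.abs_integral_sub_le u v
  exact h1.trans_isLittleO (Asymptotics.isLittleO_pow_sub_sub u one_lt_two)

lemma hasDerivAt_comp (he : IsSmoothIntegrand μ e ψ K) {h : ℝ → Lp ℝ 2 μ} {h' : Lp ℝ 2 μ} {t : ℝ}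
    (hh : HasDerivAt h h' t) :
    HasDerivAt (fun s => ∫ x, e (h s x) ∂μ) (inner ℝ (superpose ψ (h t)) h') t :=
  (he.hasFDerivAt (h t)).comp_hasDerivAt t hh

lemma lipschitzOnWith_comp (he : IsSmoothIntegrand μ e ψ K) {h : ℝ → Lp ℝ 2 μ} {a b : ℝ} {L : ℝ≥0}
    (hh : LipschitzOnWith L h (Set.Icc a b)) :
    ∃ L', LipschitzOnWith L' (fun s => ∫ x, e (h s x) ∂μ) (Set.Icc a b) := by
  obtain ⟨R, hR⟩ := isCompact_Icc.exists_bound_of_continuousOn hh.continuousOn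
  have hR' : ∀ s ∈ Set.Icc a b, ‖h s‖ ≤ R.toNNReal := fun s hs =>
    (hR s hs).trans (Real.le_coe_toNNReal R)
  refine ⟨(K * R.toNNReal + ‖superpose ψ (0 : Lp ℝ 2 μ)‖₊ + K * (R.toNNReal + R.toNNReal)) * L,
    LipschitzOnWith.of_dist_le_mul fun s hs t ht => ?_⟩
  have h1 := hh.dist_le_mul s hs t ht
  have h2 := he.abs_integral_sub_le (h t) (h s)
  have h3 := abs_real_inner_le_norm (superpose ψ (h t)) (h s - h t)
  have h4 : ‖superpose ψ (h t)‖ ≤ K * R.toNNReal + ‖superpose ψ (0 : Lp ℝ 2 μ)‖ := by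
    have h5 := norm_superpose_sub_le he.lipschitz he.zero_deriv (h t) 0
    rw [sub_zero] at h5
    have h6 := norm_sub_norm_le (superpose ψ (h t)) (superpose ψ 0)
    have h7 := mul_le_mul_of_nonneg_left (hR' t ht) K.coe_nonneg
    linarith
  have h8 : ‖h s - h t‖ ≤ R.toNNReal + R.toNNReal :=
    (norm_sub_le _ _).trans (add_le_add (hR' s hs) (hR' t ht))
  rw [dist_eq_norm] at h1
  rw [Real.dist_eq]
  push_cast
  set Φs := ∫ x, e (h s x) ∂μ
  set Φt := ∫ x, e (h t x) ∂μ
  have h9 : |Φs - Φt| ≤ (K * R.toNNReal + ‖superpose ψ (0 : Lp ℝ 2 μ)‖ +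
      K * (R.toNNReal + R.toNNReal)) * ‖h s - h t‖ := by
    have g1 := abs_sub_abs_le_abs_sub (Φs - Φt) (inner ℝ (superpose ψ (h t)) (h s - h t))
    have g2 : K * ‖h s - h t‖ ^ 2 ≤ K * (R.toNNReal + R.toNNReal) * ‖h s - h t‖ := by
      rw [sq, ← mul_assoc]
      gcongr
    have g3 := mul_le_mul_of_nonneg_right h4 (norm_nonneg (h s - h t))
    linarith
  refine h9.trans ?_
  rw [mul_assoc]
  exact mul_le_mul_of_nonneg_left h1 (by positivity)

end IsSmoothIntegrand

/-- The fundamental theorem of calculus on `(0, t]` for a nonincreasing function that is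
absolutely continuous away from `0` and has a limit at `0`. -/
lemma lintegral_neg_deriv_eq {F : ℝ → ℝ} {F₀ t : ℝ} (ht : 0 < t)
    (hAC : ∀ δ, 0 < δ → AbsolutelyContinuousOnInterval F δ t)
    (hlim : Tendsto F (𝓝[>] 0) (𝓝 F₀))
    (hneg : ∀ᵐ s ∂(volume.restrict (Set.Ioi (0 : ℝ))), deriv F s ≤ 0) :
    F t ≤ F₀ ∧ ∫⁻ s in Set.Ioc 0 t, ENNReal.ofReal (-deriv F s) = ENNReal.ofReal (F₀ - F t) := by
  have hstep : ∀ δ, 0 < δ → δ ≤ t → F t ≤ F δ ∧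
      ∫⁻ s in Set.Ioc δ t, ENNReal.ofReal (-deriv F s) = ENNReal.ofReal (F δ - F t) := by
    intro δ hδ hδt
    have h1 := (hAC δ hδ).integral_deriv_eq_sub
    have h2 := (intervalIntegrable_iff_integrableOn_Ioc_of_le hδt).1
      (hAC δ hδ).intervalIntegrable_deriv
    have h3 : ∀ᵐ s ∂(volume.restrict (Set.Ioc δ t)), 0 ≤ -deriv F s := by
      have := ae_mono (Measure.restrict_mono
        (show Set.Ioc δ t ⊆ Set.Ioi 0 from fun s hs => hδ.trans hs.1) le_rfl) hneg
      filter_upwards [this] with s hs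
      linarith
    have h4 : ∫ s in Set.Ioc δ t, -deriv F s = F δ - F t := by
      rw [integral_neg, ← intervalIntegral.integral_of_le hδt, h1]; ring
    refine ⟨?_, ?_⟩
    · have := integral_nonneg_of_ae h3
      rw [h4] at this
      linarith
    · have h5 : Integrable (fun s => -deriv F s) (volume.restrict (Set.Ioc δ t)) := h2.neg
      rw [← h4, ofReal_integral_eq_lintegral_ofReal h5 h3]
  set δ : ℕ → ℝ := fun n => t / (n + 1) with hδdef
  have hδ : ∀ n, 0 < δ n := fun n => by positivity
  have hδt : ∀ n, δ n ≤ t := fun n => by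
    rw [hδdef]; refine div_le_self ht.le ?_
    have : (0 : ℝ) ≤ n := Nat.cast_nonneg n
    linarith
  have hδanti : Antitone δ := fun m n hmn => by
    refine div_le_div_of_nonneg_left ht.le (by positivity) ?_
    have : (m : ℝ) ≤ n := Nat.cast_le.2 hmn
    linarith
  have hδlim : Tendsto δ atTop (𝓝 0) := by
    have := (tendsto_one_div_add_atTop_nhds_zero_nat (𝕜 := ℝ)).const_mul t
    simpa [hδdef, div_eq_mul_inv] using this
  have hδlim' : Tendsto δ atTop (𝓝[>] 0) :=
    tendsto_nhdsWithin_iff.2 ⟨hδlim, Eventually.of_forall hδ⟩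
  have hF := hlim.comp hδlim'
  refine ⟨ge_of_tendsto' hF fun n => (hstep _ (hδ n) (hδt n)).1, ?_⟩
  have hU : Set.Ioc 0 t = ⋃ n, Set.Ioc (δ n) t := by
    ext s
    simp only [Set.mem_Ioc, Set.mem_iUnion]
    constructor
    · rintro ⟨h1, h2⟩
      obtain ⟨n, hn⟩ := (hδlim.eventually_lt_const h1).exists
      exact ⟨n, hn, h2⟩
    · rintro ⟨n, h1, h2⟩
      exact ⟨(hδ n).trans h1, h2⟩
  have hmono : Monotone fun n => Set.Ioc (δ n) t := fun m n hmn =>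
    Set.Ioc_subset_Ioc_left (hδanti hmn)
  rw [hU, setLIntegral_iUnion_of_directed _ hmono.directed_le]
  have hm : Monotone fun n => ∫⁻ s in Set.Ioc (δ n) t, ENNReal.ofReal (-deriv F s) :=
    fun m n hmn => lintegral_mono_set (hmono hmn)
  refine tendsto_nhds_unique (tendsto_atTop_iSup hm) ?_
  simp only [fun n => (hstep _ (hδ n) (hδt n)).2]
  exact ENNReal.tendsto_ofReal (hF.sub_const (F t))

/-- If `∫ e(h)` is dissipated at the rate `P ≥ 0` along a curve `h` in `L²` that is locally
Lipschitz on `(0, ∞)`, then its total loss is the integral of `P`. The rate agrees almost everywhere with a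
derivative, and so is measurable. -/
lemma IsSmoothIntegrand.lintegral_dissipation {M : Type*} [MeasurableSpace M] {μ : Measure M}
    {e ψ : ℝ → ℝ} {K : ℝ≥0} (he : IsSmoothIntegrand μ e ψ K) {h : ℝ → Lp ℝ 2 μ} {h₀ : Lp ℝ 2 μ}
    (hlim : Tendsto h (𝓝[>] 0) (𝓝 h₀)) (hL : LocallyLipschitzOn (Set.Ioi 0) h) {P : ℝ → ℝ}
    (hP : ∀ᵐ s ∂(volume.restrict (Set.Ioi (0 : ℝ))), 0 ≤ P s ∧
      ∃ h', HasDerivAt h h' s ∧ inner ℝ (superpose ψ (h s)) h' = -P s) {t : ℝ} (ht : 0 < t) :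
    ∫ x, e (h t x) ∂μ ≤ ∫ x, e (h₀ x) ∂μ ∧
      AEMeasurable P (volume.restrict (Set.Ioc 0 t)) ∧
      ∫⁻ s in Set.Ioc 0 t, ENNReal.ofReal (P s) =
        ENNReal.ofReal (∫ x, e (h₀ x) ∂μ - ∫ x, e (h t x) ∂μ) := by
  set F : ℝ → ℝ := fun s => ∫ x, e (h s x) ∂μ with hF
  have hAC : ∀ δ, 0 < δ → AbsolutelyContinuousOnInterval F δ t := by
    intro δ hδ
    have hsub : Set.uIcc δ t ⊆ Set.Ioi 0 := fun s hs => (lt_min hδ ht).trans_le hs.1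
    obtain ⟨L, hL'⟩ := (hL.mono hsub).exists_lipschitzOnWith_of_compact isCompact_uIcc
    obtain ⟨L'', hL''⟩ := he.lipschitzOnWith_comp hL'
    exact hL''.absolutelyContinuousOnInterval
  have hlimF : Tendsto F (𝓝[>] 0) (𝓝 (∫ x, e (h₀ x) ∂μ)) :=
    ((he.hasFDerivAt h₀).continuousAt.tendsto).comp hlim
  have hd : ∀ᵐ s ∂(volume.restrict (Set.Ioi (0 : ℝ))), 0 ≤ P s ∧ deriv F s = -P s := by
    filter_upwards [hP] with s ⟨h1, h', h2, h3⟩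
    exact ⟨h1, by rw [(he.hasDerivAt_comp h2).deriv, h3]⟩
  have hd' := ae_mono (Measure.restrict_mono
    (show Set.Ioc 0 t ⊆ Set.Ioi 0 from fun s hs => hs.1) le_rfl) hd
  obtain ⟨h1, h2⟩ := lintegral_neg_deriv_eq ht hAC hlimF
    (by filter_upwards [hd] with s hs; linarith [hs.1, hs.2])
  refine ⟨h1, ?_, ?_⟩
  · refine (measurable_deriv F).neg.aemeasurable.congr ?_
    filter_upwards [hd'] with s hs
    simp [hs.2]
  · rw [← h2]
    refine lintegral_congr_ae ?_
    filter_upwards [hd'] with s hs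
    rw [hs.2, neg_neg]

end

/-! ### The Moreau–Yosida regularization of a convex function on the line -/

section

/-- Existence of the proximal point: the quadratic term confines the minimization to a compact
interval. -/
lemma exists_prox {e : ℝ → ℝ≥0∞} (hlsc : LowerSemicontinuous e) {s₀ : ℝ} (hs₀ : e s₀ ≠ ⊤) {k : ℝ}
    (hk : 0 < k) (r : ℝ) :
    ∃ s, ∀ s', e s + ENNReal.ofReal (k * (r - s) ^ 2) ≤
      e s' + ENNReal.ofReal (k * (r - s') ^ 2) := by
  set G : ℝ → ℝ≥0∞ := fun s => e s + ENNReal.ofReal (k * (r - s) ^ 2) with hG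
  have hGtop : G s₀ ≠ ⊤ := ENNReal.add_ne_top.2 ⟨hs₀, ENNReal.ofReal_ne_top⟩
  have hGl : LowerSemicontinuous G :=
    hlsc.add (ENNReal.continuous_ofReal.comp
      (continuous_const.mul ((continuous_const.sub continuous_id).pow 2))).lowerSemicontinuous
  set R : ℝ := |r - s₀| + (G s₀).toReal / k + 1 with hR
  have hA0 : 0 ≤ (G s₀).toReal / k := by positivity
  have hmem : s₀ ∈ Set.Icc (r - R) (r + R) := by
    have := abs_le.1 (show |r - s₀| ≤ R by rw [hR]; linarith)
    constructor <;> linarith [this.1, this.2]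
  obtain ⟨s, -, hs⟩ := LowerSemicontinuousOn.exists_isMinOn ⟨s₀, hmem⟩ isCompact_Icc
    (hGl.lowerSemicontinuousOn (Set.Icc (r - R) (r + R)))
  refine ⟨s, fun s' => ?_⟩
  by_cases hs' : s' ∈ Set.Icc (r - R) (r + R)
  · exact hs hs'
  · refine (hs hmem).trans ?_
    have h1 : R ≤ |r - s'| := by
      by_contra! hcon
      have := abs_lt.1 hcon
      exact hs' ⟨by linarith [this.1, this.2], by linarith [this.1, this.2]⟩
    have h2 : (G s₀).toReal ≤ k * (r - s') ^ 2 := by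
      rw [← sq_abs]
      have h3 : (G s₀).toReal / k ≤ |r - s'| ^ 2 := by
        have : 0 ≤ |r - s₀| := abs_nonneg _
        nlinarith
      rwa [div_le_iff₀' hk] at h3
    calc G s₀ = ENNReal.ofReal (G s₀).toReal := (ENNReal.ofReal_toReal hGtop).symm
      _ ≤ ENNReal.ofReal (k * (r - s') ^ 2) := ENNReal.ofReal_le_ofReal h2
      _ ≤ _ := le_add_self

/-- The Moreau–Yosida regularization `m r = min_s (e s + k (r - s)²)` is a convex `C^{1,1}`
function below `e`, close to `e` for large `k`. -/
lemma exists_moreau {e : ℝ → ℝ≥0∞} (hlsc : LowerSemicontinuous e)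
    (hconv : ∀ x y a b : ℝ, 0 < a → 0 < b → a + b = 1 →
      e (a * x + b * y) ≤ ENNReal.ofReal a * e x + ENNReal.ofReal b * e y)
    {s₀ : ℝ} (hs₀ : e s₀ ≠ ⊤) {k : ℝ≥0} (hk : 0 < k) :
    ∃ m ψ : ℝ → ℝ, LipschitzWith (2 * k) ψ ∧ Monotone ψ ∧
      (∀ r s, |m s - m r - ψ r * (s - r)| ≤ k * (s - r) ^ 2) ∧ (∀ r, 0 ≤ m r) ∧
      (∀ r, ENNReal.ofReal (m r) ≤ e r) ∧ (e 0 = 0 → m 0 = 0 ∧ ψ 0 = 0) ∧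
      ∀ r δ a, 0 < δ → (∀ s, |s - r| < δ → a < e s) → a < ENNReal.ofReal (k * δ ^ 2) →
        a < ENNReal.ofReal (m r) := by
  have hk' : (0 : ℝ) < k := hk
  choose J hJ using exists_prox hlsc hs₀ hk'
  have hfin : ∀ r, e (J r) ≠ ⊤ := fun r => by
    have h1 := (hJ r s₀).trans_lt
      (ENNReal.add_lt_top.2 ⟨hs₀.lt_top, ENNReal.ofReal_lt_top⟩)
    exact (ENNReal.add_lt_top.1 h1).1.ne
  -- `J r` is the proximal point, where the minimum defining `m r` is attained
  set m : ℝ → ℝ := fun r => (e (J r)).toReal + k * (r - J r) ^ 2 with hm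
  have hmo : ∀ r, ENNReal.ofReal (m r) = e (J r) + ENNReal.ofReal (k * (r - J r) ^ 2) := fun r => by
    rw [hm, ENNReal.ofReal_add ENNReal.toReal_nonneg (by positivity),
      ENNReal.ofReal_toReal (hfin r)]
  have hm0 : ∀ r, 0 ≤ m r := fun r => add_nonneg ENNReal.toReal_nonneg (by positivity)
  have hmle : ∀ r s, e s ≠ ⊤ → m r ≤ (e s).toReal + k * (r - s) ^ 2 := fun r s hs => by
    have h1 := hJ r s
    rw [← hmo, ← ENNReal.ofReal_toReal hs, ← ENNReal.ofReal_add ENNReal.toReal_nonneg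
      (by positivity)] at h1
    exact (ENNReal.ofReal_le_ofReal_iff (add_nonneg ENNReal.toReal_nonneg (by positivity))).1 h1
  have hmconv : ∀ x y a b : ℝ, 0 < a → 0 < b → a + b = 1 →
      m (a * x + b * y) ≤ a * m x + b * m y := by
    intro x y a b ha hb hab
    have h1 := hconv (J x) (J y) a b ha hb hab
    have h2 : ENNReal.ofReal a * e (J x) + ENNReal.ofReal b * e (J y) ≠ ⊤ :=
      ENNReal.add_ne_top.2 ⟨ENNReal.mul_ne_top ENNReal.ofReal_ne_top (hfin x),
        ENNReal.mul_ne_top ENNReal.ofReal_ne_top (hfin y)⟩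
    have h3 := ENNReal.toReal_mono h2 h1
    rw [ENNReal.toReal_add (ENNReal.mul_ne_top ENNReal.ofReal_ne_top (hfin x))
      (ENNReal.mul_ne_top ENNReal.ofReal_ne_top (hfin y)), ENNReal.toReal_mul, ENNReal.toReal_mul,
      ENNReal.toReal_ofReal ha.le, ENNReal.toReal_ofReal hb.le] at h3
    have h4 := hmle (a * x + b * y) (a * J x + b * J y) (ne_top_of_le_ne_top h2 h1)
    have h5 : (a * x + b * y - (a * J x + b * J y)) ^ 2 ≤
        a * (x - J x) ^ 2 + b * (y - J y) ^ 2 := by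
      have hb' : b = 1 - a := by linarith
      subst hb'
      nlinarith [mul_nonneg (mul_nonneg ha.le hb.le) (sq_nonneg (x - J x - (y - J y)))]
    have h6 := mul_le_mul_of_nonneg_left h5 hk'.le
    simp only [hm] at h4 ⊢
    linarith
  set ψ : ℝ → ℝ := fun r => 2 * k * (r - J r) with hψ
  have hup : ∀ r s, m s ≤ m r + ψ r * (s - r) + k * (s - r) ^ 2 := fun r s => by
    refine (hmle s (J r) (hfin r)).trans (le_of_eq ?_)
    simp only [hm, hψ]
    ring
  have hrem : ∀ r s, |m s - m r - ψ r * (s - r)| ≤ k * (s - r) ^ 2 := fun r s => by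
    rw [abs_le]
    constructor
    · -- the lower bound at `s` follows from the upper bound at the point symmetric about `r`
      have h1 := hmconv s (2 * r - s) (1 / 2) (1 / 2) (by norm_num) (by norm_num) (by norm_num)
      rw [show 1 / 2 * s + 1 / 2 * (2 * r - s) = r by ring] at h1
      have h2 := hup r (2 * r - s)
      have h3 : (2 * r - s - r) ^ 2 = (s - r) ^ 2 := by ring
      rw [h3] at h2
      linarith
    · linarith [hup r s]
  have hd := hasDerivAt_of_remainder hrem
  have hcvx : ConvexOn ℝ Set.univ m := by
    refine convexOn_iff_forall_pos.2 ⟨convex_univ, fun x _ y _ a b ha hb hab => ?_⟩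
    simpa using hmconv x y a b ha hb hab
  refine ⟨m, ψ, ?_, ?_, hrem, hm0, ?_, ?_, ?_⟩
  · refine LipschitzWith.of_dist_le_mul fun r s => ?_
    rw [Real.dist_eq, Real.dist_eq, abs_sub_comm r s]
    rcases eq_or_ne s r with h | h
    · simp [h]
    · have h1 := abs_le.1 (hrem r s)
      have h2 := abs_le.1 (hrem s r)
      have h3 : |(ψ r - ψ s) * (s - r)| ≤ 2 * k * (s - r) ^ 2 := by
        have h4 : (r - s) ^ 2 = (s - r) ^ 2 := by ring
        rw [h4] at h2
        rw [abs_le]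
        constructor <;> linarith [h1.1, h1.2, h2.1, h2.2]
      rw [abs_mul, ← sq_abs (s - r), sq, ← mul_assoc] at h3
      exact le_of_mul_le_mul_right h3 (abs_pos.2 (sub_ne_zero.2 h))
  · have h1 := hcvx.monotoneOn_deriv fun r _ => (hd r).differentiableAt
    rw [funext fun r => (hd r).deriv, monotoneOn_univ] at h1
    exact h1
  · intro r
    rw [hmo]
    simpa using hJ r r
  · intro h0
    have h1 : m 0 = 0 := by
      have := hmle 0 0 (by simp [h0])
      simp only [h0, ENNReal.toReal_zero, sub_self] at this
      exact le_antisymm (by simpa using this) (hm0 0)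
    refine ⟨h1, ?_⟩
    have h2 : k * (0 - J 0) ^ 2 ≤ m 0 := le_add_of_nonneg_left ENNReal.toReal_nonneg
    have h3 : (0 - J 0) ^ 2 ≤ 0 := by
      by_contra! hcon
      linarith [mul_pos hk' hcon]
    have h4 : 0 - J 0 = 0 := by
      exact pow_eq_zero_iff (two_ne_zero) |>.1 (le_antisymm h3 (sq_nonneg _))
    simp only [hψ, h4, mul_zero]
  · intro r δ a hδ h1 h2
    rw [hmo]
    by_cases h : |J r - r| < δ
    · exact (h1 _ h).trans_le le_self_add
    · refine h2.trans_le (le_trans (ENNReal.ofReal_le_ofReal ?_) le_add_self)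
      push Not at h
      rw [← sq_abs (r - J r), abs_sub_comm]
      gcongr

/-! ### Contraction of integral functionals -/

/-- Near `0` the integrand is bounded below by a positive constant, and `h ∈ L²` is small outside a
set of finite measure. -/
lemma lintegral_comp_eq_top {M : Type*} [MeasurableSpace M] {μ : Measure M} {e : ℝ → ℝ≥0∞}
    (hlsc : LowerSemicontinuous e) (h0 : e 0 ≠ 0) (hμ : μ Set.univ = ⊤) (h : Lp ℝ 2 μ) :
    ∫⁻ x, e (h x) ∂μ = ⊤ := by
  obtain ⟨a, ha0, ha⟩ := exists_between (pos_iff_ne_zero.2 h0)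
  obtain ⟨δ, hδ, hball⟩ := Metric.eventually_nhds_iff.1 (hlsc 0 a ha)
  have hfin : μ {x | Real.toNNReal δ ≤ ‖h x‖₊} < ⊤ :=
    (Lp.memLp h).meas_ge_lt_top (by norm_num) (by norm_num) (by simpa using hδ)
  have hm : MeasurableSet {x | Real.toNNReal δ ≤ ‖h x‖₊} :=
    measurableSet_le measurable_const (Lp.stronglyMeasurable h).measurable.nnnorm
  have hc : μ {x | Real.toNNReal δ ≤ ‖h x‖₊}ᶜ = ⊤ := by
    by_contra hcon
    have h1 := measure_add_measure_compl hm (μ := μ)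
    rw [hμ] at h1
    exact ENNReal.add_ne_top.2 ⟨hfin.ne, hcon⟩ h1
  refine top_le_iff.1 ?_
  calc (⊤ : ℝ≥0∞) = a * μ {x | Real.toNNReal δ ≤ ‖h x‖₊}ᶜ := by
        rw [hc, ENNReal.mul_top ha0.ne']
    _ = ∫⁻ _ in {x | Real.toNNReal δ ≤ ‖h x‖₊}ᶜ, a ∂μ := by rw [setLIntegral_const]
    _ ≤ ∫⁻ x in {x | Real.toNNReal δ ≤ ‖h x‖₊}ᶜ, e (h x) ∂μ := by
        refine setLIntegral_mono' hm.compl fun x hx => (hball ?_).le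
        have h2 : ‖h x‖₊ < Real.toNNReal δ := not_le.1 hx
        rw [dist_zero_right, ← coe_nnnorm]
        exact Real.lt_toNNReal_iff_coe_lt.1 h2
    _ ≤ _ := setLIntegral_le_lintegral _ _

variable {M : Type*} [MetricSpace M] [MeasurableSpace M] [BorelSpace M] {μ : Measure M} {q : ℝ≥0∞}
  [Fact (1 ≤ q)]

/-- Comparison with this flow turns statements on `f t - g t` into statements on `f t`. -/
lemma isHeatFlow_zero (hq : 1 < q) (hq' : q ≠ ⊤) :
    IsHeatFlow q μ (0 : Lp ℝ 2 μ) (fun _ => 0) := by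
  have h0 : cheeger q μ (0 : Lp ℝ 2 μ) = 0 := by
    have hp0 : 0 < q.toReal := ENNReal.toReal_pos (zero_lt_one.trans hq).ne' hq'
    have h1 : ∃ c : Lp ℝ q μ, ((0 : Lp ℝ 2 μ), c) ∈ slopeGraph q μ := ⟨0, zero_mem_slopeGraph⟩
    have h2 := (relaxedSlope_spec hq hq' h1).2.2 0 zero_mem_slopeGraph
    rw [norm_zero] at h2
    rw [cheeger_eq_ofReal hq hq' h1, le_antisymm h2 (norm_nonneg _), Real.zero_rpow hp0.ne']
    simp
  refine ⟨rfl, tendsto_const_nhds, fun x _ => ⟨0, Set.univ, univ_mem, fun _ _ _ _ => by simp⟩,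
    Eventually.of_forall fun t => ⟨0, ⟨by simp [h0], fun g => ?_⟩, ?_⟩⟩
  · have h1 : ∫ x, (0 : Lp ℝ 2 μ) x * (g x - (0 : Lp ℝ 2 μ) x) ∂μ = 0 := by
      rw [← integral_zero M ℝ (μ := μ)]
      refine integral_congr_ae ?_
      filter_upwards [Lp.coeFn_zero ℝ 2 μ] with x hx
      rw [hx]; simp
    rw [h0, h1]
    simpa using EReal.coe_ennreal_nonneg _
  · rw [neg_zero]; exact hasDerivAt_const t 0

variable {f₀ g₀ : Lp ℝ 2 μ} {f g : ℝ → Lp ℝ 2 μ}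

/-- The contraction property for smooth integrands: the derivative of the functional along
`f t - g t` is nonpositive by `T`-monotonicity. -/
lemma IsHeatFlow.integral_sub_le (hq : 1 < q) (hq' : q ≠ ⊤) (hf : IsHeatFlow q μ f₀ f)
    (hg : IsHeatFlow q μ g₀ g) {e ψ : ℝ → ℝ} {K : ℝ≥0} (he : IsSmoothIntegrand μ e ψ K)
    (hψ : Monotone ψ) {t : ℝ} (ht : 0 < t) :
    ∫ x, e ((f t - g t : Lp ℝ 2 μ) x) ∂μ ≤ ∫ x, e ((f₀ - g₀ : Lp ℝ 2 μ) x) ∂μ := by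
  refine (he.lintegral_dissipation (h := fun t => f t - g t)
    (P := fun s => -deriv (fun s => ∫ x, e ((f s - g s : Lp ℝ 2 μ) x) ∂μ) s)
    (hf.tendsto.sub hg.tendsto) (hf.locLip.sub hg.locLip) ?_ ht).1
  filter_upwards [hf.deriv_mem, hg.deriv_mem] with s ⟨l, hl, hfl⟩ ⟨l', hl', hgl⟩
  have h1 : HasDerivAt (fun t => f t - g t) (-l - -l') s := hfl.sub hgl
  have h2 := inner_superpose_nonneg hq hq' hl hl' he.lipschitz hψ he.zero_deriv
  have h3 : inner ℝ (superpose ψ (f s - g s)) (-l - -l') =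
      -inner ℝ (l - l') (superpose ψ (f s - g s)) := by
    rw [real_inner_comm, show -l - -l' = -(l - l') by abel, inner_neg_left]
  have h4 := (he.hasDerivAt_comp h1).deriv
  exact ⟨by rw [h4, h3, neg_neg]; exact h2, _, h1, by rw [h4, neg_neg]⟩

/-- The contraction property for nonnegative convex lower semicontinuous integrands, from their
Moreau–Yosida regularizations and Fatou's lemma. -/
lemma IsHeatFlow.lintegral_sub_le (hq : 1 < q) (hq' : q ≠ ⊤) (hf : IsHeatFlow q μ f₀ f)
    (hg : IsHeatFlow q μ g₀ g) {e : ℝ → ℝ≥0∞} (hlsc : LowerSemicontinuous e)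
    (hconv : ∀ x y a b : ℝ, 0 < a → 0 < b → a + b = 1 →
      e (a * x + b * y) ≤ ENNReal.ofReal a * e x + ENNReal.ofReal b * e y)
    {t : ℝ} (ht : 0 ≤ t) :
    ∫⁻ x, e ((f t - g t : Lp ℝ 2 μ) x) ∂μ ≤ ∫⁻ x, e ((f₀ - g₀ : Lp ℝ 2 μ) x) ∂μ := by
  rcases ht.eq_or_lt with rfl | ht
  · rw [hf.init, hg.init]
  by_cases htop : ∀ s, e s = ⊤
  · simp [htop]
  push Not at htop
  obtain ⟨s₀, hs₀⟩ := htop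
  by_cases h0 : e 0 ≠ 0 ∧ μ Set.univ = ⊤
  · rw [lintegral_comp_eq_top hlsc h0.1 h0.2 (f₀ - g₀)]; exact le_top
  have h0' : e 0 = 0 ∨ μ Set.univ < ⊤ := by
    by_contra! hcon
    exact h0 ⟨hcon.1, top_le_iff.1 hcon.2⟩
  choose m ψ hlip hmono hrem hm0 hme hzero happ using fun n : ℕ =>
    exists_moreau hlsc hconv hs₀ (k := (n : ℝ≥0) + 1) (by positivity)
  have hsm : ∀ n, IsSmoothIntegrand μ (m n) (ψ n) (2 * (n + 1)) := fun n =>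
    ⟨hlip n, fun r s => (hrem n r s).trans (by
      refine mul_le_mul_of_nonneg_right ?_ (sq_nonneg _)
      push_cast
      have : (0 : ℝ) ≤ n := Nat.cast_nonneg n
      linarith), h0'.imp_left (hzero n)⟩
  have hptw : ∀ r, e r ≤ liminf (fun n => ENNReal.ofReal (m n r)) atTop := by
    intro r
    refine le_of_forall_lt fun a ha => ?_
    obtain ⟨b, hab, hb⟩ := exists_between ha
    refine hab.trans_le (le_liminf_of_le (by isBoundedDefault) ?_)
    obtain ⟨δ, hδ, hball⟩ := Metric.eventually_nhds_iff.1 (hlsc r b hb)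
    have hlim : Tendsto (fun n : ℕ => ENNReal.ofReal ((((n : ℝ≥0) + 1 : ℝ≥0) : ℝ) * δ ^ 2)) atTop
        (𝓝 ⊤) := by
      refine ENNReal.tendsto_ofReal_atTop.comp ?_
      refine Tendsto.atTop_mul_const (by positivity) ?_
      push_cast
      exact tendsto_atTop_add_const_right _ _ tendsto_natCast_atTop_atTop
    filter_upwards [hlim.eventually_const_lt (hb.trans_le le_top)] with n hn
    exact (happ n r δ b hδ (fun s hs => hball (by rwa [Real.dist_eq])) hn).le
  calc ∫⁻ x, e ((f t - g t : Lp ℝ 2 μ) x) ∂μ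
      ≤ ∫⁻ x, liminf (fun n => ENNReal.ofReal (m n ((f t - g t : Lp ℝ 2 μ) x))) atTop ∂μ :=
        lintegral_mono fun x => hptw _
    _ ≤ liminf (fun n => ∫⁻ x, ENNReal.ofReal (m n ((f t - g t : Lp ℝ 2 μ) x)) ∂μ) atTop :=
        lintegral_liminf_le fun n => ((hsm n).continuous.measurable.comp
          (Lp.stronglyMeasurable _).measurable).ennreal_ofReal
    _ ≤ liminf (fun _ : ℕ => ∫⁻ x, e ((f₀ - g₀ : Lp ℝ 2 μ) x) ∂μ) atTop := by
        refine liminf_le_liminf (Eventually.of_forall fun n => ?_)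
        calc ∫⁻ x, ENNReal.ofReal (m n ((f t - g t : Lp ℝ 2 μ) x)) ∂μ
            = ENNReal.ofReal (∫ x, m n ((f t - g t : Lp ℝ 2 μ) x) ∂μ) :=
              (ofReal_integral_eq_lintegral_ofReal ((hsm n).integrable _)
                (Eventually.of_forall fun x => hm0 n _)).symm
          _ ≤ ENNReal.ofReal (∫ x, m n ((f₀ - g₀ : Lp ℝ 2 μ) x) ∂μ) :=
              ENNReal.ofReal_le_ofReal (hf.integral_sub_le hq hq' hg (hsm n) (hmono n) ht)
          _ = ∫⁻ x, ENNReal.ofReal (m n ((f₀ - g₀ : Lp ℝ 2 μ) x)) ∂μ :=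
              ofReal_integral_eq_lintegral_ofReal ((hsm n).integrable _)
                (Eventually.of_forall fun x => hm0 n _)
          _ ≤ ∫⁻ x, e ((f₀ - g₀ : Lp ℝ 2 μ) x) ∂μ := lintegral_mono fun x => hme n _
    _ = _ := liminf_const _

end

/-! ### Comparison and contraction in `L^r` -/

section

section
variable {M : Type*} [MetricSpace M] [MeasurableSpace M] [BorelSpace M] {μ : Measure M} {q : ℝ≥0∞}
  [Fact (1 ≤ q)] {f₀ g₀ : Lp ℝ 2 μ} {f g : ℝ → Lp ℝ 2 μ}

/-- If `f₀ - g₀` takes values in a closed convex set, so does `f t - g t`: apply the contraction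
property to the indicator function (in the sense of convex analysis) of the set. -/
lemma IsHeatFlow.sub_mem (hq : 1 < q) (hq' : q ≠ ⊤) (hf : IsHeatFlow q μ f₀ f)
    (hg : IsHeatFlow q μ g₀ g) {S : Set ℝ} (hS : IsClosed S) (hS' : Convex ℝ S)
    (h : ∀ᵐ x ∂μ, (f₀ - g₀ : Lp ℝ 2 μ) x ∈ S) {t : ℝ} (ht : 0 ≤ t) :
    ∀ᵐ x ∂μ, (f t - g t : Lp ℝ 2 μ) x ∈ S := by
  have hlsc : LowerSemicontinuous (Sᶜ.indicator fun _ => (⊤ : ℝ≥0∞)) :=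
    hS.isOpen_compl.lowerSemicontinuous_indicator zero_le
  have hle := hf.lintegral_sub_le hq hq' hg hlsc (fun x y a b ha hb hab => ?_) ht
  · have h0 : ∫⁻ x, Sᶜ.indicator (fun _ => (⊤ : ℝ≥0∞)) ((f₀ - g₀ : Lp ℝ 2 μ) x) ∂μ = 0 := by
      refine lintegral_eq_zero_of_ae_eq_zero ?_
      filter_upwards [h] with x hx
      exact Set.indicator_of_notMem (Set.notMem_compl_iff.2 hx) _
    have hm : Measurable fun x =>
        Sᶜ.indicator (fun _ => (⊤ : ℝ≥0∞)) ((f t - g t : Lp ℝ 2 μ) x) :=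
      hlsc.measurable.comp (Lp.stronglyMeasurable _).measurable
    rw [h0, nonpos_iff_eq_zero, lintegral_eq_zero_iff hm] at hle
    filter_upwards [hle] with x hx
    by_contra hcon
    rw [Set.indicator_of_mem (show _ ∈ Sᶜ from hcon)] at hx
    exact ENNReal.top_ne_zero hx
  · by_cases hx : x ∈ S
    · by_cases hy : y ∈ S
      · have : a * x + b * y ∈ S := hS' hx hy ha.le hb.le hab
        simp [this]
      · simp [hy, ENNReal.mul_top, hb]
    · simp [hx, ENNReal.mul_top, ha]

lemma IsHeatFlow.eLpNorm_sub_le (hq : 1 < q) (hq' : q ≠ ⊤) (hf : IsHeatFlow q μ f₀ f)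
    (hg : IsHeatFlow q μ g₀ g) {r : ℝ≥0∞} (hr : 1 ≤ r) {t : ℝ} (ht : 0 ≤ t) :
    eLpNorm (f t - g t : Lp ℝ 2 μ) r μ ≤ eLpNorm (f₀ - g₀ : Lp ℝ 2 μ) r μ := by
  rcases eq_or_ne r ⊤ with rfl | hr'
  · set N := eLpNorm (f₀ - g₀ : Lp ℝ 2 μ) ⊤ μ with hN
    rw [eLpNorm_exponent_top] at hN ⊢
    refine eLpNormEssSup_le_of_ae_enorm_bound
      (hf.sub_mem hq hq' hg (S := {s | ‖s‖ₑ ≤ N}) ?_ ?_ ?_ ht)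
    · exact isClosed_le continuous_enorm continuous_const
    · intro x hx y hy a b ha hb hab
      simp only [Set.mem_ofPred_eq] at hx hy ⊢
      calc ‖a • x + b • y‖ₑ ≤ ‖a • x‖ₑ + ‖b • y‖ₑ := enorm_add_le _ _
        _ = ENNReal.ofReal a * ‖x‖ₑ + ENNReal.ofReal b * ‖y‖ₑ := by
            rw [enorm_smul, enorm_smul, Real.enorm_of_nonneg ha, Real.enorm_of_nonneg hb]
        _ ≤ ENNReal.ofReal a * N + ENNReal.ofReal b * N := by gcongr
        _ = N := by rw [← add_mul, ← ENNReal.ofReal_add ha hb, hab, ENNReal.ofReal_one, one_mul]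
    · rw [hN]
      exact ae_le_eLpNormEssSup
  · have hr0 : r ≠ 0 := (zero_lt_one.trans_le hr).ne'
    have hp : 1 ≤ r.toReal := by
      simpa using (ENNReal.toReal_le_toReal ENNReal.one_ne_top hr').2 hr
    rw [eLpNorm_eq_lintegral_rpow_enorm_toReal hr0 hr',
      eLpNorm_eq_lintegral_rpow_enorm_toReal hr0 hr']
    refine ENNReal.rpow_le_rpow ?_ (by positivity)
    refine hf.lintegral_sub_le hq hq' hg (e := fun s => ‖s‖ₑ ^ r.toReal) ?_ ?_ ht
    · exact (ENNReal.continuous_rpow_const.comp continuous_enorm).lowerSemicontinuous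
    · intro x y a b ha hb hab
      calc ‖a * x + b * y‖ₑ ^ r.toReal
          ≤ (ENNReal.ofReal a * ‖x‖ₑ + ENNReal.ofReal b * ‖y‖ₑ) ^ r.toReal := by
            refine ENNReal.rpow_le_rpow ((enorm_add_le _ _).trans (le_of_eq ?_)) (by positivity)
            rw [enorm_mul, enorm_mul, Real.enorm_of_nonneg ha.le, Real.enorm_of_nonneg hb.le]
        _ ≤ _ := ENNReal.rpow_arith_mean_le_arith_mean2_rpow _ _ _ _
            (by rw [← ENNReal.ofReal_add ha.le hb.le, hab, ENNReal.ofReal_one]) hp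

lemma IsHeatFlow.memLp (hq : 1 < q) (hq' : q ≠ ⊤) (hf : IsHeatFlow q μ f₀ f)
    {r : ℝ≥0∞} (hr : 1 ≤ r) (h : MemLp f₀ r μ) {t : ℝ} (ht : 0 ≤ t) : MemLp (f t) r μ := by
  refine ⟨Lp.aestronglyMeasurable _, ?_⟩
  have := hf.eLpNorm_sub_le hq hq' (isHeatFlow_zero hq hq') hr ht
  rw [sub_zero, sub_zero] at this
  exact this.trans_lt h.2

end

/-! ### Integrands with values in `(-∞, ∞]` -/

/-- On a σ-finite space of infinite measure, there is a function in `L²` with values in `[0, 1]`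
and infinite integral. -/
lemma exists_Lp_two_lintegral_eq_top {M : Type*} [MeasurableSpace M] {μ : Measure M}
    [SigmaFinite μ] (hμ : μ Set.univ = ⊤) :
    ∃ w : Lp ℝ 2 μ, (∀ᵐ x ∂μ, 0 ≤ w x ∧ w x ≤ 1) ∧ ∫⁻ x, ENNReal.ofReal (w x) ∂μ = ⊤ := by
  have hset : ∀ k : ℕ, ∃ S : Set M, MeasurableSet S ∧ μ S ≠ ⊤ ∧ (16 : ℝ) ^ k ≤ μ.real S := by
    intro k
    have hlim := tendsto_measure_iUnion_atTop (μ := μ) (monotone_spanningSets μ)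
    rw [iUnion_spanningSets, hμ] at hlim
    obtain ⟨n, hn⟩ := (hlim.eventually_const_lt
      (ENNReal.ofReal_lt_top (r := (16 : ℝ) ^ k))).exists
    have hfin := (measure_spanningSets_lt_top μ n).ne
    exact ⟨_, measurableSet_spanningSets μ n, hfin, (ENNReal.ofReal_le_iff_le_toReal hfin).1 hn.le⟩
  choose S hSm hSf hS using hset
  have hm1 : ∀ k, 1 ≤ μ.real (S k) := fun k => (one_le_pow₀ (by norm_num)).trans (hS k)
  have hsq : ∀ k, (4 : ℝ) ^ k ≤ √(μ.real (S k)) := fun k => by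
    refine Real.le_sqrt_of_sq_le ((le_of_eq ?_).trans (hS k))
    rw [← pow_mul, mul_comm, pow_mul]; norm_num
  have hsq1 : ∀ k, 1 ≤ √(μ.real (S k)) := fun k => Real.one_le_sqrt.2 (hm1 k)
  -- the weights make the `L²` norms summable, while the `L¹` norms are unbounded
  set c : ℕ → ℝ := fun k => 1 / 2 / 2 ^ k / √(μ.real (S k)) with hc
  have hc0 : ∀ k, 0 ≤ c k := fun k => by positivity
  have hc1 : ∀ k, c k ≤ 1 / 2 / 2 ^ k := fun k => div_le_self (by positivity) (hsq1 k)
  set F : ℕ → Lp ℝ 2 μ := fun k => indicatorConstLp 2 (hSm k) (hSf k) (c k) with hF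
  have hFn : ∀ k, ‖F k‖ = 1 / 2 / 2 ^ k := fun k => by
    rw [hF, norm_indicatorConstLp (by norm_num) (by norm_num), Real.norm_of_nonneg (hc0 k),
      ENNReal.toReal_ofNat, ← Real.sqrt_eq_rpow]
    exact div_mul_cancel₀ _ (by linarith [hsq1 k])
  have hsum : ∑' k, ‖F k‖ₑ ≠ ⊤ := by
    refine tsum_enorm_ne_top_iff_summable_norm.2 ?_
    simp only [hFn]
    exact (hasSum_geometric_two' 1).summable
  have hae : ∀ᵐ x ∂μ, ∀ k, F k x = (S k).indicator (fun _ => c k) x :=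
    ae_all_iff.2 fun k => indicatorConstLp_coeFn
  have hind : ∀ k x, 0 ≤ (S k).indicator (fun _ => c k) x ∧
      (S k).indicator (fun _ => c k) x ≤ c k := fun k x => by
    by_cases hx : x ∈ S k <;> simp [hx, hc0]
  have hW : ∀ᵐ x ∂μ,
      HasSum (fun k => (S k).indicator (fun _ => c k) x) ((∑' k, F k : Lp ℝ 2 μ) x) := by
    filter_upwards [Lp.hasSum_coeFn_tsum hsum, hae] with x h1 h2
    simpa only [h2] using h1
  refine ⟨∑' k, F k, ?_, ?_⟩
  · filter_upwards [hW] with x hx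
    exact ⟨hx.nonneg fun k => (hind k x).1,
      hasSum_le (fun k => (hind k x).2.trans (hc1 k)) hx (hasSum_geometric_two' 1)⟩
  · refine ENNReal.eq_top_of_forall_nnreal_le fun R => ?_
    obtain ⟨k, hk⟩ := pow_unbounded_of_one_lt ((R : ℝ) * 2) (one_lt_two (α := ℝ))
    have h1 : (R : ℝ) ≤ c k * μ.real (S k) := by
      have h2 : c k * μ.real (S k) = 1 / 2 / 2 ^ k * √(μ.real (S k)) := by
        have h3 := Real.mul_self_sqrt (zero_le_one.trans (hm1 k))
        have h4 : √(μ.real (S k)) ≠ 0 := by linarith [hsq1 k]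
        rw [hc]
        field_simp
        rw [sq, h3]
      have h5 : 1 / 2 / 2 ^ k * (4 : ℝ) ^ k = 2 ^ k / 2 := by
        rw [show (4 : ℝ) = 2 * 2 by norm_num, mul_pow]; field_simp
      have h6 := mul_le_mul_of_nonneg_left (hsq k) (by positivity : (0 : ℝ) ≤ 1 / 2 / 2 ^ k)
      rw [h2]
      linarith
    calc (R : ℝ≥0∞) = ENNReal.ofReal R := (ENNReal.ofReal_coe_nnreal).symm
      _ ≤ ENNReal.ofReal (c k * μ.real (S k)) := ENNReal.ofReal_le_ofReal h1
      _ = ENNReal.ofReal (c k) * μ (S k) := by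
          rw [ENNReal.ofReal_mul (hc0 k), ofReal_measureReal (hSf k)]
      _ = ∫⁻ x, (S k).indicator (fun _ => ENNReal.ofReal (c k)) x ∂μ := by
          rw [lintegral_indicator_const (hSm k)]
      _ ≤ _ := by
          refine lintegral_mono_ae ?_
          filter_upwards [hW] with x hx
          have h7 := le_hasSum hx k fun j _ => (hind j x).1
          by_cases hxS : x ∈ S k
          · simp only [hxS, Set.indicator_of_mem] at h7 ⊢
            exact ENNReal.ofReal_le_ofReal h7
          · simp [hxS]

lemma toENNReal_add_add_toENNReal_neg {v : EReal} {l : ℝ} (hl : 0 ≤ l)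
    (hv : ((-l : ℝ) : EReal) ≤ v) :
    (v + l).toENNReal + (-v).toENNReal = v.toENNReal + ENNReal.ofReal l := by
  induction v with
  | bot => simp at hv
  | top => simp
  | coe v =>
    have h1 : -l ≤ v := EReal.coe_le_coe_iff.1 hv
    rw [← EReal.coe_add, ← EReal.coe_neg]
    simp only [EReal.toENNReal_of_ne_top (EReal.coe_ne_top _), EReal.toReal_coe]
    rcases le_total 0 v with h | h
    · rw [ENNReal.ofReal_of_nonpos (by linarith : -v ≤ 0), add_zero, ENNReal.ofReal_add h hl]
    · rw [ENNReal.ofReal_of_nonpos h, zero_add,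
        ← ENNReal.ofReal_add (by linarith) (by linarith)]
      congr 1
      ring

lemma lowerSemicontinuous_toENNReal_add {e : ℝ → EReal} (hlsc : LowerSemicontinuous e) (l : ℝ) :
    LowerSemicontinuous fun s => (e s + l).toENNReal := by
  have h1 : Continuous fun v : EReal => (v + l).toENNReal := by
    refine EReal.continuous_toENNReal.comp (continuous_iff_continuousAt.2 fun v => ?_)
    exact (EReal.continuousAt_add (p := (v, (l : EReal))) (.inr (EReal.coe_ne_bot l))
      (.inr (EReal.coe_ne_top l))).comp (f := fun v : EReal => (v, (l : EReal)))
      (continuous_id.prodMk continuous_const).continuousAt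
  exact h1.comp_lowerSemicontinuous hlsc fun v w hvw =>
    EReal.toENNReal_le_toENNReal (add_le_add_left hvw _)

lemma IsConvex.toENNReal_add {e : ℝ → EReal} (he : IsConvex e) {l : ℝ}
    (hl : ∀ r, 0 ≤ e r + l) (x y a b : ℝ) (ha : 0 < a) (hb : 0 < b) (hab : a + b = 1) :
    (e (a * x + b * y) + l).toENNReal ≤
      ENNReal.ofReal a * (e x + l).toENNReal + ENNReal.ofReal b * (e y + l).toENNReal := by
  have ha' : (0 : EReal) ≤ a := EReal.coe_nonneg.2 ha.le
  have hb' : (0 : EReal) ≤ b := EReal.coe_nonneg.2 hb.le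
  have h1 : e (a * x + b * y) + l ≤ a * (e x + l) + b * (e y + l) := by
    rw [EReal.left_distrib_of_nonneg_of_ne_top ha' (EReal.coe_ne_top a),
      EReal.left_distrib_of_nonneg_of_ne_top hb' (EReal.coe_ne_top b), add_add_add_comm,
      ← EReal.coe_mul, ← EReal.coe_mul, ← EReal.coe_add, ← add_mul, hab, one_mul]
    exact add_le_add_left (he x y a b ha hb hab) _
  refine (EReal.toENNReal_le_toENNReal h1).trans (le_of_eq ?_)
  rw [EReal.toENNReal_add (mul_nonneg ha' (hl x)) (mul_nonneg hb' (hl y)),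
    EReal.toENNReal_mul ha', EReal.toENNReal_mul hb',
    EReal.toENNReal_of_ne_top (EReal.coe_ne_top a), EReal.toENNReal_of_ne_top (EReal.coe_ne_top b),
    EReal.toReal_coe, EReal.toReal_coe]

/-- On a space of infinite measure, an integrand with `e 0 = 0` whose negative part is integrable
along all of `L²` is nonnegative: if `e r < 0`, then by convexity `-e (r w) ≥ w (-e r)` for
`0 ≤ w ≤ 1`, and `w ∈ L²` may have infinite integral. -/
lemma IsConvex.nonneg_of_negPart_lt_top {M : Type*} [MeasurableSpace M] {μ : Measure M}
    [SigmaFinite μ] (hμ : μ Set.univ = ⊤) {e : ℝ → EReal} (he : IsConvex e) (h0 : e 0 = 0)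
    {l : ℝ} (hl : ∀ r, ((-l : ℝ) : EReal) ≤ e r) (hneg : ∀ h : Lp ℝ 2 μ, negPart μ e h < ⊤)
    (r : ℝ) : 0 ≤ e r := by
  by_contra! hr
  obtain ⟨w, hw, hwint⟩ := exists_Lp_two_lintegral_eq_top hμ
  obtain ⟨v, hv⟩ : ∃ v : ℝ, e r = v :=
    ⟨(e r).toReal, (EReal.coe_toReal (hr.trans EReal.zero_lt_top).ne
      (fun h => by have := hl r; rw [h] at this; simp at this)).symm⟩
  have hv0 : v < 0 := by rw [hv] at hr; exact_mod_cast hr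
  refine absurd (hneg (r • w)) (not_lt.2 (le_of_eq ?_))
  refine (top_le_iff.1 ?_).symm
  calc (⊤ : ℝ≥0∞) = ∫⁻ x, ENNReal.ofReal (-v) * ENNReal.ofReal (w x) ∂μ := by
        rw [lintegral_const_mul' _ _ ENNReal.ofReal_ne_top, hwint, ENNReal.mul_top]
        simpa using hv0
    _ ≤ negPart μ e (r • w) := by
        refine lintegral_mono_ae ?_
        filter_upwards [hw, Lp.coeFn_smul r w] with x hx hx'
        rw [hx', Pi.smul_apply, smul_eq_mul, ← ENNReal.ofReal_mul (by linarith)]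
        have key : e (r * w x) ≤ ((v * w x : ℝ) : EReal) := by
          rcases hx.1.eq_or_lt with h | h
          · rw [← h, mul_zero, mul_zero, h0]; simp
          rcases hx.2.eq_or_lt with h' | h'
          · rw [h', mul_one, mul_one, hv]
          have h1 := he r 0 (w x) (1 - w x) h (by linarith) (by ring)
          rw [mul_zero, add_zero, h0, mul_zero, add_zero, hv, mul_comm (w x) r,
            ← EReal.coe_mul, mul_comm (w x) v] at h1
          exact h1
        have h2 := EReal.toENNReal_le_toENNReal (EReal.neg_le_neg_iff.2 key)
        rw [← EReal.coe_neg, EReal.toENNReal_of_ne_top (EReal.coe_ne_top _),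
          EReal.toReal_coe, ← neg_mul] at h2
        exact h2

lemma coe_top_sub_coe {N : ℝ≥0∞} (hN : N ≠ ⊤) : ((⊤ : ℝ≥0∞) : EReal) - (N : EReal) = ⊤ := by
  lift N to ℝ≥0 using hN
  rfl

/-- An integrand bounded below by `-l` is compared through the nonnegative `e + l`. If `μ` is
infinite, the hypothesis on `l μ(M)` forces `l = 0`. -/
lemma energy_le_of_lintegral_le {M : Type*} [MeasurableSpace M] {μ : Measure M} {e : ℝ → EReal}
    (hlsc : LowerSemicontinuous e) {l : ℝ} (hl0 : 0 ≤ l) (hl : ∀ r, ((-l : ℝ) : EReal) ≤ e r)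
    (hlμ : ENNReal.ofReal l * μ Set.univ ≠ ⊤) {u v : Lp ℝ 2 μ} (hu : negPart μ e u < ⊤)
    (hv : negPart μ e v < ⊤)
    (h : ∫⁻ x, (e (u x) + l).toENNReal ∂μ ≤ ∫⁻ x, (e (v x) + l).toENNReal ∂μ) :
    energy μ e u ≤ energy μ e v := by
  have key : ∀ u : Lp ℝ 2 μ, ∫⁻ x, (e (u x) + l).toENNReal ∂μ + negPart μ e u =
      ∫⁻ x, (e (u x)).toENNReal ∂μ + ENNReal.ofReal l * μ Set.univ := fun u => by
    have hum : Measurable u := (Lp.stronglyMeasurable u).measurable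
    have hm : Measurable fun x => (e (u x) + l).toENNReal :=
      (lowerSemicontinuous_toENNReal_add hlsc l).measurable.comp hum
    have hm' : Measurable fun x => (e (u x)).toENNReal :=
      EReal.continuous_toENNReal.measurable.comp (hlsc.measurable.comp hum)
    rw [negPart, ← lintegral_add_left hm, ← lintegral_const, ← lintegral_add_left hm']
    exact lintegral_congr fun x => toENNReal_add_add_toENNReal_neg hl0 (hl _)
  have hu' := key u
  have hv' := key v
  rw [energy, energy]
  set Pu := ∫⁻ x, (e (u x)).toENNReal ∂μ
  set Pv := ∫⁻ x, (e (v x)).toENNReal ∂μ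
  set Nu := negPart μ e u
  set Nv := negPart μ e v
  set Su := ∫⁻ x, (e (u x) + l).toENNReal ∂μ
  set Sv := ∫⁻ x, (e (v x) + l).toENNReal ∂μ
  rcases eq_or_ne Pv ⊤ with hP | hP
  · rw [hP]
    rw [coe_top_sub_coe hv.ne]; exact le_top
  have hSv : Sv ≠ ⊤ := ne_top_of_le_ne_top (ENNReal.add_ne_top.2 ⟨hP, hlμ⟩)
    (le_self_add.trans hv'.le)
  have hSu : Su ≠ ⊤ := ne_top_of_le_ne_top hSv h
  have hPu : Pu ≠ ⊤ := ne_top_of_le_ne_top (ENNReal.add_ne_top.2 ⟨hSu, hu.ne⟩)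
    (le_self_add.trans hu'.ge)
  have e1 := congrArg ENNReal.toReal hu'
  have e2 := congrArg ENNReal.toReal hv'
  rw [ENNReal.toReal_add hSu hu.ne, ENNReal.toReal_add hPu hlμ] at e1
  rw [ENNReal.toReal_add hSv hv.ne, ENNReal.toReal_add hP hlμ] at e2
  have e3 := ENNReal.toReal_mono hSv h
  rw [← EReal.coe_ennreal_toReal hPu, ← EReal.coe_ennreal_toReal hP,
    ← EReal.coe_ennreal_toReal hu.ne, ← EReal.coe_ennreal_toReal hv.ne, ← EReal.coe_sub,
    ← EReal.coe_sub, EReal.coe_le_coe_iff]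
  linarith

variable {M : Type*} [MetricSpace M] [MeasurableSpace M] [BorelSpace M] {μ : Measure M} {q : ℝ≥0∞}
  [Fact (1 ≤ q)] {f₀ g₀ : Lp ℝ 2 μ} {f g : ℝ → Lp ℝ 2 μ}

/-- The contraction property for integrands bounded below. On a space of infinite measure the
integrability of the negative part along all of `L²` forces `e 0 ≥ 0`, and `e ≥ 0` if `e 0 = 0`. -/
lemma IsHeatFlow.energy_sub_le [SigmaFinite μ] (hq : 1 < q) (hq' : q ≠ ⊤)
    (hf : IsHeatFlow q μ f₀ f) (hg : IsHeatFlow q μ g₀ g) {e : ℝ → EReal}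
    (hl : ∃ l : ℝ, ∀ r, ((-l : ℝ) : EReal) ≤ e r) (he : IsConvex e) (hlsc : LowerSemicontinuous e)
    (hneg : ∀ h : Lp ℝ 2 μ, negPart μ e h < ⊤) {t : ℝ} (ht : 0 ≤ t) :
    energy μ e (f t - g t) ≤ energy μ e (f₀ - g₀) := by
  have main : ∀ l : ℝ, 0 ≤ l → (∀ r, ((-l : ℝ) : EReal) ≤ e r) →
      ENNReal.ofReal l * μ Set.univ ≠ ⊤ → energy μ e (f t - g t) ≤ energy μ e (f₀ - g₀) := by
    intro l hl0 hl hlμ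
    refine energy_le_of_lintegral_le hlsc hl0 hl hlμ (hneg _) (hneg _) ?_
    refine hf.lintegral_sub_le hq hq' hg (e := fun s => (e s + l).toENNReal)
      (lowerSemicontinuous_toENNReal_add hlsc l) (he.toENNReal_add fun r => ?_) ht
    have := add_le_add_left (hl r) (l : EReal)
    rwa [← EReal.coe_add, neg_add_cancel, EReal.coe_zero] at this
  obtain ⟨l, hl⟩ := hl
  by_cases hμ : μ Set.univ = ⊤
  · have h0 : 0 ≤ e 0 := by
      by_contra! hcon
      refine absurd (hneg 0) (not_lt.2 (le_of_eq ?_))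
      have h1 : negPart μ e 0 = ∫⁻ _, (-e 0).toENNReal ∂μ := by
        refine lintegral_congr_ae ?_
        filter_upwards [Lp.coeFn_zero ℝ 2 μ] with x hx
        rw [hx]; rfl
      rw [h1, lintegral_const, hμ, ENNReal.mul_top]
      rw [EReal.toENNReal_ne_zero_iff]
      simpa using hcon
    -- either `e ≥ 0`, or `0 < e 0` and the right-hand side is infinite
    rcases h0.eq_or_lt with h0 | h0
    · have hpos := he.nonneg_of_negPart_lt_top hμ h0.symm hl hneg
      exact main 0 le_rfl (by simpa using hpos) (by simp)
    · have h1 := lintegral_comp_eq_top (e := fun s => (e s).toENNReal)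
        (by simpa using lowerSemicontinuous_toENNReal_add hlsc 0)
        (EReal.toENNReal_ne_zero_iff.2 h0) hμ (f₀ - g₀)
      have h2 : energy μ e (f₀ - g₀) = ⊤ := by
        rw [energy, h1, coe_top_sub_coe (hneg (f₀ - g₀)).ne]
      rw [h2]; exact le_top
  · exact main (max l 0) (le_max_right _ _)
      (fun r => le_trans (EReal.coe_le_coe_iff.2 (neg_le_neg (le_max_left _ _))) (hl r))
      (ENNReal.mul_ne_top ENNReal.ofReal_ne_top hμ)

end

/-! ### Mass preservation and the energy identity -/

section

lemma primitive_le_primitive_of_nonneg {ρ σ : ℝ → ℝ} {r : ℝ} (hr : 0 ≤ r)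
    (hρ : IntervalIntegrable ρ volume 0 r) (hσ : IntervalIntegrable σ volume 0 r)
    (h : ∀ s, 0 ≤ s → ρ s ≤ σ s) : primitive ρ r ≤ primitive σ r :=
  intervalIntegral.integral_mono_on hr hρ hσ fun s hs => h s hs.1

lemma primitive_le_primitive_of_nonpos {ρ σ : ℝ → ℝ} {r : ℝ} (hr : r ≤ 0)
    (hρ : IntervalIntegrable ρ volume 0 r) (hσ : IntervalIntegrable σ volume 0 r)
    (h : ∀ s, s ≤ 0 → ρ s ≤ σ s) : primitive σ r ≤ primitive ρ r := by
  rw [primitive, primitive, intervalIntegral.integral_symm, intervalIntegral.integral_symm r 0]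
  exact neg_le_neg (intervalIntegral.integral_mono_on hr hρ.symm hσ.symm fun s hs => h s hs.2)

/-- The second primitives of the truncations `min σ n` increase to the second primitive of `σ`. -/
lemma monotone_tendsto_primitive_primitive {σ : ℝ → ℝ} (hm : Measurable σ) (h0 : ∀ r, 0 ≤ σ r)
    (hi : ∀ a b, IntervalIntegrable σ volume a b) (r : ℝ) :
    (Monotone fun n : ℕ => primitive (primitive fun s => min (σ s) n) r) ∧
      Tendsto (fun n : ℕ => primitive (primitive fun s => min (σ s) n) r) atTop
        (𝓝 (primitive (primitive σ) r)) := by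
  have hb : ∀ n : ℕ, ∀ s, |min (σ s) n| ≤ (n : ℝ≥0) := fun n s => by
    rw [abs_of_nonneg (le_min (h0 s) (Nat.cast_nonneg n))]
    exact min_le_right _ _
  have hmm : ∀ n : ℕ, Measurable fun s => min (σ s) n := fun n => hm.min measurable_const
  have hi1 : ∀ (n : ℕ) a b, IntervalIntegrable (fun s => min (σ s) n) volume a b := fun n =>
    intervalIntegrable_of_bounded (hmm n) (hb n)
  have hc : ∀ n : ℕ, Continuous (primitive fun s => min (σ s) n) := fun n =>
    (lipschitzWith_primitive (hmm n) (hb n)).continuous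
  have hi2 : ∀ (n : ℕ) a b, IntervalIntegrable (primitive fun s => min (σ s) n) volume a b :=
    fun n a b => (hc n).intervalIntegrable a b
  have hcσ : Continuous (primitive σ) := intervalIntegral.continuous_primitive hi 0
  have hmono : ∀ {m n : ℕ}, m ≤ n → ∀ s, min (σ s) m ≤ min (σ s) n := fun hmn s =>
    min_le_min_left _ (Nat.cast_le.2 hmn)
  refine ⟨fun m n hmn => ?_, ?_⟩
  · rcases le_total 0 r with hr | hr
    · exact primitive_le_primitive_of_nonneg hr (hi2 _ _ _) (hi2 _ _ _) fun s hs =>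
        primitive_le_primitive_of_nonneg hs (hi1 _ _ _) (hi1 _ _ _) fun u _ => hmono hmn u
    · exact primitive_le_primitive_of_nonpos hr (hi2 _ _ _) (hi2 _ _ _) fun s hs =>
        primitive_le_primitive_of_nonpos hs (hi1 _ _ _) (hi1 _ _ _) fun u _ => hmono hmn u
  · have hlim : ∀ s, Tendsto (fun n : ℕ => primitive (fun s => min (σ s) n) s) atTop
        (𝓝 (primitive σ s)) := fun s => by
      refine intervalIntegral.tendsto_integral_filter_of_dominated_convergence σ
        (Eventually.of_forall fun n => (hmm n).aestronglyMeasurable)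
        (Eventually.of_forall fun n => Eventually.of_forall fun u _ => ?_) (hi 0 s)
        (Eventually.of_forall fun u _ => ?_)
      · rw [Real.norm_of_nonneg (le_min (h0 u) (Nat.cast_nonneg n))]
        exact min_le_left _ _
      · obtain ⟨N, hN⟩ := exists_nat_ge (σ u)
        refine tendsto_const_nhds.congr' ?_
        filter_upwards [eventually_ge_atTop N] with n hn
        exact (min_eq_left (hN.trans (Nat.cast_le.2 hn))).symm
    refine intervalIntegral.tendsto_integral_filter_of_dominated_convergence
      (fun s => |primitive σ s|)
      (Eventually.of_forall fun n => (hc n).aestronglyMeasurable)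
      (Eventually.of_forall fun n => Eventually.of_forall fun s _ => ?_)
      (hcσ.abs.intervalIntegrable _ _) (Eventually.of_forall fun s _ => hlim s)
    rw [Real.norm_eq_abs]
    have hz : ∀ s, primitive (fun _ => (0 : ℝ)) s = 0 := fun s => by simp [primitive]
    have hiz : ∀ a b, IntervalIntegrable (fun _ : ℝ => (0 : ℝ)) volume a b := fun a b =>
      intervalIntegrable_const
    rcases le_total 0 s with hs | hs
    · have h1 := primitive_le_primitive_of_nonneg hs (hi1 n _ _) (hi _ _) fun u _ =>
        min_le_left (σ u) n
      have h2 := primitive_le_primitive_of_nonneg hs (hiz _ _) (hi1 n _ _) fun u _ =>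
        le_min (h0 u) (Nat.cast_nonneg n)
      rw [hz] at h2
      exact abs_le_abs_of_nonneg h2 h1
    · have h1 := primitive_le_primitive_of_nonpos hs (hi1 n _ _) (hi _ _) fun u _ =>
        min_le_left (σ u) n
      have h2 := primitive_le_primitive_of_nonpos hs (hiz _ _) (hi1 n _ _) fun u _ =>
        le_min (h0 u) (Nat.cast_nonneg n)
      rw [hz] at h2
      exact abs_le_abs_of_nonpos h2 h1

lemma ofReal_integral_mul_rpow {M : Type*} [MeasurableSpace M] {μ : Measure M} {q : ℝ≥0∞}
    (hq : 1 < q) (hq' : q ≠ ⊤) {ρ : ℝ → ℝ} {B : ℝ}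
    (hρ : Measurable ρ) (h0 : ∀ r, 0 ≤ ρ r) (hB : ∀ r, |ρ r| ≤ B) (u : Lp ℝ 2 μ) (a : Lp ℝ q μ) :
    ENNReal.ofReal (∫ x, ρ (u x) * |a x| ^ q.toReal ∂μ) =
      ∫⁻ x, ENNReal.ofReal (ρ (u x)) * ‖a x‖ₑ ^ q.toReal ∂μ := by
  have hum : Measurable u := (Lp.stronglyMeasurable u).measurable
  have hint : Integrable (fun x => ρ (u x) * |a x| ^ q.toReal) μ :=
    (integrable_abs_rpow (zero_lt_one.trans hq).ne' hq' a).bdd_mul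
      (hρ.comp hum).aestronglyMeasurable (Eventually.of_forall fun x => hB (u x))
  rw [ofReal_integral_eq_lintegral_ofReal hint
    (Eventually.of_forall fun x => mul_nonneg (h0 _) (by positivity))]
  refine lintegral_congr fun x => ?_
  rw [ENNReal.ofReal_mul (h0 _), Real.enorm_eq_ofReal_abs,
    ENNReal.ofReal_rpow_of_nonneg (abs_nonneg _) ENNReal.toReal_nonneg]

variable {M : Type*} [MetricSpace M] [MeasurableSpace M] [BorelSpace M] {μ : Measure M} {q : ℝ≥0∞}
  [Fact (1 ≤ q)] {f₀ : Lp ℝ 2 μ} {f : ℝ → Lp ℝ 2 μ}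

/-- The mean is the integral functional with integrand `e r = r`; its derivative along the flow is
minus the mean of a subgradient. -/
lemma IsHeatFlow.integral_eq (hq : 1 < q) (hq' : q ≠ ⊤) (hf : IsHeatFlow q μ f₀ f)
    (hμ : μ Set.univ < ⊤) {t : ℝ} (ht : 0 ≤ t) : ∫ x, f t x ∂μ = ∫ x, f₀ x ∂μ := by
  rcases ht.eq_or_lt with rfl | ht
  · rw [hf.init]
  have he : IsSmoothIntegrand μ (fun r => r) (fun _ => 1) 0 :=
    ⟨LipschitzWith.const 1, fun r s => by simp, .inr hμ⟩
  obtain ⟨h1, -, h2⟩ := he.lintegral_dissipation hf.tendsto hf.locLip (P := fun _ => 0) (by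
    filter_upwards [hf.deriv_mem] with s ⟨l, hl, hd⟩
    refine ⟨le_rfl, _, hd, ?_⟩
    rw [inner_neg_right, real_inner_comm, inner_superpose_eq_integral he.lipschitz he.zero_deriv]
    simpa using integral_subgradient_eq_zero hq hq' hl hμ) ht
  simp only [ENNReal.ofReal_zero, lintegral_zero] at h2
  exact le_antisymm h1 (by linarith [ENNReal.ofReal_eq_zero.1 h2.symm])

/-- The energy identity for the second primitive of a nonnegative locally integrable `σ`, as the
monotone limit of the identities for the bounded truncations of `σ`. -/
lemma IsHeatFlow.energy_identity_primitive [SFinite μ] (hq : 1 < q) (hq' : q ≠ ⊤)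
    (hf : IsHeatFlow q μ f₀ f) {σ : ℝ → ℝ} (hm : Measurable σ) (h0 : ∀ r, 0 ≤ σ r)
    (hi : ∀ a b, IntervalIntegrable σ volume a b) {t : ℝ} (ht : 0 < t) :
    ∫⁻ x, ENNReal.ofReal (primitive (primitive σ) (f t x)) ∂μ +
      ∫⁻ s in Set.Ioc 0 t, ∫⁻ x, ENNReal.ofReal (σ (f s x)) *
        ‖relaxedSlope q μ (f s) x‖ₑ ^ q.toReal ∂μ =
      ∫⁻ x, ENNReal.ofReal (primitive (primitive σ) (f₀ x)) ∂μ := by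
  set ρ : ℕ → ℝ → ℝ := fun n s => min (σ s) n with hρ
  have hρ0 : ∀ n s, 0 ≤ ρ n s := fun n s => le_min (h0 s) (Nat.cast_nonneg n)
  have hb : ∀ n s, |ρ n s| ≤ (n : ℝ≥0) := fun n s => by
    rw [abs_of_nonneg (hρ0 n s)]
    exact min_le_right _ _
  have hmm : ∀ n, Measurable (ρ n) := fun n => hm.min measurable_const
  have hlip := fun n => lipschitzWith_primitive (hmm n) (hb n)
  have he : ∀ n : ℕ, IsSmoothIntegrand μ (primitive (primitive (ρ n))) (primitive (ρ n)) n :=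
    fun n => ⟨hlip n, primitive_remainder_le (hlip n),
      .inl ⟨primitive_zero _, primitive_zero _⟩⟩
  have hlim := monotone_tendsto_primitive_primitive hm h0 hi
  have hpos : ∀ n r, 0 ≤ primitive (primitive (ρ n)) r := fun n r => by
    have h1 := (hlim r).1 (Nat.zero_le n)
    have h2 : primitive (primitive fun s => min (σ s) ((0 : ℕ) : ℝ)) r = 0 := by
      simp [primitive, h0]
    simp only [h2] at h1
    exact h1
  set P : ℕ → ℝ → ℝ := fun n s => ∫ x, ρ n (f s x) * |relaxedSlope q μ (f s) x| ^ q.toReal ∂μ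
  have hP : ∀ n s, ENNReal.ofReal (P n s) = ∫⁻ x, ENNReal.ofReal (ρ n (f s x)) *
      ‖relaxedSlope q μ (f s) x‖ₑ ^ q.toReal ∂μ := fun n s =>
    ofReal_integral_mul_rpow hq hq' (hmm n) (hρ0 n) (hb n) _ _
  have hdiss := fun n => (he n).lintegral_dissipation hf.tendsto hf.locLip (P := P n) (by
    filter_upwards [hf.deriv_mem] with s ⟨l, hl, hd⟩
    refine ⟨integral_nonneg fun x => mul_nonneg (hρ0 n _) (by positivity), _, hd, ?_⟩
    rw [inner_neg_right, real_inner_comm, inner_superpose_primitive hq hq' hl (hmm n) (hb n)]) ht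
  have hid : ∀ n, ∫⁻ x, ENNReal.ofReal (primitive (primitive (ρ n)) (f t x)) ∂μ +
      ∫⁻ s in Set.Ioc 0 t, ENNReal.ofReal (P n s) =
      ∫⁻ x, ENNReal.ofReal (primitive (primitive (ρ n)) (f₀ x)) ∂μ := fun n => by
    rw [(hdiss n).2.2, ← ofReal_integral_eq_lintegral_ofReal ((he n).integrable _)
        (Eventually.of_forall fun x => hpos n _),
      ← ofReal_integral_eq_lintegral_ofReal ((he n).integrable _)
        (Eventually.of_forall fun x => hpos n _),
      ← ENNReal.ofReal_add (integral_nonneg fun x => hpos n _) (sub_nonneg.2 (hdiss n).1),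
      add_sub_cancel]
  have hlimE : ∀ u : Lp ℝ 2 μ, Tendsto
      (fun n => ∫⁻ x, ENNReal.ofReal (primitive (primitive (ρ n)) (u x)) ∂μ) atTop
      (𝓝 (∫⁻ x, ENNReal.ofReal (primitive (primitive σ) (u x)) ∂μ)) := fun u =>
    lintegral_tendsto_of_tendsto_of_monotone
      (fun n => ((he n).continuous.measurable.comp
        (Lp.stronglyMeasurable u).measurable).ennreal_ofReal.aemeasurable)
      (Eventually.of_forall fun x m n hmn => ENNReal.ofReal_le_ofReal ((hlim (u x)).1 hmn))
      (Eventually.of_forall fun x => ENNReal.tendsto_ofReal (hlim (u x)).2)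
  have hmonoρ : ∀ r, Monotone fun n => ENNReal.ofReal (ρ n r) := fun r m n hmn =>
    ENNReal.ofReal_le_ofReal (min_le_min_left _ (Nat.cast_le.2 hmn))
  have hlimρ : ∀ r, Tendsto (fun n => ENNReal.ofReal (ρ n r)) atTop
      (𝓝 (ENNReal.ofReal (σ r))) := fun r => by
    obtain ⟨N, hN⟩ := exists_nat_ge (σ r)
    refine tendsto_const_nhds.congr' ?_
    filter_upwards [eventually_ge_atTop N] with n hn
    rw [hρ]
    simp only [min_eq_left (hN.trans (Nat.cast_le.2 hn))]
  have hlimP : Tendsto (fun n => ∫⁻ s in Set.Ioc 0 t, ENNReal.ofReal (P n s)) atTop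
      (𝓝 (∫⁻ s in Set.Ioc 0 t, ∫⁻ x, ENNReal.ofReal (σ (f s x)) *
        ‖relaxedSlope q μ (f s) x‖ₑ ^ q.toReal ∂μ)) := by
    refine lintegral_tendsto_of_tendsto_of_monotone
      (fun n => (hdiss n).2.1.ennreal_ofReal)
      (Eventually.of_forall fun s m n hmn => ?_) (Eventually.of_forall fun s => ?_)
    · simp only [hP]
      exact lintegral_mono fun x => mul_le_mul_left (hmonoρ _ hmn) _
    · simp only [hP]
      have ham : Measurable fun x => ‖relaxedSlope q μ (f s) x‖ₑ ^ q.toReal :=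
        (Lp.stronglyMeasurable _).measurable.enorm.pow_const _
      refine lintegral_tendsto_of_tendsto_of_monotone
        (fun n => (((hmm n).comp (Lp.stronglyMeasurable _).measurable).ennreal_ofReal.mul
          ham).aemeasurable)
        (Eventually.of_forall fun x m n hmn => mul_le_mul_left (hmonoρ _ hmn) _)
        (Eventually.of_forall fun x => ?_)
      exact ENNReal.Tendsto.mul_const (hlimρ _)
        (.inr (ENNReal.rpow_ne_top_of_nonneg ENNReal.toReal_nonneg enorm_ne_top))
  have hfin := (hlimE (f t)).add hlimP
  simp only [hid] at hfin
  exact tendsto_nhds_unique hfin (hlimE f₀)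

/-- Up to an affine function, `e` is the second primitive of its second derivative. The integral of
the affine part is preserved if `μ` is finite; otherwise the affine part vanishes. -/
lemma IsHeatFlow.energy_identity [SFinite μ] (hq : 1 < q) (hq' : q ≠ ⊤)
    (hf : IsHeatFlow q μ f₀ f) {e : ℝ → ℝ} (he0 : ∀ r, 0 ≤ e r) (hconv : ConvexOn ℝ Set.univ e)
    (hd : Differentiable ℝ e) (hAC : ∀ a b : ℝ, AbsolutelyContinuousOnInterval (deriv e) a b)
    (hfin : ∫⁻ x, ENNReal.ofReal (e (f₀ x)) ∂μ < ⊤) {t : ℝ} (ht : 0 ≤ t) :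
    ∫⁻ x, ENNReal.ofReal (e (f t x)) ∂μ +
      ∫⁻ s in Set.Ioc 0 t, ∫⁻ x, ENNReal.ofReal (deriv (deriv e) (f s x)) *
        ‖relaxedSlope q μ (f s) x‖ₑ ^ q.toReal ∂μ = ∫⁻ x, ENNReal.ofReal (e (f₀ x)) ∂μ := by
  rcases ht.eq_or_lt with rfl | ht
  · simp [hf.init]
  have hmono : Monotone (deriv e) := by
    have h1 := hconv.monotoneOn_deriv fun r _ => hd r
    rwa [monotoneOn_univ] at h1
  have hσ0 : ∀ r, 0 ≤ deriv (deriv e) r := fun r => hmono.deriv_nonneg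
  have hcd : Continuous (deriv e) := continuous_iff_continuousAt.2 fun r =>
    ((hAC (r - 1) (r + 1)).continuousOn).continuousAt
      (by rw [Set.uIcc_of_le (by linarith)]; exact Icc_mem_nhds (by linarith) (by linarith))
  have hprim : ∀ r, e r = primitive (primitive (deriv (deriv e))) r + (e 0 + deriv e 0 * r) := by
    intro r
    have h1 : primitive (deriv (deriv e)) = fun s => deriv e s - deriv e 0 := funext fun s =>
      (hAC 0 s).integral_deriv_eq_sub
    have h2 : ∫ s in (0 : ℝ)..r, deriv e s = e r - e 0 :=
      intervalIntegral.integral_deriv_eq_sub (fun s _ => hd s) (hcd.intervalIntegrable _ _)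
    rw [h1, primitive, intervalIntegral.integral_sub (hcd.intervalIntegrable _ _)
      intervalIntegrable_const, h2, intervalIntegral.integral_const, smul_eq_mul]
    ring
  have hid := hf.energy_identity_primitive hq hq' (measurable_deriv (deriv e)) hσ0
    (fun a b => (hAC a b).intervalIntegrable_deriv) ht
  set E := primitive (primitive (deriv (deriv e))) with hE
  set D := ∫⁻ s in Set.Ioc 0 t, ∫⁻ x, ENNReal.ofReal (deriv (deriv e) (f s x)) *
    ‖relaxedSlope q μ (f s) x‖ₑ ^ q.toReal ∂μ with hD
  have hE0 : ∀ r, 0 ≤ E r := fun r => by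
    have h1 := (monotone_tendsto_primitive_primitive (measurable_deriv (deriv e)) hσ0
      (fun a b => (hAC a b).intervalIntegrable_deriv) r)
    have h2 := h1.1.ge_of_tendsto h1.2 0
    have h3 : primitive (primitive fun s => min (deriv (deriv e) s) ((0 : ℕ) : ℝ)) r = 0 := by
      simp [primitive, hσ0]
    rwa [h3] at h2
  by_cases hμ : μ Set.univ = ⊤
  · -- finiteness of the energy forces `e 0 = 0`, so that `0` is a minimum of `e`
    have h0 : e 0 = 0 := by
      by_contra hcon
      refine hfin.ne (lintegral_comp_eq_top (e := fun r => ENNReal.ofReal (e r))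
        (ENNReal.continuous_ofReal.comp hd.continuous).lowerSemicontinuous ?_ hμ f₀)
      exact (ENNReal.ofReal_pos.2 (lt_of_le_of_ne (he0 0) (Ne.symm hcon))).ne'
    have h1 : deriv e 0 = 0 :=
      IsLocalMin.deriv_eq_zero (Eventually.of_forall fun r => by rw [h0]; exact he0 r)
    have h2 : e = E := funext fun r => by rw [hprim r, h0, h1]; ring
    have h3 : ∀ u : Lp ℝ 2 μ, ∫⁻ x, ENNReal.ofReal (e (u x)) ∂μ =
        ∫⁻ x, ENNReal.ofReal (E (u x)) ∂μ := fun u => by simp only [congrFun h2]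
    rw [h3, h3]
    exact hid
  · have hμ' : μ Set.univ < ⊤ := lt_top_iff_ne_top.2 hμ
    have : IsFiniteMeasure μ := ⟨hμ'⟩
    have hEe : ∀ r, E r = e r - (e 0 + deriv e 0 * r) := fun r => by rw [hprim r]; ring
    have hEc : Continuous E := by
      rw [funext hEe]
      exact hd.continuous.sub (continuous_const.add (continuous_const.mul continuous_id))
    have hL1 : ∀ u : Lp ℝ 2 μ, Integrable u μ := fun u => (Lp.memLp u).integrable (by norm_num)
    have haff : ∀ u : Lp ℝ 2 μ, Integrable (fun x => e 0 + deriv e 0 * u x) μ := fun u =>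
      (integrable_const _).add ((hL1 u).const_mul _)
    have hmass : ∫ x, (e 0 + deriv e 0 * f t x) ∂μ = ∫ x, (e 0 + deriv e 0 * f₀ x) ∂μ := by
      rw [integral_add (integrable_const _) ((hL1 _).const_mul _),
        integral_add (integrable_const _) ((hL1 _).const_mul _), integral_const_mul,
        integral_const_mul, hf.integral_eq hq hq' hμ' ht.le]
    have hint0 : Integrable (fun x => e (f₀ x)) μ :=
      (lintegral_ofReal_ne_top_iff_integrable
        (hd.continuous.comp_aestronglyMeasurable (Lp.aestronglyMeasurable f₀))
        (Eventually.of_forall fun x => he0 _)).1 hfin.ne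
    have hintE0 : Integrable (fun x => E (f₀ x)) μ := by
      simp only [hEe]
      exact hint0.sub (haff f₀)
    have hE0fin : ∫⁻ x, ENNReal.ofReal (E (f₀ x)) ∂μ ≠ ⊤ :=
      (lintegral_ofReal_ne_top_iff_integrable hintE0.aestronglyMeasurable
        (Eventually.of_forall fun x => hE0 _)).2 hintE0
    have hintEt : Integrable (fun x => E (f t x)) μ :=
      (lintegral_ofReal_ne_top_iff_integrable
        (hEc.comp_aestronglyMeasurable (Lp.aestronglyMeasurable _))
        (Eventually.of_forall fun x => hE0 _)).1 (ne_top_of_le_ne_top hE0fin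
          (le_self_add.trans hid.le))
    have hintt : Integrable (fun x => e (f t x)) μ :=
      (hintEt.add (haff (f t))).congr (Eventually.of_forall fun x => (hprim _).symm)
    have hsplit : ∀ u : Lp ℝ 2 μ, Integrable (fun x => E (u x)) μ →
        ∫ x, e (u x) ∂μ = ∫ x, E (u x) ∂μ + ∫ x, (e 0 + deriv e 0 * u x) ∂μ := fun u hu => by
      rw [← integral_add hu (haff u)]
      exact integral_congr_ae (Eventually.of_forall fun x => hprim _)
    have hDfin : D ≠ ⊤ := ne_top_of_le_ne_top hE0fin (le_add_self.trans hid.le)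
    rw [← ofReal_integral_eq_lintegral_ofReal hintEt (Eventually.of_forall fun x => hE0 _),
      ← ofReal_integral_eq_lintegral_ofReal hintE0 (Eventually.of_forall fun x => hE0 _),
      ← ENNReal.ofReal_toReal hDfin, ← ENNReal.ofReal_add (integral_nonneg fun x => hE0 _)
        ENNReal.toReal_nonneg, ENNReal.ofReal_eq_ofReal_iff
        (add_nonneg (integral_nonneg fun x => hE0 _) ENNReal.toReal_nonneg)
        (integral_nonneg fun x => hE0 _)] at hid
    rw [← ofReal_integral_eq_lintegral_ofReal hintt (Eventually.of_forall fun x => he0 _),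
      ← ofReal_integral_eq_lintegral_ofReal hint0 (Eventually.of_forall fun x => he0 _),
      ← ENNReal.ofReal_toReal hDfin, ← ENNReal.ofReal_add (integral_nonneg fun x => he0 _)
        ENNReal.toReal_nonneg, hsplit _ hintEt, hsplit _ hintE0, hmass, ← hid]
    congr 1
    ring

end

end QHeat

end

theorem mainTheorem3 {M : Type*} [MetricSpace M] [ProperSpace M] [MeasurableSpace M]
    [BorelSpace M] (μ : Measure M) [IsLocallyFiniteMeasure μ]
    (q : ℝ≥0∞) [Fact (1 ≤ q)] (hq : 1 < q) (hq' : q ≠ ⊤)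
    (f₀ g₀ : Lp ℝ 2 μ) (f g : ℝ → Lp ℝ 2 μ)
    (hf : QHeat.IsHeatFlow q μ f₀ f) (hg : QHeat.IsHeatFlow q μ g₀ g) :
    -- comparison principle
    ((∀ C : ℝ, (∀ᵐ x ∂μ, f₀ x ≤ C) → ∀ t : ℝ, 0 ≤ t → ∀ᵐ x ∂μ, f t x ≤ C) ∧
      (∀ c : ℝ, (∀ᵐ x ∂μ, c ≤ f₀ x) → ∀ t : ℝ, 0 ≤ t → ∀ᵐ x ∂μ, c ≤ f t x) ∧
      (∀ C : ℝ, (∀ᵐ x ∂μ, f₀ x ≤ g₀ x + C) →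
        ∀ t : ℝ, 0 ≤ t → ∀ᵐ x ∂μ, f t x ≤ g t x + C)) ∧
    -- contraction of integral functionals, whenever these are well defined on `L²`
    (∀ e : ℝ → EReal, (∃ l : ℝ, ∀ r, ((-l : ℝ) : EReal) ≤ e r) → QHeat.IsConvex e →
      LowerSemicontinuous e → (∀ h : Lp ℝ 2 μ, QHeat.negPart μ e h < ⊤) →
      ∀ t : ℝ, 0 ≤ t →
        QHeat.energy μ e (f t) ≤ QHeat.energy μ e f₀ ∧
        QHeat.energy μ e (f t - g t) ≤ QHeat.energy μ e (f₀ - g₀)) ∧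
    -- contraction in `L^r`
    (∀ r : ℝ≥0∞, 1 ≤ r → MemLp f₀ r μ → MemLp g₀ r μ → ∀ t : ℝ, 0 ≤ t →
      MemLp (f t) r μ ∧ MemLp (g t) r μ ∧
        eLpNorm (f t - g t : Lp ℝ 2 μ) r μ ≤ eLpNorm (f₀ - g₀ : Lp ℝ 2 μ) r μ) ∧
    -- energy identity
    (∀ e : ℝ → ℝ, (∀ r, 0 ≤ e r) → ConvexOn ℝ Set.univ e → Differentiable ℝ e →
      (∀ a b : ℝ, AbsolutelyContinuousOnInterval (deriv e) a b) →
      ∫⁻ x, ENNReal.ofReal (e (f₀ x)) ∂μ < ⊤ →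
      ∀ t : ℝ, 0 ≤ t →
        ∫⁻ x, ENNReal.ofReal (e (f t x)) ∂μ +
          ∫⁻ s in Set.Ioc 0 t, ∫⁻ x, ENNReal.ofReal (deriv (deriv e) (f s x)) *
            ‖QHeat.relaxedSlope q μ (f s) x‖ₑ ^ q.toReal ∂μ
          = ∫⁻ x, ENNReal.ofReal (e (f₀ x)) ∂μ) ∧
    -- mass preservation
    (μ Set.univ < ⊤ → ∀ t : ℝ, 0 ≤ t → ∫ x, f t x ∂μ = ∫ x, f₀ x ∂μ) := by
  have hz := QHeat.isHeatFlow_zero (μ := μ) hq hq'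
  refine ⟨⟨fun C h t ht => ?_, fun c h t ht => ?_, fun C h t ht => ?_⟩,
    fun e hl he hlsc hneg t ht => ⟨?_, hf.energy_sub_le hq hq' hg hl he hlsc hneg ht⟩,
    fun r hr hfr hgr t ht => ⟨hf.memLp hq hq' hr hfr ht, hg.memLp hq hq' hr hgr ht,
      hf.eLpNorm_sub_le hq hq' hg hr ht⟩,
    fun e he0 hconv hd hAC hfin t ht => hf.energy_identity hq hq' he0 hconv hd hAC hfin ht,
    fun hμ t ht => hf.integral_eq hq hq' hμ ht⟩
  · simpa using hf.sub_mem hq hq' hz isClosed_Iic (convex_Iic C) (by simpa using h) ht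
  · simpa using hf.sub_mem hq hq' hz isClosed_Ici (convex_Ici c) (by simpa using h) ht
  · have h0 : ∀ᵐ x ∂μ, (f₀ - g₀ : Lp ℝ 2 μ) x ∈ Set.Iic C := by
      filter_upwards [h, Lp.coeFn_sub f₀ g₀] with x hx hx'
      rw [hx', Pi.sub_apply, Set.mem_Iic]
      linarith
    filter_upwards [hf.sub_mem hq hq' hg isClosed_Iic (convex_Iic C) h0 ht,
      Lp.coeFn_sub (f t) (g t)] with x hx hx'
    rw [hx', Pi.sub_apply, Set.mem_Iic] at hx
    linarith
  · simpa using hf.energy_sub_le hq hq' hz hl he hlsc hneg ht
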